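/- Let $k$ be an algebraically closed field of characteristic zero, $n\ge 0$, and let $K=k(t,x_1,\dots,x_n)$ with the derivations $\partial_t,\partial_{x_1},\dots,\partial_{x_n}$. Let $U$ be any differential field extension of $K$ with commuting derivations (for example the universal one). An $f\in U$ is *D-finite* over $K$ if for every $\delta\in\{\partial_t,\partial_{x_1},\dots,\partial_{x_n}\}$ there is a nonzero $L_\delta\in K\langle\delta\rangle$ with $L_\delta(f)=0$. A *form* is an expression $\omega=\sum_{I\subseteq\{1,\dots,n\}}f_I\,dx_I$ with D-finite $f_I\in U$, where $dx_I=dx_{i_1}\wedge\cdots\wedge dx_{i_r}$ for $I=\{i_1<\dots<i_r\}$; it is a $p$-form if $f_I=0$ whenever $|I|\ne p$ (so the only $(-1)$-form is $0$). Differential operators act on forms coefficientwise. For $0\le s\le n$ put $d_s\omega=\sum_{j=1}^s dx_j\wedge\partial_{x_j}(\omega)$, and $d=d_n$. For a set $S$ of letters among $t,x_1,\dots,x_n,\partial_t,\partial_{x_1},\dots,\partial_{x_n}$, let $k\langle S\rangle$ be the $k$-algebra of differential operators generated by $S$. A form $\omega$ is *closed* if $d\omega=0$, *exact* if $\omega=d\eta$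 for some form $\eta$, and *$\partial_t$-closed* (*$\partial_t$-exact*) if $L(\omega)$ is closed (exact) for some nonzero $L\in k(t)\langle\partial_t\rangle$. A *telescoper* for $\omega$ is a nonzero $L\in k(t)\langle\partial_t\rangle$ such that $L(\omega)$ is exact. **Theorem.** 1. Let $0\le s\le n$, $p\ge 0$, and let $V\subset\{x_{s+1},\dots,x_n,\partial_{x_{s+1}},\dots,\partial_{x_n}\}$ with $|V|=n-s$. (a) For every $p$-form $\omega$ with $d_s\omega=0$ there are a nonzero $L\in k\langle\{t,\partial_t\}\cup V\rangle$ and a $(p-1)$-form $\mu$ with $L(\omega)=d_s\mu$. (b) Such $L$ and $\mu$ can be computed. Precisely: let $k_0\subseteq k$ be a subfield with a coding of its elements by natural numbers for which the field operations are computable, and represent operators over $k_0$ by finite $k_0$-linear combinations of words in the letters. Then there is a partial recursive procedure which, given for every $\delta\in\{\partial_t,\partial_{x_1},\dots,\partial_{x_n}\}$ and every $I\subseteq\{1,\dots,n\}$ a nonzero operator $A_{\delta,I}\in k_0[t,x_1,\dots,x_n]\langle\delta\rangle$, terminates and returns a nonzero $L\in k_0\langle\{t,\partial_t\}\cup V\rangle$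 and operators $M_{J,I}\in k_0\langle t,x_1,\dots,x_n,\partial_t,\partial_{x_1},\dots,\partial_{x_n}\rangle$ $(I,J\subseteq\{1,\dots,n\})$ such that, for every $p$-form $\omega=\sum_I f_I\,dx_I$ with $d_s\omega=0$ and $A_{\delta,I}(f_I)=0$ for all $\delta$ and $I$, the form $\mu=\sum_J\bigl(\sum_I M_{J,I}(f_I)\bigr)dx_J$ is a $(p-1)$-form and $L(\omega)=d_s\mu$. 2. (Parametrized Poincaré lemma.) Every $\partial_t$-closed form is $\partial_t$-exact. 3. A form $\omega$ has a telescoper if and only if $L(d\omega)=0$ for some nonzero $L\in k(t)\langle\partial_t\rangle$. -/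

import Mathlib

universe u v

noncomputable section

/-- The field `K = k(t, x₁, …, xₙ)` of rational functions in `n + 1` variables.
The variable with index `0` is `t`; the variable with index `i ≥ 1` is `xᵢ`. -/
abbrev RatFun (k : Type u) [Field k] (n : ℕ) : Type u :=
  FractionRing (MvPolynomial (Fin (n + 1)) k)

/-- The variable with index `a`, as an element of `K`. -/
def RatFun.var (k : Type u) [Field k] (n : ℕ) (a : Fin (n + 1)) : RatFun k n :=
  algebraMap (MvPolynomial (Fin (n + 1)) k) (RatFun k n) (MvPolynomial.X a)

/-- The structure of a differential field extension of `(k(t, x₁, …, xₙ), ∂_t, ∂_{x₁}, …, ∂_{xₙ})`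
on a field extension `U` of `k(t, x₁, …, xₙ)`: commuting derivations `∂_a` of `U` that restrict to
the partial derivations of `k(t, x₁, …, xₙ)`. (A derivation of `U` that vanishes on `k` is
determined on `k(t, x₁, …, xₙ)` by its values at the variables, which are prescribed here.) -/
structure DiffExt (k : Type u) [Field k] (n : ℕ) (U : Type v) [Field U] [Algebra k U]
    [Algebra (RatFun k n) U] where
  der : Fin (n + 1) → Derivation k U U
  der_comm : ∀ (a b : Fin (n + 1)) (f : U), der a (der b f) = der b (der a f)
  der_var : ∀ a b : Fin (n + 1),
    der a (algebraMap (RatFun k n) U (RatFun.var k n b)) = if a = b then 1 else 0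

/-- The letters `t, x₁, …, xₙ` (`Sum.inl 0, Sum.inl 1, …, Sum.inl n`) and
`∂_t, ∂_{x₁}, …, ∂_{xₙ}` (`Sum.inr 0, Sum.inr 1, …, Sum.inr n`). -/
abbrev Letter (n : ℕ) : Type := Fin (n + 1) ⊕ Fin (n + 1)

/-- The index of the variable to which a letter belongs: `0` for `t` and `∂_t`, and `i` for
`xᵢ` and `∂_{xᵢ}`. -/
def Letter.index {n : ℕ} (l : Letter n) : ℕ :=
  match l with
  | Sum.inl a => a
  | Sum.inr a => a

/-- The set `{t, ∂_t}` of letters. -/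
def Letter.tPart (n : ℕ) : Set (Letter n) := {Sum.inl 0, Sum.inr 0}

/-- The field `k(t)` inside `k(t, x₁, …, xₙ)`. -/
def RatFun.fieldT (k : Type u) [Field k] (n : ℕ) : IntermediateField k (RatFun k n) :=
  IntermediateField.adjoin k {RatFun.var k n 0}

/-- An (inhomogeneous) form `∑_I ω_I dx_I` with coefficients in `U`, given by its coefficients in
the basis of the monomials `dx_I = dx_{i₁} ∧ ⋯ ∧ dx_{i_r}`, `I = {i₁ < ⋯ < i_r}`.
The element `j : Fin n` stands for the variable `x_{j+1}`, that is, for the index `j.succ`. -/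
abbrev Form (n : ℕ) (U : Type v) : Type v := Finset (Fin n) → U

/-- A code for a differential operator with coefficients in `k₀`: a finite list of pairs
`(c, w)` with `c ∈ k₀` and `w` a word in the letters, standing for the operator `∑ c w`. -/
abbrev OpCode {k : Type u} [Field k] (k₀ : Subfield k) (n : ℕ) : Type u :=
  List (k₀ × List (Letter n))

/-- The code uses only letters from `S`, so that it is the code of an operator in `k₀⟨S⟩`. -/
def OpCode.UsesOnly {k : Type u} [Field k] {k₀ : Subfield k} {n : ℕ} (c : OpCode k₀ n)
    (S : Set (Letter n)) : Prop :=
  ∀ q ∈ c, ∀ l ∈ q.2, l ∈ S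

/-- Tables indexed by the finite set of subsets of `Fin n` are coded as finite sequences, through
an enumeration of the index set. (As the index set is finite, the enumeration that is used
does not matter for computability.) -/
instance tablePrimcodable (n : ℕ) (α : Type u) [Primcodable α] :
    Primcodable (Finset (Fin n) → α) :=
  Primcodable.ofEquiv (Fin (Fintype.card (Finset (Fin n))) → α)
    (Equiv.arrowCongr (Fintype.equivFin (Finset (Fin n))) (Equiv.refl α))

/-- A computable field: relative to the given coding of its elements by natural numbers,
the field operations are computable. (Equality is decidable on codes.) -/
structure IsComputableField (F : Type u) [Field F] [Primcodable F] : Prop where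
  add : Computable₂ (fun a b : F => a + b)
  mul : Computable₂ (fun a b : F => a * b)
  neg : Computable (fun a : F => -a)
  inv : Computable (fun a : F => a⁻¹)

namespace DiffExt

variable {k : Type u} [Field k] {n : ℕ} {U : Type v} [Field U] [Algebra k U]
  [Algebra (RatFun k n) U]

/-- Multiplication by a rational function, as an operator on `U`. -/
def mulOp (_E : DiffExt k n U) (c : RatFun k n) : Module.End k U :=
  LinearMap.mulLeft k (algebraMap (RatFun k n) U c)

/-- The operator on `U` given by a letter. -/
def letterOp (E : DiffExt k n U) : Letter n → Module.End k U
  | Sum.inl a => E.mulOp (RatFun.var k n a)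
  | Sum.inr a => (E.der a : U →ₗ[k] U)

/-- The algebra `k⟨S⟩` of differential operators generated over `k` by a set `S` of letters.
Differential operators are identified with the maps that they induce on `U`; in characteristic
zero an operator is zero as soon as it vanishes on the polynomials, so that nothing is lost. -/
def opAlg (E : DiffExt k n U) (S : Set (Letter n)) : Subalgebra k (Module.End k U) :=
  Algebra.adjoin k (E.letterOp '' S)

/-- The algebra `F⟨∂_a⟩` of differential operators in the single derivation `∂_a` with coefficients
in a field `F` between `k` and `k(t, x₁, …, xₙ)`. -/
def ratOpAlg (E : DiffExt k n U) (F : IntermediateField k (RatFun k n)) (a : Fin (n + 1)) :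
    Subalgebra k (Module.End k U) :=
  Algebra.adjoin k (insert (E.der a : U →ₗ[k] U) (E.mulOp '' (F : Set (RatFun k n))))

/-- `f` is D-finite over `K`: for each `a` it is annihilated by a nonzero operator
in `K⟨∂_a⟩`. -/
def IsDFinite (E : DiffExt k n U) (f : U) : Prop :=
  ∀ a : Fin (n + 1), ∃ L ∈ E.ratOpAlg ⊤ a, L ≠ 0 ∧ L f = 0

/-- `ω` is a form with D-finite coefficients. -/
def IsDForm (E : DiffExt k n U) (ω : Form n U) : Prop :=
  ∀ I, E.IsDFinite (ω I)

/-- `ω` is a `p`-form with D-finite coefficients. The degree is an integer, and the only form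
of negative degree is `0`. -/
def IsPForm (E : DiffExt k n U) (p : ℤ) (ω : Form n U) : Prop :=
  E.IsDForm ω ∧ ∀ I, ω I ≠ 0 → (I.card : ℤ) = p

/-- The coefficientwise action of an operator on forms. -/
def act (_E : DiffExt k n U) (L : Module.End k U) (ω : Form n U) : Form n U :=
  fun I => L (ω I)

/-- `d_s ω = ∑_{j = 1}^{s} dx_j ∧ ∂_{x_j}(ω)`, in coordinates: for `j ∈ J` one has
`dx_j ∧ dx_{J \ {j}} = (-1)^{#{i ∈ J, i < j}} dx_J`. -/
def d (E : DiffExt k n U) (s : ℕ) (ω : Form n U) : Form n U :=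
  fun J => ∑ j ∈ J with j.val < s,
    (-1) ^ (J.filter (fun i => i < j)).card * E.der j.succ (ω (J.erase j))

/-- `dω = 0`, where `d = d_n`. -/
def IsClosedForm (E : DiffExt k n U) (ω : Form n U) : Prop :=
  E.d n ω = 0

/-- `ω = dη` for some form `η` with D-finite coefficients. -/
def IsExactForm (E : DiffExt k n U) (ω : Form n U) : Prop :=
  ∃ η : Form n U, E.IsDForm η ∧ ω = E.d n η

/-- `ω` is `∂_t`-closed: `L(ω)` is closed for some nonzero `L ∈ k(t)⟨∂_t⟩`. -/
def IsTClosed (E : DiffExt k n U) (ω : Form n U) : Prop :=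
  ∃ L ∈ E.ratOpAlg (RatFun.fieldT k n) 0, L ≠ 0 ∧ E.IsClosedForm (E.act L ω)

/-- `L` is a telescoper for `ω`: it is a nonzero element of `k(t)⟨∂_t⟩` such that `L(ω)` is
exact. -/
def IsTelescoper (E : DiffExt k n U) (L : Module.End k U) (ω : Form n U) : Prop :=
  L ∈ E.ratOpAlg (RatFun.fieldT k n) 0 ∧ L ≠ 0 ∧ E.IsExactForm (E.act L ω)

/-- `ω` is `∂_t`-exact: `L(ω)` is exact for some nonzero `L ∈ k(t)⟨∂_t⟩`. -/
def IsTExact (E : DiffExt k n U) (ω : Form n U) : Prop :=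
  ∃ L, E.IsTelescoper L ω

/-- The operator `∑ c w` given by a code. -/
def evalCode (E : DiffExt k n U) {k₀ : Subfield k} (c : OpCode k₀ n) : Module.End k U :=
  (c.map (fun q => (q.1 : k) • (q.2.map E.letterOp).prod)).sum

/-- `A a I` is, for all `a` and `I`, the code of a nonzero operator in the derivation `∂_a` with
polynomial coefficients over `k₀`. -/
def IsAnnihilatorData (E : DiffExt k n U) {k₀ : Subfield k}
    (A : Fin (n + 1) → Finset (Fin n) → OpCode k₀ n) : Prop :=
  ∀ a I, (A a I).UsesOnly (insert (Sum.inr a) (Set.range Sum.inl)) ∧ E.evalCode (A a I) ≠ 0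

/-- The form `∑_J (∑_I M_{J,I}(ω_I)) dx_J` that a table of operator codes produces from `ω`. -/
def applyTable (E : DiffExt k n U) {k₀ : Subfield k}
    (M : Finset (Fin n) → Finset (Fin n) → OpCode k₀ n) (ω : Form n U) : Form n U :=
  fun J => ∑ I, E.evalCode (M J I) (ω I)

end DiffExt

end

/-! The core is an induction on `s` that trades a variable of integration for one additional letter
in `V`. For `s = 0` one has `d_0 = 0`, so `L` must annihilate the finitely many coefficients of `ω`,
and `n + 2` letters are available. This is Lipshitz's counting argument, `exists_annihilator`: up to
denominators the D-finite coefficients generate a module of finite rank over the polynomials in `n +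
1` variables. There are about `Λ^(n+2)` operator monomials with exponents at most `Λ`, and after
multiplication by a common denominator their values lie in a space of dimension `O(Λ^(n+1))`.

For the step (`exists_formD_eq`), let `x` be the new variable, `∂` its derivation, and `ω = ω₀ + dx
∧ ω₁`. Then `d_{s+1} ω = 0` means `d_s ω₀ = 0` and `∂ω₀ = d_s ω₁`. The induction hypothesis with `x`
added to `V` gives `A ω₀ = d_s μ₀`. Elimination of `x` gives `∂^r A = L₀ + P ∂` with `L₀` nonzero
and free of `x` and `∂`; since `∂ω₀` is `d_s`-exact, so is `L₀ ω₀`. Subtracting `d_{s+1}` of its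
primitive from `L₀ ω` leaves `dx ∧ η` with `d_s η = 0`. The induction hypothesis with `∂` added to
`V` gives `A' η = d_s μ₁`, elimination of `∂` gives `x^r' A' = L₁ + ∂ Q`, and `dx ∧ ∂Qη =
d_{s+1}(Qη)`. Finally `L = L₁ L₀` is nonzero because the Weyl algebra has no zero divisors.

The argument needs only a torsion-free module of finite rank over the Weyl algebra. The submodule of
`U` generated by the coefficients of `ω` yields the existence statement. For the algorithm the
module is universal (`exists_certificate`): generators `e_I`, relations `A_{a,I} e_I = 0` and `d_s e
= 0`, torsion divided out. The result is an identity in the Weyl algebra over `k₀` that proves `L ω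
= d_s μ` for all admissible `ω` at once, and the algorithm is an unbounded search for such an
identity. Candidates can be verified by search as well: vanishing in the Weyl algebra is witnessed
by the defining relations, and nonvanishing, by simplicity, by an expression of `1`.

The Poincaré lemma and the telescoper criterion are the case `s = n` with `V` empty, since operators
in `t` and `∂_t` commute with `d`, and `d² = 0`. -/

noncomputable section

/-! ### The Weyl algebra by generators and relations, and normal ordering -/

open MvPolynomial (pderiv)

/-- The commutator `[l, l']` of two letters. -/
def Letter.comm {n : ℕ} : Letter n → Letter n → ℤ
  | Sum.inr a, Sum.inl b => if a = b then 1 else 0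
  | Sum.inl a, Sum.inr b => if a = b then -1 else 0
  | _, _ => 0

/-- The element `l l' - l' l - [l, l']` of the free algebra on the letters. -/
def weylRel (F : Type u) [Field F] {n : ℕ} (l l' : Letter n) : FreeAlgebra F (Letter n) :=
  FreeAlgebra.ι F l * FreeAlgebra.ι F l' - FreeAlgebra.ι F l' * FreeAlgebra.ι F l -
    ((l.comm l' : ℤ) : FreeAlgebra F (Letter n))

/-- The two-sided ideal of the free algebra generated by the commutation relations. -/
def weylIdeal (F : Type u) [Field F] (n : ℕ) : Ideal (FreeAlgebra F (Letter n)) :=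
  Ideal.span {g | ∃ l l' v, g = weylRel F l l' * v}

/-- Each generator carries an arbitrary right factor `v`, so the left ideal spanned by them absorbs
right multiplication too. -/
instance weylIdeal.isTwoSided (F : Type u) [Field F] (n : ℕ) : (weylIdeal F n).IsTwoSided where
  mul_mem_of_left := by
    intro a b ha
    induction ha using Submodule.span_induction with
    | mem x hx =>
      obtain ⟨l, l', v, rfl⟩ := hx
      exact Ideal.subset_span ⟨l, l', v * b, mul_assoc _ _ _⟩
    | zero => simp
    | add x y _ _ hx hy => rw [add_mul]; exact add_mem hx hy
    | smul c x _ hx => rw [smul_eq_mul, mul_assoc]; exact Ideal.mul_mem_left _ _ hx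

/-- The Weyl algebra over `F` in the letters `t, x₁, …, xₙ, ∂_t, ∂_{x₁}, …, ∂_{xₙ}`. -/
def Weyl (F : Type u) [Field F] (n : ℕ) : Type u :=
  FreeAlgebra F (Letter n) ⧸ weylIdeal F n

namespace Weyl

variable {F : Type u} [Field F] {n : ℕ}

instance : Ring (Weyl F n) := inferInstanceAs (Ring (FreeAlgebra F (Letter n) ⧸ weylIdeal F n))

instance : Algebra F (Weyl F n) :=
  inferInstanceAs (Algebra F (FreeAlgebra F (Letter n) ⧸ weylIdeal F n))

/-- The quotient map from the free algebra to the Weyl algebra. -/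
def ofFree : FreeAlgebra F (Letter n) →ₐ[F] Weyl F n :=
  Ideal.Quotient.mkₐ F (weylIdeal F n)

theorem ofFree_surjective : Function.Surjective (ofFree (F := F) (n := n)) :=
  Ideal.Quotient.mkₐ_surjective F _

theorem ofFree_eq_zero_iff (x : FreeAlgebra F (Letter n)) :
    ofFree x = 0 ↔ x ∈ weylIdeal F n :=
  Ideal.Quotient.eq_zero_iff_mem

/-- The generator of the Weyl algebra given by a letter. -/
def gen (l : Letter n) : Weyl F n := ofFree (FreeAlgebra.ι F l)

theorem gen_comm (l l' : Letter n) :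
    (gen l * gen l' - gen l' * gen l : Weyl F n) = (l.comm l' : ℤ) := by
  have h : ofFree (weylRel F l l') = 0 := by
    rw [ofFree_eq_zero_iff]
    exact Ideal.subset_span ⟨l, l', 1, (mul_one _).symm⟩
  rw [weylRel, map_sub, map_sub, map_mul, map_mul, map_intCast, sub_eq_zero] at h
  exact h

section lift

variable {B : Type v} [Ring B] [Algebra F B] (g : Letter n → B)
  (h : ∀ l l', g l * g l' - g l' * g l = (l.comm l' : ℤ))

/-- The universal property of the Weyl algebra. -/
def lift : Weyl F n →ₐ[F] B :=
  Ideal.Quotient.liftₐ (weylIdeal F n) (FreeAlgebra.lift F g) (by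
    intro a ha
    induction ha using Submodule.span_induction with
    | mem x hx =>
      obtain ⟨l, l', v, rfl⟩ := hx
      have : FreeAlgebra.lift F g (weylRel F l l') = 0 := by
        simp [weylRel, h]
      rw [map_mul, this, zero_mul]
    | zero => simp
    | add x y _ _ hx hy => rw [map_add, hx, hy, add_zero]
    | smul c x _ hx => rw [smul_eq_mul, map_mul, hx, mul_zero])

theorem lift_ofFree (x : FreeAlgebra F (Letter n)) :
    lift g h (ofFree x) = FreeAlgebra.lift F g x := rfl

@[simp]
theorem lift_gen (l : Letter n) : lift g h (gen (F := F) l) = g l := by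
  rw [gen, lift_ofFree, FreeAlgebra.lift_ι_apply]

end lift

theorem adjoin_range_gen : Algebra.adjoin F (Set.range (gen (F := F) (n := n))) = ⊤ := by
  have h := FreeAlgebra.adjoin_range_ι F (Letter n)
  have h2 := congrArg (Subalgebra.map (ofFree (F := F) (n := n))) h
  rw [AlgHom.map_adjoin, ← Set.range_comp, Algebra.map_top,
    (AlgHom.range_eq_top _).2 ofFree_surjective] at h2
  exact h2

/-- A left ideal induction principle: a subspace that contains `1` and is stable under left
multiplication by the letters in `S` contains the algebra generated by `S`. -/
theorem mem_of_mem_adjoin {S : Set (Letter n)} (P : Submodule F (Weyl F n)) (h1 : 1 ∈ P)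
    (hl : ∀ l ∈ S, ∀ A ∈ P, gen l * A ∈ P) {A : Weyl F n}
    (hA : A ∈ Algebra.adjoin F (gen '' S)) : A ∈ P := by
  -- `P` is only a subspace, so products are handled through stability under left multiplication,
  -- applied to `1` at the end.
  have key : ∀ B ∈ P, A * B ∈ P := by
    induction hA using Algebra.adjoin_induction with
    | mem x hx => obtain ⟨l, hl', rfl⟩ := hx; exact hl l hl'
    | algebraMap r => intro B hB; rw [← Algebra.smul_def]; exact P.smul_mem r hB
    | add x y _ _ hx hy => intro B hB; rw [add_mul]; exact add_mem (hx B hB) (hy B hB)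
    | mul x y _ _ hx hy => intro B hB; rw [mul_assoc]; exact hx _ (hy B hB)
  simpa using key 1 h1

theorem mem_of_stable (P : Submodule F (Weyl F n)) (h1 : 1 ∈ P)
    (hl : ∀ l, ∀ A ∈ P, gen l * A ∈ P) (A : Weyl F n) : A ∈ P := by
  refine mem_of_mem_adjoin (S := Set.univ) P h1 (fun l _ => hl l) ?_
  rw [Set.image_univ, adjoin_range_gen]; trivial

end Weyl

open scoped IsMulCommutative in
/-- The homomorphism from a polynomial ring to a not necessarily commutative algebra given by
a commuting family. -/
theorem exists_aeval_of_commute {F : Type u} [Field F] {σ : Type} {B : Type v} [Ring B]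
    [Algebra F B] (g : σ → B) (hg : ∀ a b, Commute (g a) (g b)) :
    ∃ f : MvPolynomial σ F →ₐ[F] B, ∀ a, f (MvPolynomial.X a) = g a := by
  -- A commuting family generates a commutative subalgebra, where the ordinary `aeval` is available.
  have := Algebra.isMulCommutative_adjoin F (s := Set.range g) (by
    rintro _ ⟨a, rfl⟩ _ ⟨b, rfl⟩; exact hg a b)
  refine ⟨(Algebra.adjoin F (Set.range g)).val.comp (MvPolynomial.aeval
    (fun a => (⟨g a, Algebra.subset_adjoin ⟨a, rfl⟩⟩ : Algebra.adjoin F (Set.range g)))), ?_⟩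
  intro a
  rw [AlgHom.comp_apply, MvPolynomial.aeval_X]
  rfl

namespace Weyl

variable {F : Type u} [Field F] {n : ℕ}

theorem commute_of_comm {l l' : Letter n} (h : l.comm l' = 0) :
    Commute (gen l : Weyl F n) (gen l') := by
  have := gen_comm (F := F) l l'
  rw [h, Int.cast_zero, sub_eq_zero] at this
  exact this

/-- The embedding of the polynomials in the variables. -/
def ofX : MvPolynomial (Fin (n + 1)) F →ₐ[F] Weyl F n :=
  (exists_aeval_of_commute (fun a => gen (F := F) (n := n) (Sum.inl a))
    (fun _ _ => commute_of_comm rfl)).choose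

/-- The embedding of the polynomials in the derivations. -/
def ofD : MvPolynomial (Fin (n + 1)) F →ₐ[F] Weyl F n :=
  (exists_aeval_of_commute (fun a => gen (F := F) (n := n) (Sum.inr a))
    (fun _ _ => commute_of_comm rfl)).choose

@[simp]
theorem ofX_X (a : Fin (n + 1)) : ofX (MvPolynomial.X a) = gen (F := F) (Sum.inl a) :=
  (exists_aeval_of_commute (fun a => gen (F := F) (n := n) (Sum.inl a))
    (fun _ _ => commute_of_comm rfl)).choose_spec a

@[simp]
theorem ofD_X (a : Fin (n + 1)) : ofD (MvPolynomial.X a) = gen (F := F) (Sum.inr a) :=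
  (exists_aeval_of_commute (fun a => gen (F := F) (n := n) (Sum.inr a))
    (fun _ _ => commute_of_comm rfl)).choose_spec a

theorem der_mul_var (a b : Fin (n + 1)) :
    (gen (Sum.inr a) * gen (Sum.inl b) : Weyl F n) =
      gen (Sum.inl b) * gen (Sum.inr a) + if a = b then 1 else 0 := by
  have := gen_comm (F := F) (n := n) (Sum.inr a) (Sum.inl b)
  rw [sub_eq_iff_eq_add'] at this
  rw [this, Letter.comm]
  split_ifs <;> simp

/-- The commutator with `∂_a` is a derivation with the same values on the variables as `pderiv a`.
-/
theorem der_mul_ofX (a : Fin (n + 1)) (p : MvPolynomial (Fin (n + 1)) F) :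
    gen (Sum.inr a) * ofX p = ofX p * gen (Sum.inr a) + ofX (pderiv a p) := by
  induction p using MvPolynomial.induction_on with
  | C c =>
    rw [MvPolynomial.pderiv_C, map_zero, add_zero, ← MvPolynomial.algebraMap_eq,
      AlgHom.commutes, Algebra.commutes]
  | add p q hp hq => simp only [map_add, mul_add, add_mul, hp, hq]; abel
  | mul_X p b hp =>
    rw [map_mul, ← mul_assoc, hp, ofX_X, add_mul, mul_assoc, der_mul_var, Derivation.leibniz,
      MvPolynomial.pderiv_X, map_add, smul_eq_mul, smul_eq_mul, map_mul, map_mul, ofX_X,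
      mul_add, mul_assoc, Pi.single_apply]
    have : ofX (n := n) (MvPolynomial.X b) * ofX (pderiv a p) =
        ofX (pderiv a p) * ofX (n := n) (MvPolynomial.X b : MvPolynomial _ F) := by
      rw [← map_mul, mul_comm, map_mul]
    rw [ofX_X] at this
    rw [this]
    simp only [eq_comm (a := b) (b := a)]
    split_ifs
    · simp only [mul_one, map_one]; abel
    · simp

/-- The mirror image of `der_mul_ofX`: the commutator with `x_a` differentiates polynomials in the
derivations. -/
theorem ofD_mul_var (a : Fin (n + 1)) (p : MvPolynomial (Fin (n + 1)) F) :
    ofD p * gen (Sum.inl a) = gen (Sum.inl a) * ofD p + ofD (pderiv a p) := by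
  induction p using MvPolynomial.induction_on with
  | C c =>
    rw [MvPolynomial.pderiv_C, map_zero, add_zero, ← MvPolynomial.algebraMap_eq,
      AlgHom.commutes, Algebra.commutes]
  | add p q hp hq => simp only [map_add, mul_add, add_mul, hp, hq]; abel
  | mul_X p b hp =>
    rw [map_mul, mul_assoc, ofD_X, der_mul_var, mul_add, ← mul_assoc, hp, Derivation.leibniz,
      MvPolynomial.pderiv_X, map_add, smul_eq_mul, smul_eq_mul, map_mul, map_mul, ofD_X,
      add_mul, mul_assoc, Pi.single_apply]
    have : ofD (n := n) (MvPolynomial.X b) * ofD (pderiv a p) =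
        ofD (pderiv a p) * ofD (n := n) (MvPolynomial.X b : MvPolynomial _ F) := by
      rw [← map_mul, mul_comm, map_mul]
    rw [ofD_X] at this
    rw [this]
    split_ifs
    · simp only [mul_one, map_one]; abel
    · simp

theorem commute_der_ofD (a : Fin (n + 1)) (p : MvPolynomial (Fin (n + 1)) F) :
    Commute (gen (Sum.inr a)) (ofD p) := by
  rw [← ofD_X, Commute, SemiconjBy, ← map_mul, mul_comm, map_mul]

theorem commute_var_ofX (a : Fin (n + 1)) (p : MvPolynomial (Fin (n + 1)) F) :
    Commute (gen (Sum.inl a)) (ofX p) := by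
  rw [← ofX_X, Commute, SemiconjBy, ← map_mul, mul_comm, map_mul]

/-! ### The derivations dual to the letters -/

/-- The inner derivation of the Weyl algebra that sends the letter `l` to `1` and the other
letters to `0`. -/
def dual : Letter n → Weyl F n →ₗ[F] Weyl F n
  | Sum.inl a => LinearMap.mulLeft F (gen (Sum.inr a)) - LinearMap.mulRight F (gen (Sum.inr a))
  | Sum.inr a => LinearMap.mulRight F (gen (Sum.inl a)) - LinearMap.mulLeft F (gen (Sum.inl a))

theorem dual_inl (a : Fin (n + 1)) (A : Weyl F n) :
    dual (Sum.inl a) A = gen (Sum.inr a) * A - A * gen (Sum.inr a) := rfl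

theorem dual_inr (a : Fin (n + 1)) (A : Weyl F n) :
    dual (Sum.inr a) A = A * gen (Sum.inl a) - gen (Sum.inl a) * A := rfl

theorem dual_mul (l : Letter n) (A B : Weyl F n) :
    dual l (A * B) = dual l A * B + A * dual l B := by
  cases l <;> simp only [dual_inl, dual_inr] <;> noncomm_ring

/-! ### Normal ordering -/

open MvPolynomial in
/-- The linear map from polynomials in the letters to the Weyl algebra that writes the variables
to the left of the derivations. -/
def normalOrder : MvPolynomial (Letter n) F →ₗ[F] Weyl F n :=
  (MvPolynomial.basisMonomials (Letter n) F).constr F fun s =>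
    ofX (monomial (s.comapDomain Sum.inl Sum.inl_injective.injOn) 1) *
      ofD (monomial (s.comapDomain Sum.inr Sum.inr_injective.injOn) 1)

open MvPolynomial

theorem normalOrder_monomial (s : Letter n →₀ ℕ) (c : F) :
    normalOrder (monomial s c) = c •
      (ofX (monomial (s.comapDomain Sum.inl Sum.inl_injective.injOn) 1) *
        ofD (monomial (s.comapDomain Sum.inr Sum.inr_injective.injOn) 1)) := by
  have h : (monomial s c : MvPolynomial (Letter n) F) = c • monomial s 1 := by
    rw [smul_monomial, smul_eq_mul, mul_one]
  have hb := congrFun (coe_basisMonomials (Letter n) F) s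
  rw [h, map_smul, normalOrder, ← hb, Module.Basis.constr_basis]

theorem normalOrder_C (c : F) : normalOrder (n := n) (C c) = algebraMap F _ c := by
  rw [← monomial_zero', normalOrder_monomial, Algebra.algebraMap_eq_smul_one]
  have h1 : Finsupp.comapDomain (Sum.inl : Fin (n+1) → Letter n) (0 : Letter n →₀ ℕ)
      Sum.inl_injective.injOn = 0 := by ext; simp
  have h2 : Finsupp.comapDomain (Sum.inr : Fin (n+1) → Letter n) (0 : Letter n →₀ ℕ)
      Sum.inr_injective.injOn = 0 := by ext; simp
  rw [h1, h2]
  have h3 : (monomial 0 1 : MvPolynomial (Fin (n + 1)) F) = 1 := rfl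
  rw [h3, map_one, map_one, mul_one]

/-- The bracket with `∂_a` differentiates the left factor of a normally ordered product and commutes
with the right one; the bracket with `x_a` does the opposite. Inner derivations thus become partial
derivatives of commutative symbols, and degree arguments carry over to the Weyl algebra. -/
theorem dual_normalOrder (l : Letter n) (p : MvPolynomial (Letter n) F) :
    dual l (normalOrder p) = normalOrder (pderiv l p) := by
  induction p using MvPolynomial.induction_on' with
  | add p q hp hq => simp only [map_add, hp, hq]
  | monomial s c =>
    rw [pderiv_monomial, normalOrder_monomial, normalOrder_monomial, map_smul, mul_smul]
    congr 1
    rcases l with a | a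
    · rw [dual_inl, ← mul_assoc, der_mul_ofX, add_mul, mul_assoc, (commute_der_ofD a _).eq,
        ← mul_assoc, add_sub_cancel_left, pderiv_monomial, one_mul]
      have h1 : Finsupp.comapDomain (Sum.inl : Fin (n+1) → Letter n) s
          Sum.inl_injective.injOn - Finsupp.single a 1 = Finsupp.comapDomain Sum.inl
            (s - Finsupp.single (Sum.inl a) 1) Sum.inl_injective.injOn := by
        ext b; simp [Finsupp.single_apply]
      have h2 : Finsupp.comapDomain (Sum.inr : Fin (n+1) → Letter n) s
          Sum.inr_injective.injOn = Finsupp.comapDomain Sum.inr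
            (s - Finsupp.single (Sum.inl a) 1) Sum.inr_injective.injOn := by
        ext b; simp
      rw [h1, ← h2, Finsupp.comapDomain_apply, ← smul_mul_assoc, ← map_smul, smul_monomial,
        smul_eq_mul, mul_one]
    · rw [dual_inr, mul_assoc, ofD_mul_var, mul_add, ← mul_assoc, ← (commute_var_ofX a _).eq,
        mul_assoc, add_sub_cancel_left, pderiv_monomial, one_mul]
      have h1 : Finsupp.comapDomain (Sum.inr : Fin (n+1) → Letter n) s
          Sum.inr_injective.injOn - Finsupp.single a 1 = Finsupp.comapDomain Sum.inr
            (s - Finsupp.single (Sum.inr a) 1) Sum.inr_injective.injOn := by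
        ext b; simp [Finsupp.single_apply]
      have h2 : Finsupp.comapDomain (Sum.inl : Fin (n+1) → Letter n) s
          Sum.inl_injective.injOn = Finsupp.comapDomain Sum.inl
            (s - Finsupp.single (Sum.inr a) 1) Sum.inl_injective.injOn := by
        ext b; simp
      rw [h1, ← h2, Finsupp.comapDomain_apply, ← mul_smul_comm, ← map_smul, smul_monomial,
        smul_eq_mul, mul_one]

theorem X_mul_monomial_eq {σ : Type} (a : σ) (s : σ →₀ ℕ) (c : F) :
    (X a * monomial s c : MvPolynomial σ F) = monomial (Finsupp.single a 1 + s) c := by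
  rw [X, monomial_mul, one_mul]

theorem pderiv_pderiv_comm {σ : Type} (a b : σ) (p : MvPolynomial σ F) :
    pderiv a (pderiv b p) = pderiv b (pderiv a p) := by
  classical
  ext m
  simp only [coeff_pderiv, Finsupp.add_apply, Finsupp.single_apply, eq_comm (a := b),
    add_right_comm m]
  split_ifs with h
  · subst h; rfl
  · push_cast; ring

theorem var_mul_normalOrder (a : Fin (n + 1)) (p : MvPolynomial (Letter n) F) :
    gen (Sum.inl a) * normalOrder p = normalOrder (X (Sum.inl a) * p) := by
  induction p using MvPolynomial.induction_on' with
  | add p q hp hq => simp only [map_add, mul_add, hp, hq]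
  | monomial s c =>
    rw [X_mul_monomial_eq, normalOrder_monomial, normalOrder_monomial, mul_smul_comm, ← mul_assoc,
      ← ofX_X, ← map_mul, X_mul_monomial_eq]
    congr 5
    · ext b; simp [Finsupp.single_apply]
    · ext b; simp

theorem der_mul_normalOrder (a : Fin (n + 1)) (p : MvPolynomial (Letter n) F) :
    gen (Sum.inr a) * normalOrder p =
      normalOrder (X (Sum.inr a) * p + pderiv (Sum.inl a) p) := by
  rw [map_add, ← dual_normalOrder, dual_inl, ← sub_eq_iff_eq_add, sub_sub_cancel]
  induction p using MvPolynomial.induction_on' with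
  | add p q hp hq => simp only [map_add, mul_add, add_mul, hp, hq]
  | monomial s c =>
    rw [X_mul_monomial_eq, normalOrder_monomial, normalOrder_monomial, smul_mul_assoc, mul_assoc,
      ← ofD_X, ← map_mul, mul_comm (monomial _ _), X_mul_monomial_eq]
    congr 5
    · ext b; simp
    · ext b; simp [Finsupp.single_apply]

theorem normalOrder_surjective : Function.Surjective (normalOrder (F := F) (n := n)) := by
  intro A
  refine mem_of_stable (LinearMap.range normalOrder) ⟨1, ?_⟩ ?_ A
  · simpa using normalOrder_C (F := F) (n := n) 1
  · rintro l _ ⟨p, rfl⟩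
    rcases l with a | a
    · exact ⟨_, (var_mul_normalOrder a p).symm⟩
    · exact ⟨_, (der_mul_normalOrder a p).symm⟩

/-- The Weyl algebra acts on the polynomials in the letters, by left multiplication
under normal ordering. -/
theorem exists_symbol : ∃ f : Weyl F n →ₗ[F] MvPolynomial (Letter n) F,
    ∀ p, f (normalOrder p) = p := by
  -- The formulas are dictated by `var_mul_normalOrder` and `der_mul_normalOrder`: left
  -- multiplication by a letter, written on symbols. Verifying the relations directly avoids
  -- presupposing that symbols are unique; evaluation at `1` then recovers the symbol.
  let g : Letter n → Module.End F (MvPolynomial (Letter n) F) := fun l =>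
    match l with
    | Sum.inl a => LinearMap.mulLeft F (X (Sum.inl a))
    | Sum.inr a => LinearMap.mulLeft F (X (Sum.inr a)) +
        (pderiv (Sum.inl a) : Derivation F (MvPolynomial (Letter n) F) _).toLinearMap
  have hg : ∀ l l', g l * g l' - g l' * g l = (l.comm l' : ℤ) := by
    intro l l'
    refine LinearMap.ext fun p => ?_
    rcases l with a | a <;> rcases l' with b | b <;>
      simp only [g, Letter.comm, LinearMap.sub_apply, Module.End.mul_apply, LinearMap.add_apply,
        LinearMap.mulLeft_apply, Derivation.coeFn_coe,
        Derivation.leibniz, pderiv_X, smul_eq_mul, map_add, Pi.single_apply, reduceCtorEq,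
        if_false, mul_zero, add_zero, Int.cast_zero, LinearMap.zero_apply, Sum.inl.injEq]
    · ring
    · rcases eq_or_ne a b with rfl | h
      · simp; ring
      · simp [h]; ring
    · rcases eq_or_ne a b with rfl | h
      · simp; ring
      · simp [h, h.symm]; ring
    · rw [pderiv_pderiv_comm]; ring
  let r := lift (F := F) g hg
  have hX : ∀ p q : MvPolynomial (Fin (n + 1)) F, r (ofX p) (rename Sum.inr q) =
      rename Sum.inl p * rename Sum.inr q := by
    intro p
    induction p using MvPolynomial.induction_on with
    | C c =>
      intro q
      rw [← MvPolynomial.algebraMap_eq, AlgHom.commutes, AlgHom.commutes, AlgHom.commutes,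
        Module.algebraMap_end_apply, Algebra.smul_def]
    | add p p' hp hp' =>
      intro q; simp only [map_add, LinearMap.add_apply, hp, hp', add_mul]
    | mul_X p b hp =>
      intro q
      rw [mul_comm p, map_mul, map_mul, Module.End.mul_apply, hp, ofX_X, lift_gen,
        map_mul (rename Sum.inl), rename_X, mul_assoc]
      rfl
  have hD : ∀ q : MvPolynomial (Fin (n + 1)) F, r (ofD q) 1 = rename Sum.inr q := by
    intro q
    induction q using MvPolynomial.induction_on with
    | C c =>
      rw [← MvPolynomial.algebraMap_eq, AlgHom.commutes, AlgHom.commutes, AlgHom.commutes,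
        Module.algebraMap_end_apply, Algebra.smul_def, mul_one]
    | add p p' hp hp' => simp only [map_add, LinearMap.add_apply, hp, hp']
    | mul_X p b hp =>
      rw [mul_comm p, map_mul, map_mul, Module.End.mul_apply, hp, ofD_X, lift_gen,
        map_mul (rename Sum.inr), rename_X]
      -- This symbol contains only derivation letters, so the correction term of `g` disappears.
      have : pderiv (Sum.inl b) (rename (Sum.inr : Fin (n + 1) → Letter n) p) = 0 := by
        apply pderiv_eq_zero_of_notMem_vars
        intro h
        have := vars_rename (Sum.inr : Fin (n + 1) → Letter n) p h
        simp at this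
      simp [g, this]
  refine ⟨(LinearMap.applyₗ (1 : MvPolynomial (Letter n) F)).comp r.toLinearMap, fun p => ?_⟩
  induction p using MvPolynomial.induction_on' with
  | add p q hp hq => rw [map_add, map_add, hp, hq]
  | monomial s c =>
    rw [normalOrder_monomial, map_smul]
    simp only [LinearMap.comp_apply, AlgHom.toLinearMap_apply, LinearMap.applyₗ_apply_apply,
      map_mul, Module.End.mul_apply]
    rw [hD, hX, rename_monomial, rename_monomial, monomial_mul, smul_monomial]
    congr 2
    · ext l
      rcases l with a | a
      · rw [Finsupp.add_apply, Finsupp.mapDomain_apply Sum.inl_injective,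
          Finsupp.mapDomain_of_notMem_range]
        · simp
        · simp
      · rw [Finsupp.add_apply, Finsupp.mapDomain_apply Sum.inr_injective,
          Finsupp.mapDomain_of_notMem_range]
        · simp
        · simp
    · simp

theorem normalOrder_injective : Function.Injective (normalOrder (F := F) (n := n)) := by
  obtain ⟨f, hf⟩ := exists_symbol (F := F) (n := n)
  exact Function.LeftInverse.injective hf

instance : Nontrivial (Weyl F n) := normalOrder_injective.nontrivial

end Weyl
end

/-! ### Characteristic zero: no zero divisors, simplicity, faithful actions -/

noncomputable section

open MvPolynomial

theorem MvPolynomial.add_single_mem_support_of_mem_support_pderiv {F : Type u} [Field F]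
    {σ : Type} {p : MvPolynomial σ F} {i : σ} {m : σ →₀ ℕ} (hm : m ∈ (pderiv i p).support) :
    m + Finsupp.single i 1 ∈ p.support := by
  rw [mem_support_iff, coeff_pderiv] at hm
  rw [mem_support_iff]
  exact left_ne_zero_of_mul hm

theorem MvPolynomial.totalDegree_pderiv_le {F : Type u} [Field F] {σ : Type}
    (p : MvPolynomial σ F) (i : σ) : (pderiv i p).totalDegree ≤ p.totalDegree - 1 := by
  refine Finset.sup_le fun m hm => ?_
  have := le_totalDegree (add_single_mem_support_of_mem_support_pderiv hm)
  rw [Finsupp.sum_add_index' (by simp) (by simp), Finsupp.sum_single_index rfl] at this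
  omega

theorem MvPolynomial.exists_eq_C_of_pderiv_eq_zero {F : Type u} [Field F] [CharZero F]
    {σ : Type} {p : MvPolynomial σ F} (h : ∀ i, pderiv i p = 0) : ∃ c, p = C c := by
  classical
  refine ⟨coeff 0 p, ?_⟩
  ext m
  rw [coeff_C]
  split_ifs with hm
  · rw [hm]
  · obtain ⟨i, hi⟩ : ∃ i, m i ≠ 0 := by
      by_contra! hc
      exact hm (Finsupp.ext fun i => (hc i).symm)
    have h1 := congrArg (coeff (m - Finsupp.single i 1)) (h i)
    rw [coeff_pderiv, coeff_zero, tsub_add_cancel_of_le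
      (Finsupp.single_le_iff.2 (Nat.one_le_iff_ne_zero.2 hi))] at h1
    exact (mul_eq_zero.1 h1).resolve_right (Nat.cast_add_one_ne_zero _)

theorem MvPolynomial.iterate_pderiv_eq_zero {F : Type u} [Field F] {σ : Type} (i : σ) :
    ∀ (N : ℕ) (p : MvPolynomial σ F), p.totalDegree < N → (pderiv i)^[N] p = 0
  | 0, _, h => absurd h (Nat.not_lt_zero _)
  | 1, p, h => by
    rw [(totalDegree_eq_zero_iff_eq_C).1 (Nat.lt_one_iff.1 h)]
    simp
  | N + 2, p, h => by
    rw [Function.iterate_succ_apply]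
    apply iterate_pderiv_eq_zero i (N + 1)
    have := totalDegree_pderiv_le p i
    omega

namespace Weyl

variable {F : Type u} [Field F] {n : ℕ}

theorem exists_eq_algebraMap_of_dual_eq_zero [CharZero F] {A : Weyl F n}
    (h : ∀ l, dual l A = 0) : ∃ c, A = algebraMap F _ c := by
  obtain ⟨p, rfl⟩ := normalOrder_surjective A
  obtain ⟨c, hc⟩ := exists_eq_C_of_pderiv_eq_zero (p := p) (fun l =>
    normalOrder_injective (by rw [← dual_normalOrder, h, map_zero]))
  exact ⟨c, by rw [hc, normalOrder_C]⟩

/-- Every nonzero element is taken to a nonzero scalar by some sequence of the derivations dual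
to the letters. -/
theorem dual_induction [CharZero F] {P : Weyl F n → Prop}
    (scalar : ∀ c : F, c ≠ 0 → P (algebraMap F _ c)) (step : ∀ l A, P (dual l A) → P A)
    (A : Weyl F n) (hA : A ≠ 0) : P A := by
  obtain ⟨p, rfl⟩ := normalOrder_surjective A
  induction h : p.totalDegree using Nat.strong_induction_on generalizing p with
  | _ d ih =>
    by_cases hd : ∀ l, dual l (normalOrder p) = 0
    · obtain ⟨c, hc⟩ := exists_eq_algebraMap_of_dual_eq_zero hd
      rw [hc] at hA ⊢
      exact scalar c (by rintro rfl; simp at hA)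
    · push Not at hd
      obtain ⟨l, hl⟩ := hd
      apply step l
      rw [dual_normalOrder] at hl ⊢
      refine ih _ ?_ _ hl rfl
      have h1 := totalDegree_pderiv_le p l
      rcases Nat.eq_zero_or_pos d with h0 | h0
      · rw [h0] at h
        rw [totalDegree_eq_zero_iff_eq_C.1 h, pderiv_C, map_zero] at hl
        exact absurd rfl hl
      · omega

/-- Each application of `dual l` lowers the total degree of the symbol. -/
theorem exists_iterate_dual_eq_zero (l : Letter n) (A : Weyl F n) :
    ∃ N, (dual l)^[N] A = 0 := by
  obtain ⟨p, rfl⟩ := normalOrder_surjective A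
  refine ⟨p.totalDegree + 1, ?_⟩
  have : ∀ N (q : MvPolynomial (Letter n) F),
      (dual l)^[N] (normalOrder q) = normalOrder ((pderiv l)^[N] q) := by
    intro N
    induction N with
    | zero => intro q; rfl
    | succ N ih => intro q; rw [Function.iterate_succ_apply, dual_normalOrder, ih]; rfl
  rw [this, iterate_pderiv_eq_zero l _ p (Nat.lt_succ_self _), map_zero]

theorem iterate_dual_mul (l : Letter n) (m : ℕ) (A B : Weyl F n) :
    (dual l)^[m] (A * B) = ∑ ij ∈ Finset.HasAntidiagonal.antidiagonal m,
      m.choose ij.1 • ((dual l)^[ij.1] A * (dual l)^[ij.2] B) := by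
  induction m with
  | zero => simp
  | succ m ih =>
    rw [Finset.sum_antidiagonal_choose_succ_nsmul
      (fun i j => (dual l)^[i] A * (dual l)^[j] B) m, Function.iterate_succ_apply', ih, map_sum,
      ← Finset.sum_add_distrib]
    refine Finset.sum_congr rfl fun ij hij => ?_
    rw [map_nsmul, dual_mul, smul_add, Function.iterate_succ_apply',
      Function.iterate_succ_apply', add_comm, Finset.HasAntidiagonal.mem_antidiagonal.1 hij |>.symm]
    congr 2
    rw [Nat.choose_symm_add]

theorem dual_comm (l l' : Letter n) (A : Weyl F n) : dual l (dual l' A) = dual l' (dual l A) := by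
  obtain ⟨p, rfl⟩ := normalOrder_surjective A
  simp only [dual_normalOrder, pderiv_pderiv_comm l l']

theorem dual_iterate_comm (l l' : Letter n) (m : ℕ) (A : Weyl F n) :
    dual l ((dual l')^[m] A) = (dual l')^[m] (dual l A) := by
  induction m generalizing A with
  | zero => rfl
  | succ m ih => rw [Function.iterate_succ_apply, ih, dual_comm, Function.iterate_succ_apply]

theorem exists_last_iterate_dual (l : Letter n) {A : Weyl F n} (hA : A ≠ 0) :
    ∃ m, (dual l)^[m] A ≠ 0 ∧ ∀ j, m < j → (dual l)^[j] A = 0 := by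
  classical
  have h := exists_iterate_dual_eq_zero l A
  have h0 : Nat.find h ≠ 0 := by
    intro h0
    have := Nat.find_spec h
    rw [h0] at this
    exact hA this
  refine ⟨Nat.find h - 1, Nat.find_min h (by omega), fun j hj => ?_⟩
  obtain ⟨i, rfl⟩ := Nat.exists_eq_add_of_le (show Nat.find h ≤ j by omega)
  rw [add_comm, Function.iterate_add_apply, Nat.find_spec h]
  exact iterate_map_zero _ _

/-- Let `i` and `j` be the last orders at which the iterates of `dual l` on the two factors are
nonzero. In the Leibniz expansion of order `i + j` only the term `(i, j)` survives, with a binomial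
coefficient that is nonzero in characteristic zero. The dual derivations commute, so running through
all letters turns a pair of zero divisors into a pair killed by every `dual l`, that is, into
nonzero scalars with product zero. -/
instance noZeroDivisors [CharZero F] : NoZeroDivisors (Weyl F n) where
  eq_zero_or_eq_zero_of_mul_eq_zero := by
    intro A B hAB
    by_contra! hne
    have key : ∀ s : Finset (Letter n), ∃ A B : Weyl F n, A ≠ 0 ∧ B ≠ 0 ∧ A * B = 0 ∧
        ∀ l ∈ s, dual l A = 0 ∧ dual l B = 0 := by
      intro s
      induction s using Finset.induction_on with
      | empty => exact ⟨A, B, hne.1, hne.2, hAB, by simp⟩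
      | insert l s _ ih =>
        obtain ⟨A, B, hA, hB, hAB, hs⟩ := ih
        obtain ⟨i, hi, hi'⟩ := exists_last_iterate_dual l hA
        obtain ⟨j, hj, hj'⟩ := exists_last_iterate_dual l hB
        refine ⟨(dual l)^[i] A, (dual l)^[j] B, hi, hj, ?_, ?_⟩
        · have h := iterate_dual_mul l (i + j) A B
          rw [hAB, iterate_map_zero, Finset.sum_eq_single (i, j)] at h
          · rw [← Nat.cast_smul_eq_nsmul F] at h
            exact (smul_eq_zero.1 h.symm).resolve_left
              (by exact_mod_cast (Nat.choose_pos (Nat.le_add_right i j)).ne')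
          · rintro ⟨a, b⟩ hab hne
            rw [Finset.HasAntidiagonal.mem_antidiagonal] at hab
            dsimp only at hab ⊢
            rcases lt_trichotomy a i with h1 | h1 | h1
            · rw [hj' b (by omega), mul_zero, smul_zero]
            · exact absurd (Prod.ext h1 (show b = j by omega)) hne
            · rw [hi' a h1, zero_mul, smul_zero]
          · intro h; exact absurd (Finset.HasAntidiagonal.mem_antidiagonal.2 (rfl : i + j = i + j)) h
        · intro l' hl'
          rcases Finset.mem_insert.1 hl' with rfl | hl'
          · exact ⟨(Function.iterate_succ_apply' (dual l') i A).symm.trans (hi' _ (Nat.lt_succ_self _)),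
              (Function.iterate_succ_apply' (dual l') j B).symm.trans (hj' _ (Nat.lt_succ_self _))⟩
          · rw [dual_iterate_comm, dual_iterate_comm, (hs l' hl').1, (hs l' hl').2]
            exact ⟨iterate_map_zero _ _, iterate_map_zero _ _⟩
    obtain ⟨A, B, hA, hB, hAB, hs⟩ := key Finset.univ
    obtain ⟨a, rfl⟩ := exists_eq_algebraMap_of_dual_eq_zero fun l => (hs l (Finset.mem_univ l)).1
    obtain ⟨b, rfl⟩ := exists_eq_algebraMap_of_dual_eq_zero fun l => (hs l (Finset.mem_univ l)).2
    rw [← map_mul, map_eq_zero_iff _ (algebraMap F (Weyl F n)).injective, mul_eq_zero] at hAB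
    rcases hAB with rfl | rfl
    · simp at hA
    · simp at hB

/-- The Weyl algebra is simple. -/
theorem one_mem_span_mul_mul [CharZero F] {A : Weyl F n} (hA : A ≠ 0) :
    (1 : Weyl F n) ∈ Submodule.span F {B | ∃ u v, B = u * A * v} := by
  refine dual_induction (P := fun A => (1 : Weyl F n) ∈
    Submodule.span F {B | ∃ u v, B = u * A * v}) ?_ ?_ A hA
  · intro c hc
    refine Submodule.subset_span ⟨algebraMap F _ c⁻¹, 1, ?_⟩
    rw [mul_one, ← map_mul, inv_mul_cancel₀ hc, map_one]
  · intro l A h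
    refine Submodule.span_le.2 ?_ h
    rintro _ ⟨u, v, rfl⟩
    -- `dual l` is inner, so `dual l A` lies in the two-sided ideal of `A`, and an expression of `1`
    -- through `dual l A` becomes one through `A`.
    cases l with
    | inl a =>
      have : u * dual (Sum.inl a) A * v =
          (u * gen (Sum.inr a)) * A * v - u * A * (gen (Sum.inr a) * v) := by
        rw [dual_inl]; noncomm_ring
      rw [this]
      exact sub_mem (Submodule.subset_span ⟨_, _, rfl⟩) (Submodule.subset_span ⟨_, _, rfl⟩)
    | inr a =>
      have : u * dual (Sum.inr a) A * v =
          u * A * (gen (Sum.inl a) * v) - (u * gen (Sum.inl a)) * A * v := by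
        rw [dual_inr]; noncomm_ring
      rw [this]
      exact sub_mem (Submodule.subset_span ⟨_, _, rfl⟩) (Submodule.subset_span ⟨_, _, rfl⟩)

/-- By simplicity, a kernel with a nonzero element contains `1`. Hence the action on `U` will be
faithful, and whether an operator is zero can be tested in the Weyl algebra. -/
theorem algHom_injective [CharZero F] {B : Type v} [Ring B] [Nontrivial B] [Algebra F B]
    (f : Weyl F n →ₐ[F] B) : Function.Injective f := by
  rw [injective_iff_map_eq_zero]
  intro A hA
  by_contra hne
  have h : Submodule.span F {B | ∃ u v, B = u * A * v} ≤ LinearMap.ker f.toLinearMap := by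
    rw [Submodule.span_le]
    rintro _ ⟨u, v, rfl⟩
    simp [hA]
  have := h (one_mem_span_mul_mul hne)
  simp at this

theorem ofX_injective [CharZero F] : Function.Injective (ofX (F := F) (n := n)) := by
  rw [injective_iff_map_eq_zero]
  intro p hp
  have : normalOrder (rename Sum.inl p : MvPolynomial (Letter n) F) = ofX p := by
    clear hp
    induction p using MvPolynomial.induction_on with
    | C c => rw [rename_C, normalOrder_C, ← algebraMap_eq, AlgHom.commutes]
    | add p q hp hq => rw [map_add, map_add, map_add, hp, hq]
    | mul_X p a hp =>
      rw [mul_comm, map_mul ofX, map_mul (rename Sum.inl), rename_X, ← var_mul_normalOrder, hp, ofX_X]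
  rw [hp] at this
  exact rename_injective _ Sum.inl_injective
    (normalOrder_injective (this.trans (map_zero _).symm) |>.trans (map_zero _).symm)

end Weyl
end

/-! ### Finite rank up to denominators -/

noncomputable section

open MvPolynomial

namespace Weyl

/-- A module over the Weyl algebra is a module over the polynomials in the variables. -/
@[reducible]
def polyModule (F : Type u) [Field F] (n : ℕ) (N : Type v) [AddCommGroup N]
    [Module (Weyl F n) N] : Module (MvPolynomial (Fin (n + 1)) F) N :=
  Module.compHom N (ofX (F := F) (n := n) : MvPolynomial (Fin (n + 1)) F →+* Weyl F n)

attribute [local instance] polyModule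

variable {F : Type u} [Field F] {n : ℕ} {N : Type v} [AddCommGroup N] [Module (Weyl F n) N]

theorem poly_smul_def (q : MvPolynomial (Fin (n + 1)) F) (f : N) : q • f = ofX q • f := rfl

theorem der_poly_smul (a : Fin (n + 1)) (q : MvPolynomial (Fin (n + 1)) F) (f : N) :
    gen (F := F) (Sum.inr a) • (q • f) = q • (gen (F := F) (Sum.inr a) • f) + pderiv a q • f := by
  simp only [poly_smul_def, ← mul_smul, der_mul_ofX, add_smul]

theorem var_smul (a : Fin (n + 1)) (f : N) :
    gen (F := F) (Sum.inl a) • f = (X a : MvPolynomial (Fin (n + 1)) F) • f := by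
  rw [poly_smul_def, ofX_X]

theorem algebraMap_smul' (c : F) (f : N) :
    algebraMap F (Weyl F n) c • f = (C c : MvPolynomial (Fin (n + 1)) F) • f := by
  rw [poly_smul_def, ← MvPolynomial.algebraMap_eq, AlgHom.commutes]

variable (F n) in
/-- The elements of which a nonzero polynomial multiple lies in the span of `S` over the
polynomials in the variables. -/
def sat (S : Set N) : Submodule (MvPolynomial (Fin (n + 1)) F) N where
  carrier := {f | ∃ q : MvPolynomial (Fin (n + 1)) F, q ≠ 0 ∧
    q • f ∈ Submodule.span (MvPolynomial (Fin (n + 1)) F) S}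
  zero_mem' := ⟨1, one_ne_zero, by simp⟩
  add_mem' := by
    rintro f g ⟨q, hq, hf⟩ ⟨r, hr, hg⟩
    refine ⟨q * r, mul_ne_zero hq hr, ?_⟩
    rw [smul_add]
    refine add_mem ?_ ?_
    · rw [mul_comm, mul_smul]; exact Submodule.smul_mem _ _ hf
    · rw [mul_smul]; exact Submodule.smul_mem _ _ hg
  smul_mem' := by
    rintro c f ⟨q, hq, hf⟩
    exact ⟨q, hq, by rw [smul_comm]; exact Submodule.smul_mem _ _ hf⟩

theorem mem_sat {S : Set N} {f : N} : f ∈ sat F n S ↔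
    ∃ q : MvPolynomial (Fin (n + 1)) F, q ≠ 0 ∧
      q • f ∈ Submodule.span (MvPolynomial (Fin (n + 1)) F) S := Iff.rfl

theorem span_le_sat (S : Set N) :
    Submodule.span (MvPolynomial (Fin (n + 1)) F) S ≤ sat F n S :=
  fun f hf => ⟨1, one_ne_zero, by rwa [one_smul]⟩

theorem subset_sat (S : Set N) : S ⊆ sat F n S :=
  fun _ hf => span_le_sat S (Submodule.subset_span hf)

theorem mem_sat_of_smul_mem {S : Set N} {f : N} {q : MvPolynomial (Fin (n + 1)) F} (hq : q ≠ 0)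
    (h : q • f ∈ sat F n S) : f ∈ sat F n S := by
  obtain ⟨r, hr, h⟩ := h
  exact ⟨r * q, mul_ne_zero hr hq, by rwa [mul_smul]⟩

theorem sat_le {S T : Set N} (h : S ⊆ sat F n T) : sat F n S ≤ sat F n T := by
  rintro f ⟨q, hq, hf⟩
  exact mem_sat_of_smul_mem hq (Submodule.span_le.2 h hf)

theorem sat_mono {S T : Set N} (h : S ⊆ T) : sat F n S ≤ sat F n T :=
  sat_le (h.trans (subset_sat T))

/-- By the product rule `q ∂f = ∂(q f) - (∂q) f`; when `q f` lies in the span of `S`, both terms on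
the right lie in `sat F n T`, and `q` can be divided out. So behaviour under a derivation need only
be checked on generators. -/
theorem der_mem_sat {S T : Set N} (h : S ⊆ sat F n T) (a : Fin (n + 1))
    (hd : ∀ s ∈ S, gen (F := F) (Sum.inr a) • s ∈ sat F n T) {f : N} (hf : f ∈ sat F n S) :
    gen (F := F) (Sum.inr a) • f ∈ sat F n T := by
  have hspan : ∀ g ∈ Submodule.span (MvPolynomial (Fin (n + 1)) F) S,
      gen (F := F) (Sum.inr a) • g ∈ sat F n T := by
    intro g hg
    induction hg using Submodule.span_induction with
    | mem x hx => exact hd x hx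
    | zero => rw [smul_zero]; exact zero_mem _
    | add x y _ _ hx hy => rw [smul_add]; exact add_mem hx hy
    | smul c x hx' hx =>
      rw [der_poly_smul]
      exact add_mem (Submodule.smul_mem _ _ hx)
        (Submodule.smul_mem _ _ (Submodule.span_le.2 h hx'))
  obtain ⟨q, hq, hf'⟩ := hf
  have h1 := hspan _ hf'
  rw [der_poly_smul] at h1
  have h2 : pderiv a q • f ∈ sat F n T := Submodule.smul_mem _ _ (sat_le h ⟨q, hq, hf'⟩)
  exact mem_sat_of_smul_mem hq ((Submodule.add_mem_iff_left _ h2).1 h1)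

variable (F n) in
/-- The elements that lie in a finite-dimensional space stable under the derivation `∂_a`, up to
denominators. -/
def IsAlgebraicFor (a : Fin (n + 1)) (f : N) : Prop :=
  ∃ S : Set N, S.Finite ∧ f ∈ sat F n S ∧ ∀ s ∈ S, gen (F := F) (Sum.inr a) • s ∈ sat F n S

namespace IsAlgebraicFor

variable {a : Fin (n + 1)}

theorem zero : IsAlgebraicFor F n a (0 : N) :=
  ⟨∅, Set.finite_empty, zero_mem _, by simp⟩

theorem add {f g : N} (hf : IsAlgebraicFor F n a f) (hg : IsAlgebraicFor F n a g) :
    IsAlgebraicFor F n a (f + g) := by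
  obtain ⟨S, hS, hfS, hSd⟩ := hf
  obtain ⟨T, hT, hgT, hTd⟩ := hg
  have h1 := sat_mono (F := F) (n := n) (S := S) (T := S ∪ T) Set.subset_union_left
  have h2 := sat_mono (F := F) (n := n) (S := T) (T := S ∪ T) Set.subset_union_right
  refine ⟨S ∪ T, hS.union hT, add_mem (h1 hfS) (h2 hgT), ?_⟩
  rintro s (hs | hs)
  · exact h1 (hSd s hs)
  · exact h2 (hTd s hs)

theorem poly_smul {f : N} (hf : IsAlgebraicFor F n a f) (q : MvPolynomial (Fin (n + 1)) F) :
    IsAlgebraicFor F n a (q • f) := by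
  obtain ⟨S, hS, hfS, hSd⟩ := hf
  exact ⟨S, hS, Submodule.smul_mem _ _ hfS, hSd⟩

/-- Since `∂_a` and `∂_b` commute, `S ∪ ∂_b S` is stable under `∂_a` up to denominators whenever `S`
is. -/
theorem der_smul {f : N} (hf : IsAlgebraicFor F n a f) (b : Fin (n + 1)) :
    IsAlgebraicFor F n a (gen (F := F) (Sum.inr b) • f) := by
  obtain ⟨S, hS, hfS, hSd⟩ := hf
  let D : N → N := fun s => gen (F := F) (Sum.inr b) • s
  have h1 := sat_mono (F := F) (n := n) (S := S) (T := S ∪ D '' S) Set.subset_union_left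
  have hD : ∀ g ∈ sat F n S, D g ∈ sat F n (S ∪ D '' S) := fun g hg =>
    der_mem_sat (fun s hs => h1 (subset_sat S hs)) b
      (fun s hs => subset_sat _ (Or.inr ⟨s, hs, rfl⟩)) hg
  refine ⟨S ∪ D '' S, hS.union (hS.image _), hD f hfS, ?_⟩
  rintro _ (hs | ⟨s, hs, rfl⟩)
  · exact h1 (hSd _ hs)
  · have : gen (F := F) (Sum.inr a) • D s = D (gen (F := F) (Sum.inr a) • s) := by
      simp only [D, ← mul_smul]
      rw [(commute_of_comm (F := F) (l := Sum.inr a) (l' := Sum.inr b) rfl).eq]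
    rw [this]
    exact hD _ (hSd s hs)

theorem smul {f : N} (hf : IsAlgebraicFor F n a f) (A : Weyl F n) :
    IsAlgebraicFor F n a (A • f) := by
  let P : Submodule F (Weyl F n) :=
    { carrier := {A | IsAlgebraicFor F n a (A • f)}
      zero_mem' := by simpa using zero
      add_mem' := by
        intro A B hA hB
        simp only [Set.mem_ofPred_eq, add_smul] at *
        exact hA.add hB
      smul_mem' := by
        intro c A hA
        simp only [Set.mem_ofPred_eq] at *
        rw [Algebra.smul_def, mul_smul, algebraMap_smul']
        exact hA.poly_smul _ }
  refine mem_of_stable P ?_ ?_ A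
  · simpa [P] using hf
  · intro l A hA
    change IsAlgebraicFor F n a ((gen l * A) • f)
    rw [mul_smul]
    rcases l with b | b
    · rw [var_smul]; exact IsAlgebraicFor.poly_smul hA _
    · exact IsAlgebraicFor.der_smul hA b

end IsAlgebraicFor

/-- If `f` is annihilated by a nonzero operator `∑ c_j ∂_a^j`, then the derivatives of order less
than the order of the operator span all derivatives. -/
theorem iterate_der_mem_sat {a : Fin (n + 1)} {f : N}
    {p : Polynomial (MvPolynomial (Fin (n + 1)) F)} (hp : p ≠ 0)
    (h : p.sum (fun j c => c • (gen (F := F) (Sum.inr a) ^ j • f)) = 0) (m : ℕ) :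
    gen (F := F) (Sum.inr a) ^ m • f ∈
      sat F n ((fun j => gen (F := F) (Sum.inr a) ^ j • f) '' Set.Iio p.natDegree) := by
  set S := (fun j => gen (F := F) (Sum.inr a) ^ j • f) '' Set.Iio p.natDegree with hS
  have hle : ∀ m ≤ p.natDegree, gen (F := F) (Sum.inr a) ^ m • f ∈ sat F n S := by
    intro m hm
    rcases hm.lt_or_eq with hm | rfl
    · exact subset_sat _ ⟨m, hm, rfl⟩
    -- The relation expresses the leading coefficient times the top derivative through the lower
    -- ones.
    · refine mem_sat_of_smul_mem (q := p.leadingCoeff) (by simpa using hp) ?_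
      rw [Polynomial.sum_over_range _ (by simp), Finset.sum_range_succ, add_comm,
        ← eq_neg_iff_add_eq_zero] at h
      rw [Polynomial.leadingCoeff, h]
      refine neg_mem (sum_mem fun j hj => Submodule.smul_mem _ _ (subset_sat _ ⟨j, ?_, rfl⟩))
      exact Finset.mem_range.1 hj
  induction m with
  | zero => exact hle 0 (Nat.zero_le _)
  | succ m ih =>
    rw [pow_succ', mul_smul]
    refine der_mem_sat (subset_sat S) a ?_ ih
    rintro _ ⟨j, hj, rfl⟩
    dsimp only
    rw [← mul_smul, ← pow_succ']
    exact hle _ hj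

theorem isAlgebraicFor_of_sum_eq_zero {a : Fin (n + 1)} {f : N}
    {p : Polynomial (MvPolynomial (Fin (n + 1)) F)} (hp : p ≠ 0)
    (h : p.sum (fun j c => c • (gen (F := F) (Sum.inr a) ^ j • f)) = 0) :
    IsAlgebraicFor F n a f := by
  refine ⟨(fun j => gen (F := F) (Sum.inr a) ^ j • f) '' Set.Iio p.natDegree,
    (Set.finite_Iio _).image _, ?_, ?_⟩
  · simpa using iterate_der_mem_sat hp h 0
  · rintro _ ⟨j, hj, rfl⟩
    dsimp only
    rw [← mul_smul, ← pow_succ']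
    exact iterate_der_mem_sat hp h _

/-- Once denominators are cleared, the derivatives of orders `0` to `card S` are `card S + 1`
combinations of `card S` elements, so their coefficient vectors are linearly dependent. The operator
has the dependency coefficients times the denominators as its coefficients. -/
theorem IsAlgebraicFor.exists_sum_eq_zero {a : Fin (n + 1)} {f : N}
    (hf : IsAlgebraicFor F n a f) : ∃ p : Polynomial (MvPolynomial (Fin (n + 1)) F), p ≠ 0 ∧
      p.sum (fun j c => c • (gen (F := F) (Sum.inr a) ^ j • f)) = 0 := by
  classical
  obtain ⟨S, hS, hfS, hSd⟩ := hf
  obtain ⟨S, rfl⟩ := hS.exists_finset_coe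
  have hmem : ∀ j : ℕ, gen (F := F) (Sum.inr a) ^ j • f ∈ sat F n (S : Set N) := by
    intro j
    induction j with
    | zero => simpa using hfS
    | succ j ih =>
      rw [pow_succ', mul_smul]
      exact der_mem_sat (subset_sat _) a hSd ih
  choose q hq hqm using fun j => mem_sat.1 (hmem j)
  simp only [Submodule.mem_span_finset'] at hqm
  choose c hc using hqm
  have hdep : ¬ LinearIndependent (MvPolynomial (Fin (n + 1)) F)
      (fun j : Fin (S.card + 1) => c j) := by
    intro hli
    have := hli.fintype_card_le_finrank
    rw [Module.finrank_fintype_fun_eq_card, Fintype.card_fin, Fintype.card_coe] at this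
    omega
  rw [Fintype.not_linearIndependent_iff] at hdep
  obtain ⟨b, hb, i, hi⟩ := hdep
  refine ⟨∑ j : Fin (S.card + 1), Polynomial.monomial j (b j * q j), ?_, ?_⟩
  · intro h0
    have := congrArg (fun p => Polynomial.coeff p i) h0
    simp only [Polynomial.finsetSum_coeff, Polynomial.coeff_monomial, Fin.val_inj,
      Finset.sum_ite_eq', Finset.mem_univ, if_true, Polynomial.coeff_zero] at this
    exact mul_ne_zero hi (hq i) this
  · have hsum : ∀ s : Finset (Fin (S.card + 1)),
        (∑ j ∈ s, Polynomial.monomial (j : ℕ) (b j * q j)).sum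
          (fun j c => c • (gen (F := F) (Sum.inr a) ^ j • f)) =
        ∑ j ∈ s, (b j * q j) • (gen (F := F) (Sum.inr a) ^ (j : ℕ) • f) := by
      intro s
      induction s using Finset.induction_on with
      | empty => simp
      | insert j s hj ih =>
        rw [Finset.sum_insert hj, Finset.sum_insert hj, Polynomial.sum_add_index, ih,
          Polynomial.sum_monomial_index]
        · simp
        · simp
        · intro i x y; rw [add_smul]
    rw [hsum]
    have h2 : ∀ j : Fin (S.card + 1), (b j * q j) • (gen (F := F) (Sum.inr a) ^ (j : ℕ) • f) =
        ∑ s : S, (b j * c j s) • (s : N) := by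
      intro j
      rw [mul_smul, ← hc, Finset.smul_sum]
      simp only [mul_smul]
    rw [Finset.sum_congr rfl fun j _ => h2 j, Finset.sum_comm]
    refine Finset.sum_eq_zero fun s _ => ?_
    rw [← Finset.sum_smul]
    have := congrFun hb s
    simp only [Finset.sum_apply, Pi.smul_apply, smul_eq_mul, Pi.zero_apply] at this
    rw [this, zero_smul]

/-- A module generated by finitely many elements that are algebraic for all derivations has finite
rank over the polynomials in the variables. -/
theorem exists_finite_sat_eq_top {ι : Type} [Finite ι] (e : ι → N)
    (hspan : Submodule.span (Weyl F n) (Set.range e) = ⊤)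
    (halg : ∀ a i, IsAlgebraicFor F n a (e i)) : ∃ S : Set N, S.Finite ∧ sat F n S = ⊤ := by
  classical
  -- The derivations are treated one at a time. For a new `∂_b`, each `s` is replaced by its
  -- `∂_b`-derivatives below the order of an annihilating operator. Stability under the derivations
  -- already treated survives because they commute with `∂_b`, and the new generators are again
  -- algebraic for all derivations.
  have key : ∀ T : Finset (Fin (n + 1)), ∃ S : Set N, S.Finite ∧ (∀ i, e i ∈ sat F n S) ∧
      (∀ a ∈ T, ∀ s ∈ S, gen (F := F) (Sum.inr a) • s ∈ sat F n S) ∧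
      ∀ a, ∀ s ∈ S, IsAlgebraicFor F n a s := by
    intro T
    induction T using Finset.induction_on with
    | empty =>
      refine ⟨Set.range e, Set.finite_range e, fun i => subset_sat _ ⟨i, rfl⟩, by simp, ?_⟩
      rintro a _ ⟨i, rfl⟩
      exact halg a i
    | insert b T _ ih =>
      obtain ⟨S, hS, he, hT, hA⟩ := ih
      have hr : ∀ s : N, ∃ r : ℕ, s ∈ S → ∀ m, gen (F := F) (Sum.inr b) ^ m • s ∈
          sat F n ((fun j => gen (F := F) (Sum.inr b) ^ j • s) '' Set.Iio r) := by
        intro s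
        by_cases hs : s ∈ S
        · obtain ⟨p, hp, hps⟩ := (hA b s hs).exists_sum_eq_zero
          exact ⟨_, fun _ => iterate_der_mem_sat hp hps⟩
        · exact ⟨0, fun h => absurd h hs⟩
      choose r hr using hr
      let B : N → Set N := fun s => (fun j => gen (F := F) (Sum.inr b) ^ j • s) '' Set.Iio (r s)
      have hB : ∀ s ∈ S, sat F n (B s) ≤ sat F n (⋃ s ∈ S, B s) := fun s hs =>
        sat_mono (Set.subset_biUnion_of_mem (u := B) hs)
      have hSB : S ⊆ sat F n (⋃ s ∈ S, B s) := fun s hs =>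
        hB s hs (by simpa using hr s hs 0)
      have hb : ∀ s ∈ ⋃ s ∈ S, B s, gen (F := F) (Sum.inr b) • s ∈ sat F n (⋃ s ∈ S, B s) := by
        intro x hx
        simp only [Set.mem_iUnion] at hx
        obtain ⟨s, hs, j, hj, rfl⟩ := hx
        dsimp only
        rw [← mul_smul, ← pow_succ']
        exact hB s hs (hr s hs _)
      have hb' : ∀ (j : ℕ) (f : N), f ∈ sat F n (⋃ s ∈ S, B s) →
          gen (F := F) (Sum.inr b) ^ j • f ∈ sat F n (⋃ s ∈ S, B s) := by
        intro j
        induction j with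
        | zero => intro f hf; simpa using hf
        | succ j ih =>
          intro f hf
          rw [pow_succ, mul_smul]
          exact ih _ (der_mem_sat (subset_sat _) b hb hf)
      refine ⟨⋃ s ∈ S, B s, hS.biUnion fun s _ => (Set.finite_Iio _).image _,
        fun i => sat_le hSB (he i), ?_, ?_⟩
      · intro a ha
        rcases Finset.mem_insert.1 ha with rfl | ha
        · exact hb
        · intro x hx
          simp only [Set.mem_iUnion] at hx
          obtain ⟨s, hs, j, hj, rfl⟩ := hx
          dsimp only
          rw [← mul_smul, ((commute_of_comm (F := F) (l := Sum.inr a) (l' := Sum.inr b)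
            rfl).pow_right j).eq, mul_smul]
          exact hb' j _ (sat_le hSB (hT a ha s hs))
      · intro a x hx
        simp only [Set.mem_iUnion] at hx
        obtain ⟨s, hs, j, hj, rfl⟩ := hx
        exact (hA a s hs).smul _
  obtain ⟨S, hS, he, hd, -⟩ := key Finset.univ
  refine ⟨S, hS, ?_⟩
  have hst : ∀ (A : Weyl F n) (f : N), f ∈ sat F n S → A • f ∈ sat F n S := by
    intro A f hf
    let P : Submodule F (Weyl F n) :=
      { carrier := {A | A • f ∈ sat F n S}
        zero_mem' := by simp
        add_mem' := by
          intro A B hA hB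
          simp only [Set.mem_ofPred_eq, add_smul] at *
          exact add_mem hA hB
        smul_mem' := by
          intro c A hA
          simp only [Set.mem_ofPred_eq] at *
          rw [Algebra.smul_def, mul_smul, algebraMap_smul']
          exact Submodule.smul_mem _ _ hA }
    refine mem_of_stable P ?_ ?_ A
    · simpa [P] using hf
    · intro l A hA
      change (gen l * A) • f ∈ sat F n S
      rw [mul_smul]
      rcases l with b | b
      · rw [var_smul]; exact Submodule.smul_mem _ _ hA
      · exact der_mem_sat (subset_sat _) b (hd b (Finset.mem_univ b)) hA
  rw [eq_top_iff]
  intro f _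
  have hf : f ∈ Submodule.span (Weyl F n) (Set.range e) := by rw [hspan]; trivial
  induction hf using Submodule.span_induction with
  | mem x hx => obtain ⟨i, rfl⟩ := hx; exact he i
  | zero => exact zero_mem _
  | add x y _ _ hx hy => exact add_mem (hx trivial) (hy trivial)
  | smul c x _ hx => exact hst c x (hx trivial)

end Weyl
end

/-! ### Lipshitz's counting argument -/

noncomputable section

open MvPolynomial

namespace Weyl

attribute [local instance] polyModule

variable {F : Type u} [Field F] {n : ℕ} {N : Type v} [AddCommGroup N] [Module (Weyl F n) N]

variable (F n N) in
/-- A module over the Weyl algebra without torsion with respect to the polynomials in the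
variables. -/
def IsTorsionFree : Prop :=
  ∀ (q : MvPolynomial (Fin (n + 1)) F) (f : N), ofX q • f = 0 → q = 0 ∨ f = 0

section bounded

variable {κ : Type v} [Fintype κ] (b : κ → N)

variable (F n) in
/-- The combinations of the family `b` with polynomial coefficients of total degree at most `E`. -/
def boundedSpan (E : ℕ) : Set N :=
  {f | ∃ p : κ → MvPolynomial (Fin (n + 1)) F, (∀ j, (p j).totalDegree ≤ E) ∧
    f = ∑ j, p j • b j}

variable {b}

theorem boundedSpan_add {E : ℕ} {f g : N} (hf : f ∈ boundedSpan F n b E)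
    (hg : g ∈ boundedSpan F n b E) : f + g ∈ boundedSpan F n b E := by
  obtain ⟨p, hp, rfl⟩ := hf
  obtain ⟨r, hr, rfl⟩ := hg
  refine ⟨p + r, fun j => (totalDegree_add _ _).trans (max_le (hp j) (hr j)), ?_⟩
  simp [add_smul, Finset.sum_add_distrib]

theorem boundedSpan_sum {E : ℕ} {α : Type v} (s : Finset α) (f : α → N)
    (hf : ∀ i ∈ s, f i ∈ boundedSpan F n b E) : ∑ i ∈ s, f i ∈ boundedSpan F n b E := by
  classical
  induction s using Finset.induction_on with
  | empty => exact ⟨0, by simp, by simp⟩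
  | insert i s hi ih =>
    rw [Finset.sum_insert hi]
    exact boundedSpan_add (hf i (Finset.mem_insert_self i s))
      (ih fun j hj => hf j (Finset.mem_insert_of_mem hj))

theorem boundedSpan_smul {E d : ℕ} {f : N} (hf : f ∈ boundedSpan F n b E)
    {r : MvPolynomial (Fin (n + 1)) F} (hr : r.totalDegree ≤ d) :
    r • f ∈ boundedSpan F n b (E + d) := by
  obtain ⟨p, hp, rfl⟩ := hf
  refine ⟨fun j => r * p j, fun j => (totalDegree_mul _ _).trans ?_, ?_⟩
  · have := hp j; omega
  · rw [Finset.smul_sum]; simp only [mul_smul]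

theorem boundedSpan_mono {E E' : ℕ} (h : E ≤ E') {f : N} (hf : f ∈ boundedSpan F n b E) :
    f ∈ boundedSpan F n b E' := by
  obtain ⟨p, hp, rfl⟩ := hf
  exact ⟨p, fun j => (hp j).trans h, rfl⟩

/-- One letter costs one factor `q` and a degree increase by `D`. For a derivation this comes from
`q^(m+1) ∂f = q ∂(q^m f) - m (∂q) q^m f`, where `q` clears the denominators in the derivatives of
the `b j`. Growth linear in the number of letters is what the count needs. -/
theorem gen_smul_mem_boundedSpan {q : MvPolynomial (Fin (n + 1)) F} {D : ℕ}
    (hq : q.totalDegree + 1 ≤ D)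
    (hb : ∀ (a : Fin (n + 1)) j, q • (gen (F := F) (Sum.inr a) • b j) ∈ boundedSpan F n b D)
    (l : Letter n) {m E : ℕ} {f : N} (hf : q ^ m • f ∈ boundedSpan F n b E) :
    q ^ (m + 1) • (gen (F := F) l • f) ∈ boundedSpan F n b (E + D) := by
  rcases l with a | a
  · have : q ^ (m + 1) • (gen (F := F) (Sum.inl a) • f) =
        (q * X a : MvPolynomial (Fin (n + 1)) F) • (q ^ m • f) := by
      rw [var_smul, smul_smul, smul_smul]; congr 1; ring
    rw [this]
    refine boundedSpan_smul hf ((totalDegree_mul _ _).trans ?_)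
    rw [totalDegree_X]; exact hq
  · have h1 : q ^ (m + 1) • (gen (F := F) (Sum.inr a) • f) =
        q • (gen (F := F) (Sum.inr a) • (q ^ m • f)) +
          (-(C (m : F) * pderiv a q)) • (q ^ m • f) := by
      rw [der_poly_smul, smul_add, smul_smul, smul_smul, smul_smul, ← pow_succ', add_assoc,
        ← add_smul, left_eq_add]
      have : q * pderiv a (q ^ m) + -(C (m : F) * pderiv a q) * q ^ m = 0 := by
        rw [Derivation.leibniz_pow]
        cases m with
        | zero => simp
        | succ m =>
          simp only [smul_eq_mul, nsmul_eq_mul, Nat.add_sub_cancel, map_natCast]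
          ring
      rw [this, zero_smul]
    rw [h1]
    refine boundedSpan_add ?_ ?_
    · obtain ⟨p, hp, hfp⟩ := hf
      rw [hfp, Finset.smul_sum, Finset.smul_sum]
      refine boundedSpan_sum _ _ fun j _ => ?_
      rw [der_poly_smul, smul_add, smul_smul, mul_comm q, ← smul_smul, smul_smul q]
      refine boundedSpan_add ?_ ?_
      · exact boundedSpan_mono (by omega) (boundedSpan_smul (hb a j) (hp j))
      · have hbj : b j ∈ boundedSpan F n b 0 := by
          classical
          refine ⟨Pi.single j 1, fun i => ?_, ?_⟩
          · rw [Pi.single_apply]; split_ifs <;> simp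
          · simp [Pi.single_apply]
        refine boundedSpan_mono (E := 0 + (E + D)) (by omega) (boundedSpan_smul hbj ?_)
        refine (totalDegree_mul _ _).trans ?_
        have h2 := totalDegree_pderiv_le (p j) a
        have := hp j
        omega
    · refine boundedSpan_smul hf ?_
      rw [totalDegree_neg]
      refine (totalDegree_mul _ _).trans ?_
      rw [totalDegree_C]
      have h2 := totalDegree_pderiv_le q a
      omega

end bounded

theorem exists_common_denominator {J : Type} [Finite J] {S : Set N} (hS : sat F n S = ⊤)
    (g : J → N) : ∃ q : MvPolynomial (Fin (n + 1)) F, q ≠ 0 ∧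
      ∀ j, q • g j ∈ Submodule.span (MvPolynomial (Fin (n + 1)) F) S := by
  classical
  have := Fintype.ofFinite J
  have h : ∀ j, g j ∈ sat F n S := fun j => by rw [hS]; trivial
  choose q hq hqg using h
  refine ⟨∏ j, q j, Finset.prod_ne_zero_iff.2 fun j _ => hq j, fun j => ?_⟩
  rw [← Finset.prod_erase_mul _ _ (Finset.mem_univ j), mul_smul]
  exact Submodule.smul_mem _ _ (hqg j)

theorem ofX_mem_adjoin {T : Set (Letter n)} {p : MvPolynomial (Fin (n + 1)) F}
    (hp : p ∈ supported F {a | Sum.inl a ∈ T}) : ofX p ∈ Algebra.adjoin F (gen (F := F) '' T) := by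
  have h : ofX p ∈ (supported F {a | Sum.inl a ∈ T}).map (ofX (F := F) (n := n)) :=
    ⟨p, hp, rfl⟩
  rw [supported, AlgHom.map_adjoin] at h
  refine Algebra.adjoin_mono ?_ h
  rintro _ ⟨_, ⟨a, ha, rfl⟩, rfl⟩
  exact ⟨Sum.inl a, ha, (ofX_X a).symm⟩

theorem ofD_mem_adjoin {T : Set (Letter n)} {p : MvPolynomial (Fin (n + 1)) F}
    (hp : p ∈ supported F {a | Sum.inr a ∈ T}) : ofD p ∈ Algebra.adjoin F (gen (F := F) '' T) := by
  have h : ofD p ∈ (supported F {a | Sum.inr a ∈ T}).map (ofD (F := F) (n := n)) :=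
    ⟨p, hp, rfl⟩
  rw [supported, AlgHom.map_adjoin] at h
  refine Algebra.adjoin_mono ?_ h
  rintro _ ⟨_, ⟨a, ha, rfl⟩, rfl⟩
  exact ⟨Sum.inr a, ha, (ofD_X a).symm⟩

theorem monomial_one_mem_supported {σ : Type} {T : Set σ} {s : σ →₀ ℕ}
    (hs : ∀ a, s a ≠ 0 → a ∈ T) : (monomial s 1 : MvPolynomial σ F) ∈ supported F T := by
  rw [mem_supported, vars_monomial one_ne_zero]
  intro a ha
  exact hs a (Finsupp.mem_support_iff.1 ha)

theorem normalOrder_monomial_mem_adjoin {T : Set (Letter n)} {s : Letter n →₀ ℕ}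
    (hs : ∀ l, s l ≠ 0 → l ∈ T) :
    normalOrder (monomial s (1 : F)) ∈ Algebra.adjoin F (gen (F := F) '' T) := by
  rw [normalOrder_monomial, one_smul]
  refine mul_mem (ofX_mem_adjoin (monomial_one_mem_supported fun a ha => ?_))
    (ofD_mem_adjoin (monomial_one_mem_supported fun a ha => ?_))
  · exact hs _ ha
  · exact hs _ ha

/-- A monomial `X^s` is a product of `|s|` variables. -/
theorem monomial_one_induction {σ : Type} {P : ℕ → MvPolynomial σ F → Prop} (one : P 0 1)
    (step : ∀ m p a, P m p → P (m + 1) (X a * p)) (s : σ →₀ ℕ) :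
    P s.degree (monomial s 1) := by
  induction s using Finsupp.induction_linear with
  | zero => simpa using one
  | single a m =>
    rw [Finsupp.degree_single]
    induction m with
    | zero => simpa using one
    | succ m ih =>
      have := step _ _ a ih
      rwa [X_mul_monomial_eq, ← Finsupp.single_add, add_comm 1] at this
  | add s t hs ht =>
    clear hs
    induction s using Finsupp.induction_linear generalizing t with
    | zero => simpa using ht
    | single a m =>
      rw [map_add, Finsupp.degree_single]
      induction m with
      | zero => simpa using ht
      | succ m ih =>
        have := step _ _ a ih
        rwa [X_mul_monomial_eq, ← add_assoc, ← Finsupp.single_add, add_comm 1, add_right_comm,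
          ] at this
    | add s s' hs hs' =>
      rw [add_assoc]
      exact hs _ (hs' _ ht)

/-- One factor `q` serves `f` itself and one each letter of the monomial. The remaining factors pad
the exponent to a common `K`, so that the values of all monomials can be compared in one space. -/
theorem normalOrder_monomial_smul_mem_boundedSpan {κ : Type v} [Fintype κ] {b : κ → N}
    {q : MvPolynomial (Fin (n + 1)) F} {D : ℕ} (hq : q.totalDegree + 1 ≤ D)
    (hb : ∀ (a : Fin (n + 1)) j, q • (gen (F := F) (Sum.inr a) • b j) ∈ boundedSpan F n b D)
    {f : N} (hf : q • f ∈ boundedSpan F n b D) (s : Letter n →₀ ℕ) {K : ℕ} (hK : s.degree < K) :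
    q ^ K • (normalOrder (monomial s (1 : F)) • f) ∈ boundedSpan F n b (K * D) := by
  let P : ℕ → Weyl F n → Prop := fun k A => ∀ m E f, q ^ m • f ∈ boundedSpan F n b E →
    q ^ (m + k) • (A • f) ∈ boundedSpan F n b (E + k * D)
  have hP0 : P 0 1 := by intro m E f hf; simpa using hf
  have hP : ∀ k A l, P k A → P (k + 1) (gen l * A) := by
    intro k A l hA m E f hf
    rw [mul_smul, add_mul, one_mul, ← add_assoc, ← add_assoc]
    exact gen_smul_mem_boundedSpan hq hb l (hA m E f hf)
  have hX := monomial_one_induction (F := F) (P := fun k p => P k (ofX (n := n) p))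
    (by simpa using hP0) (fun m p a h => by rw [map_mul, ofX_X]; exact hP _ _ _ h)
  have hD := monomial_one_induction (F := F) (P := fun k p => P k (ofD (n := n) p))
    (by simpa using hP0) (fun m p a h => by rw [map_mul, ofD_X]; exact hP _ _ _ h)
  set s₁ := s.comapDomain Sum.inl Sum.inl_injective.injOn
  set s₂ := s.comapDomain Sum.inr Sum.inr_injective.injOn
  have hdeg : s.degree = s₁.degree + s₂.degree := by
    rw [Finsupp.degree_eq_sum, Finsupp.degree_eq_sum, Finsupp.degree_eq_sum, Fintype.sum_sum_type]
    rfl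
  have h := hX s₁ _ _ _ (hD s₂ 1 D f (by simpa using hf))
  rw [normalOrder_monomial, one_smul, mul_smul]
  obtain ⟨j, rfl⟩ := Nat.exists_eq_add_of_lt hK
  have hqj : (q ^ j).totalDegree ≤ j * D := (totalDegree_pow _ _).trans
    (Nat.mul_le_mul_left _ (by omega))
  have h2 := boundedSpan_smul h hqj
  rw [smul_smul, ← pow_add] at h2
  have e1 : s.degree + j + 1 = j + (1 + s₂.degree + s₁.degree) := by omega
  rw [e1]
  refine boundedSpan_mono (le_of_eq ?_) h2
  ring

/-- **Lipshitz's lemma**: in a torsion-free module of finite rank, finitely many elements are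
annihilated by a common nonzero operator in any `n + 2` of the letters. -/
theorem exists_annihilator [CharZero F] (htf : IsTorsionFree F n N) {S : Set N} (hS : S.Finite)
    (hsat : sat F n S = ⊤) {ι : Type} [Finite ι] (w : ι → N) (ls : Finset (Letter n))
    (hls : n + 2 ≤ ls.card) :
    ∃ L ∈ Algebra.adjoin F (gen (F := F) '' (ls : Set (Letter n))), L ≠ 0 ∧ ∀ i, L • w i = 0 := by
  classical
  have := Fintype.ofFinite ι
  have : Finite S := hS
  have := Fintype.ofFinite S
  let κ := S
  let b : κ → N := fun j => j
  obtain ⟨m, ⟨eκ⟩⟩ := Finite.exists_equiv_fin S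
  let g : ((Fin (n + 1) × Fin m) ⊕ ι) → N :=
    Sum.elim (fun p => gen (F := F) (Sum.inr p.1) • b (eκ.symm p.2)) w
  obtain ⟨q, hq, hqg⟩ := exists_common_denominator hsat g
  have hbr : S = Set.range b := by simp [b, κ]
  have hbd : ∃ D, q.totalDegree + 1 ≤ D ∧ ∀ j, q • g j ∈ boundedSpan F n b D := by
    have hc : ∀ j, ∃ D, q • g j ∈ boundedSpan F n b D := by
      intro j
      have h := hqg j
      rw [hbr, Submodule.mem_span_range_iff_exists_fun] at h
      obtain ⟨c, hc⟩ := h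
      exact ⟨Finset.univ.sup fun i => (c i).totalDegree, c,
        fun i => Finset.le_sup (f := fun i => (c i).totalDegree) (Finset.mem_univ i), hc.symm⟩
    choose D hD using hc
    refine ⟨max (q.totalDegree + 1) (Finset.univ.sup D), le_max_left _ _, fun j => ?_⟩
    exact boundedSpan_mono ((Finset.le_sup (Finset.mem_univ j)).trans (le_max_right _ _)) (hD j)
  obtain ⟨D, hqD, hD⟩ := hbd
  have hb : ∀ (a : Fin (n + 1)) j, q • (gen (F := F) (Sum.inr a) • b j) ∈ boundedSpan F n b D := by
    intro a j
    simpa [g] using hD (Sum.inl (a, eκ j))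
  have hw : ∀ i, q • w i ∈ boundedSpan F n b D := fun i => hD (Sum.inr i)
  obtain ⟨ls', hls', hcard⟩ := Finset.exists_subset_card_eq hls
  -- exponents in a box, and their number
  obtain ⟨Λ, hΛ⟩ : ∃ Λ : ℕ, Fintype.card (ι × κ) * (D * (n + 2) + D + 1) ^ (n + 1) ≤ Λ := ⟨_, le_rfl⟩
  -- A monomial with exponents at most `Λ` in `n + 2` letters has degree at most `(n + 2) * Λ`; the
  -- extra `1` is the factor `q` spent on `w i`. Since `K * D + 1 ≤ (D * (n + 2) + D + 1) * (Λ +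
  -- 1)`, the choice of `Λ` leaves at most `Λ * (Λ + 1) ^ (n + 1)` coefficients to kill, fewer than
  -- the `(Λ + 1) ^ (n + 2)` monomials.
  set K := (n + 2) * Λ + 1 with hKdef
  let ex : (ls' → Fin (Λ + 1)) → (Letter n →₀ ℕ) := fun γ =>
    Finsupp.equivFunOnFinite.symm fun l => if h : l ∈ ls' then (γ ⟨l, h⟩ : ℕ) else 0
  have hex : ∀ γ l (h : l ∈ ls'), ex γ l = γ ⟨l, h⟩ := fun γ l h => by simp [ex, h]
  have hex0 : ∀ γ l, l ∉ ls' → ex γ l = 0 := fun γ l h => by simp [ex, h]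
  have hexinj : Function.Injective ex := by
    intro γ γ' h
    funext l
    have := DFunLike.congr_fun h (l : Letter n)
    rw [hex _ _ l.2, hex _ _ l.2] at this
    exact Fin.ext this
  have hexdeg : ∀ γ, (ex γ).degree < K := by
    intro γ
    rw [Finsupp.degree_eq_sum, ← Finset.sum_subset (Finset.subset_univ ls')
      (fun l _ h => hex0 γ l h), hKdef, Nat.lt_succ_iff, ← hcard]
    refine (Finset.sum_le_card_nsmul _ _ Λ fun l hl => ?_).trans (by rw [smul_eq_mul])
    rw [hex γ l hl]
    exact Nat.lt_succ_iff.1 (γ ⟨l, hl⟩).2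
  have hmem : ∀ γ i, q ^ K • (normalOrder (monomial (ex γ) (1 : F)) • w i) ∈
      boundedSpan F n b (K * D) := fun γ i =>
    normalOrder_monomial_smul_mem_boundedSpan hqD hb (hw i) (ex γ) (hexdeg γ)
  choose c hcdeg hc using hmem
  -- Bounding each exponent separately by `K * D` covers every polynomial of total degree at most `K
  -- * D`; the surplus does not affect the order of growth.
  let box : (Fin (n + 1) → Fin (K * D + 1)) → (Fin (n + 1) →₀ ℕ) := fun α =>
    Finsupp.equivFunOnFinite.symm fun a => (α a : ℕ)
  let vec : (ls' → Fin (Λ + 1)) → (ι × κ) × (Fin (n + 1) → Fin (K * D + 1)) → F :=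
    fun γ x => coeff (box x.2) (c γ x.1.1 x.1.2)
  have hdep : ¬ LinearIndependent F vec := by
    intro hli
    have h := hli.fintype_card_le_finrank
    rw [Module.finrank_fintype_fun_eq_card, Fintype.card_prod, Fintype.card_fun, Fintype.card_fun,
      Fintype.card_fin, Fintype.card_fin, Fintype.card_coe, Fintype.card_fin, hcard] at h
    have h1 : K * D + 1 ≤ (D * (n + 2) + D + 1) * (Λ + 1) := by
      rw [hKdef]; nlinarith
    have h2 : Fintype.card (ι × κ) * (K * D + 1) ^ (n + 1) ≤ Λ * (Λ + 1) ^ (n + 1) := by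
      refine (Nat.mul_le_mul_left _ (Nat.pow_le_pow_left h1 _)).trans ?_
      rw [mul_pow, ← mul_assoc]
      exact Nat.mul_le_mul_right _ hΛ
    have h3 : Λ * (Λ + 1) ^ (n + 1) < (Λ + 1) ^ (n + 2) := by
      rw [pow_succ (Λ + 1) (n + 1), mul_comm]
      exact Nat.mul_lt_mul_of_pos_left (Nat.lt_succ_self Λ) (by positivity)
    omega
  rw [Fintype.not_linearIndependent_iff] at hdep
  obtain ⟨a, ha, γ₀, hγ₀⟩ := hdep
  let p : MvPolynomial (Letter n) F := ∑ γ, monomial (ex γ) (a γ)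
  have hpL : normalOrder p = ∑ γ, algebraMap F (Weyl F n) (a γ) *
      normalOrder (monomial (ex γ) 1) := by
    simp only [p, map_sum]
    refine Finset.sum_congr rfl fun γ _ => ?_
    rw [← Algebra.smul_def, ← map_smul, smul_monomial, smul_eq_mul, mul_one]
  refine ⟨normalOrder p, ?_, ?_, ?_⟩
  · rw [hpL]
    refine sum_mem fun γ _ => mul_mem (Subalgebra.algebraMap_mem _ _)
      (normalOrder_monomial_mem_adjoin fun l hl => ?_)
    by_contra h
    exact hl (hex0 γ l fun h' => h (hls' h'))
  · intro h0
    have h1 : p = 0 := normalOrder_injective (h0.trans (map_zero _).symm)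
    have h2 := congrArg (coeff (ex γ₀)) h1
    simp only [p, coeff_sum, coeff_monomial, hexinj.eq_iff, Finset.sum_ite_eq', Finset.mem_univ,
      if_true, coeff_zero] at h2
    exact hγ₀ h2
  · intro i
    -- The dependency between coefficient vectors kills `q ^ K` times the value, and
    -- torsion-freeness removes the factor.
    have hz : ofX (q ^ K) • (normalOrder p • w i) = 0 := by
      have h1 : ∀ j, ∑ γ, (C (a γ) * c γ i j : MvPolynomial (Fin (n + 1)) F) = 0 := by
        intro j
        ext α
        rw [coeff_sum, coeff_zero]
        simp only [coeff_C_mul]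
        by_cases hα : ∀ x, α x < K * D + 1
        · have := congrFun ha ((i, j), fun x => ⟨α x, hα x⟩)
          rw [Finset.sum_apply] at this
          simp only [Pi.smul_apply, vec, smul_eq_mul, Pi.zero_apply] at this
          convert this using 4
          ext x; simp [box]
        · push Not at hα
          obtain ⟨x, hx⟩ := hα
          refine Finset.sum_eq_zero fun γ _ => ?_
          rw [coeff_eq_zero_of_totalDegree_lt, mul_zero]
          refine lt_of_le_of_lt (hcdeg γ i j) (lt_of_lt_of_le hx ?_)
          rw [← Finsupp.degree_apply]
          exact Finsupp.le_degree x α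
      rw [← poly_smul_def, hpL, Finset.sum_smul, Finset.smul_sum]
      have h2 : ∀ γ, q ^ K • ((algebraMap F (Weyl F n) (a γ) *
          normalOrder (monomial (ex γ) 1)) • w i) = ∑ j, (C (a γ) * c γ i j) • b j := by
        intro γ
        rw [mul_smul, algebraMap_smul', smul_comm, hc, Finset.smul_sum]
        simp only [mul_smul]
      rw [Finset.sum_congr rfl fun γ _ => h2 γ, Finset.sum_comm]
      refine Finset.sum_eq_zero fun j _ => ?_
      rw [← Finset.sum_smul, h1 j, zero_smul]
    exact (htf _ _ hz).resolve_left (pow_ne_zero _ hq)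

end Weyl
end

/-! ### Elimination of a letter modulo multiples of a derivation -/

noncomputable section

namespace Weyl

variable {F : Type u} [Field F] {n : ℕ}

/-! ### Elimination of a letter -/

theorem commute_of_mem_adjoin {S : Set (Letter n)} {l : Letter n}
    (h : ∀ l' ∈ S, Letter.comm l l' = 0) {A : Weyl F n}
    (hA : A ∈ Algebra.adjoin F (gen '' S)) : Commute (gen l) A := by
  refine Algebra.commute_of_mem_adjoin_of_forall_mem_commute hA ?_
  rintro _ ⟨l', hl', rfl⟩
  exact commute_of_comm (h l' hl')

/-- Because `l` commutes with the letters in `S`, evaluation at `gen l` of polynomials over the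
subalgebra of `S` is a ring homomorphism, although that subalgebra need not be commutative. Its
range contains all generators. -/
theorem exists_expansion {S : Set (Letter n)} {l : Letter n}
    (h : ∀ l' ∈ S, Letter.comm l l' = 0) {A : Weyl F n}
    (hA : A ∈ Algebra.adjoin F (gen '' insert l S)) :
    ∃ p : Polynomial (Algebra.adjoin F (gen (F := F) '' S)),
      A = p.sum fun j c => gen l ^ j * (c : Weyl F n) := by
  let ev : Polynomial (Algebra.adjoin F (gen (F := F) '' S)) →+* Weyl F n :=
    Polynomial.eval₂RingHom' (Algebra.adjoin F (gen (F := F) '' S)).val.toRingHom (gen l)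
      (fun c => (commute_of_mem_adjoin h c.2).symm)
  have hev : ∀ p, ev p = p.sum fun j c => gen l ^ j * (c : Weyl F n) := by
    intro p
    change Polynomial.eval₂ _ _ p = _
    rw [Polynomial.eval₂_eq_sum]
    refine Finset.sum_congr rfl fun j _ => ?_
    exact ((commute_of_mem_adjoin h (p.coeff j).2).pow_left j).symm
  suffices hr : A ∈ ev.range by
    obtain ⟨p, rfl⟩ := hr
    exact ⟨p, hev p⟩
  induction hA using Algebra.adjoin_induction with
  | mem x hx =>
    obtain ⟨l', hl' | hl', rfl⟩ := hx
    · exact ⟨Polynomial.X, by rw [hl']; exact Polynomial.eval₂_X _ _⟩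
    · exact ⟨Polynomial.C ⟨gen l', Algebra.subset_adjoin ⟨l', hl', rfl⟩⟩,
        Polynomial.eval₂_C _ _⟩
  | algebraMap r => exact ⟨Polynomial.C (algebraMap F _ r), Polynomial.eval₂_C _ _⟩
  | add x y _ _ hx hy => exact add_mem hx hy
  | mul x y _ _ hx hy => exact mul_mem hx hy

theorem der_mul_var_pow (a : Fin (n + 1)) (j : ℕ) :
    (gen (Sum.inr a) * gen (Sum.inl a) ^ j : Weyl F n) =
      gen (Sum.inl a) ^ j * gen (Sum.inr a) + (j : Weyl F n) * gen (Sum.inl a) ^ (j - 1) := by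
  have := der_mul_ofX (F := F) (n := n) a (MvPolynomial.X a ^ j)
  rw [Derivation.leibniz_pow, MvPolynomial.pderiv_X_self, smul_eq_mul, mul_one, nsmul_eq_mul,
    map_mul, map_natCast, map_pow, map_pow, ofX_X] at this
  exact this

/-- Each `∂` either passes to the right end, which gives a multiple `P ∂`, or differentiates a
factor `x`. A term without `∂` at the right arises only when all `r` derivations are consumed, hence
only for `j = r`, and it is then `r!`. -/
theorem der_pow_mul_var_pow (a : Fin (n + 1)) (r : ℕ) : ∀ j ≤ r,
    ∃ P ∈ Algebra.adjoin F (gen (F := F) '' {Sum.inl a, Sum.inr a}),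
      (gen (Sum.inr a) ^ r * gen (Sum.inl a) ^ j : Weyl F n) =
        (if j = r then (r.factorial : Weyl F n) else 0) + P * gen (Sum.inr a) := by
  induction r with
  | zero => intro j hj; obtain rfl := Nat.le_zero.1 hj; exact ⟨0, zero_mem _, by simp⟩
  | succ r ih =>
    have hx : gen (Sum.inl a) ∈ Algebra.adjoin F (gen (F := F) '' {Sum.inl a, Sum.inr a}) :=
      Algebra.subset_adjoin ⟨_, by simp, rfl⟩
    have hd : gen (Sum.inr a) ∈ Algebra.adjoin F (gen (F := F) '' {Sum.inl a, Sum.inr a}) :=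
      Algebra.subset_adjoin ⟨_, by simp, rfl⟩
    intro j hj
    have h1 : (gen (Sum.inr a) ^ (r + 1) * gen (Sum.inl a) ^ j : Weyl F n) =
        gen (Sum.inr a) ^ r * gen (Sum.inl a) ^ j * gen (Sum.inr a) +
          (j : Weyl F n) * (gen (Sum.inr a) ^ r * gen (Sum.inl a) ^ (j - 1)) := by
      rw [pow_succ, mul_assoc, der_mul_var_pow, mul_add, ← mul_assoc, ← mul_assoc, ← mul_assoc,
        (Nat.cast_commute j _).eq]
    rcases Nat.eq_zero_or_pos j with rfl | hj0
    · exact ⟨gen (Sum.inr a) ^ r, pow_mem hd r, by simp [pow_succ]⟩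
    · obtain ⟨P, hP, hPe⟩ := ih (j - 1) (by omega)
      refine ⟨gen (Sum.inr a) ^ r * gen (Sum.inl a) ^ j + (j : Weyl F n) * P,
        add_mem (mul_mem (pow_mem hd _) (pow_mem hx _)) (mul_mem (natCast_mem _ _) hP), ?_⟩
      rw [h1, hPe, mul_add, add_mul, mul_assoc (j : Weyl F n)]
      have h2 : (j - 1 = r) ↔ j = r + 1 := by omega
      simp only [h2]
      split_ifs with h
      · subst h; rw [Nat.factorial_succ]; push_cast; abel
      · simp

/-- The mirror image, with derivations moved to the left: every consumed derivation now contributes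
a sign. -/
theorem var_pow_mul_der_pow (a : Fin (n + 1)) (r : ℕ) : ∀ j ≤ r,
    ∃ Q ∈ Algebra.adjoin F (gen (F := F) '' {Sum.inl a, Sum.inr a}),
      (gen (Sum.inl a) ^ j * gen (Sum.inr a) ^ r : Weyl F n) =
        (if j = r then ((-1) ^ r * (r.factorial : Weyl F n)) else 0) + gen (Sum.inr a) * Q := by
  induction r with
  | zero => intro j hj; obtain rfl := Nat.le_zero.1 hj; exact ⟨0, zero_mem _, by simp⟩
  | succ r ih =>
    have hx : gen (Sum.inl a) ∈ Algebra.adjoin F (gen (F := F) '' {Sum.inl a, Sum.inr a}) :=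
      Algebra.subset_adjoin ⟨_, by simp, rfl⟩
    have hd : gen (Sum.inr a) ∈ Algebra.adjoin F (gen (F := F) '' {Sum.inl a, Sum.inr a}) :=
      Algebra.subset_adjoin ⟨_, by simp, rfl⟩
    intro j hj
    have h1 : (gen (Sum.inl a) ^ j * gen (Sum.inr a) ^ (r + 1) : Weyl F n) =
        gen (Sum.inr a) * (gen (Sum.inl a) ^ j * gen (Sum.inr a) ^ r) -
          (j : Weyl F n) * (gen (Sum.inl a) ^ (j - 1) * gen (Sum.inr a) ^ r) := by
      rw [pow_succ', ← mul_assoc, ← mul_assoc, ← mul_assoc, der_mul_var_pow, add_mul,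
        add_sub_cancel_right]
    rcases Nat.eq_zero_or_pos j with rfl | hj0
    · exact ⟨gen (Sum.inr a) ^ r, pow_mem hd r, by simp [pow_succ']⟩
    · obtain ⟨P, hP, hPe⟩ := ih (j - 1) (by omega)
      refine ⟨gen (Sum.inl a) ^ j * gen (Sum.inr a) ^ r - (j : Weyl F n) * P,
        sub_mem (mul_mem (pow_mem hx _) (pow_mem hd _)) (mul_mem (natCast_mem _ _) hP), ?_⟩
      rw [h1, hPe, mul_add, mul_sub, ← mul_assoc _ (j : Weyl F n), ← (Nat.cast_commute j _).eq]
      have h2 : (j - 1 = r) ↔ j = r + 1 := by omega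
      simp only [h2]
      split_ifs with h
      · subst h
        have h3 : ((r + 1 : ℕ) : Weyl F n) * ((-1) ^ r * (r.factorial : Weyl F n)) =
            -((-1) ^ (r + 1) * ((r + 1).factorial : Weyl F n)) := by
          rw [pow_succ, Nat.factorial_succ, Nat.cast_mul, mul_neg_one, neg_mul, neg_neg,
            ← mul_assoc, ← mul_assoc, (Nat.cast_commute (r + 1) _).eq]
        rw [h3, mul_assoc (((r + 1 : ℕ) : Weyl F n))]
        abel
      · noncomm_ring

theorem natCast_mul_ne_zero [CharZero F] {m : ℕ} (hm : m ≠ 0) {A : Weyl F n} (hA : A ≠ 0) :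
    (m : Weyl F n) * A ≠ 0 := by
  refine mul_ne_zero ?_ hA
  rw [← map_natCast (algebraMap F (Weyl F n)), map_ne_zero_iff _ (algebraMap F _).injective]
  exact_mod_cast hm

theorem comm_eq_zero_of_index_ne {l l' : Letter n} (h : l.index ≠ l'.index) :
    Letter.comm l l' = 0 := by
  rcases l with a | a <;> rcases l' with b | b
  · rfl
  · have : a ≠ b := by rintro rfl; exact h rfl
    simp [Letter.comm, this]
  · have : a ≠ b := by rintro rfl; exact h rfl
    simp [Letter.comm, this]
  · rfl

/-- Elimination of a variable `x_a`: modulo right multiples of `∂_a`. -/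
theorem exists_eliminate_var [CharZero F] {S : Set (Letter n)} {a : Fin (n + 1)}
    (h : ∀ l ∈ S, l.index ≠ a) {A : Weyl F n}
    (hA : A ∈ Algebra.adjoin F (gen '' insert (Sum.inl a) S)) (hne : A ≠ 0) :
    ∃ (r : ℕ) (L P : Weyl F n), L ∈ Algebra.adjoin F (gen '' S) ∧ L ≠ 0 ∧
      P ∈ Algebra.adjoin F (gen '' insert (Sum.inl a) (insert (Sum.inr a) S)) ∧
      gen (Sum.inr a) ^ r * A = L + P * gen (Sum.inr a) := by
  have hd : ∀ c ∈ Algebra.adjoin F (gen (F := F) '' S), Commute (gen (Sum.inr a)) c :=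
    fun c hc => commute_of_mem_adjoin (fun l hl => comm_eq_zero_of_index_ne (l := Sum.inr a) (h l hl).symm) hc
  obtain ⟨p, rfl⟩ := exists_expansion
    (fun l hl => comm_eq_zero_of_index_ne (l := Sum.inl a) (h l hl).symm) hA
  have hp : p ≠ 0 := by rintro rfl; simp at hne
  choose! P hP hPe using der_pow_mul_var_pow (F := F) (n := n) a p.natDegree
  -- With `A = ∑ x^j c_j` and `r` the degree, multiplication by `∂^r` turns the terms with `j < r`
  -- into multiples of `∂`, and leaves `r! c_r` from the leading term. The `c_j` commute with `∂`,
  -- so `∂` can be kept at the right end.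
  refine ⟨p.natDegree, p.natDegree.factorial * (p.leadingCoeff : Weyl F n),
    ∑ j ∈ Finset.range (p.natDegree + 1), P j * (p.coeff j : Weyl F n),
    mul_mem (natCast_mem _ _) p.leadingCoeff.2,
    natCast_mul_ne_zero (Nat.factorial_ne_zero _) (by simpa using hp), ?_, ?_⟩
  · refine sum_mem fun j hj => mul_mem (Algebra.adjoin_mono ?_ (hP j ?_))
      (Algebra.adjoin_mono ?_ (p.coeff j).2)
    · exact Set.image_mono (by
        rintro l (rfl | rfl)
        · exact Or.inl rfl
        · exact Or.inr (Or.inl rfl))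
    · exact Nat.lt_succ_iff.1 (Finset.mem_range.1 hj)
    · exact Set.image_mono fun l hl => Or.inr (Or.inr hl)
  · rw [Polynomial.sum_over_range _ (by simp), Finset.mul_sum, Finset.sum_mul]
    have : ∀ j ∈ Finset.range (p.natDegree + 1), gen (Sum.inr a) ^ p.natDegree *
        (gen (Sum.inl a) ^ j * (p.coeff j : Weyl F n)) =
        (if j = p.natDegree then p.natDegree.factorial * (p.coeff j : Weyl F n) else 0) +
          P j * (p.coeff j : Weyl F n) * gen (Sum.inr a) := by
      intro j hj
      rw [← mul_assoc, hPe j (Nat.lt_succ_iff.1 (Finset.mem_range.1 hj)), add_mul, mul_assoc,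
        (hd _ (p.coeff j).2).eq, mul_assoc]
      split_ifs <;> simp
    rw [Finset.sum_congr rfl this, Finset.sum_add_distrib, Finset.sum_ite_eq',
      if_pos (Finset.self_mem_range_succ _), Polynomial.leadingCoeff]

/-- Elimination of a derivation `∂_a`: modulo left multiples of `∂_a`. -/
theorem exists_eliminate_der [CharZero F] {S : Set (Letter n)} {a : Fin (n + 1)}
    (h : ∀ l ∈ S, l.index ≠ a) {A : Weyl F n}
    (hA : A ∈ Algebra.adjoin F (gen '' insert (Sum.inr a) S)) (hne : A ≠ 0) :
    ∃ (r : ℕ) (L Q : Weyl F n), L ∈ Algebra.adjoin F (gen '' S) ∧ L ≠ 0 ∧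
      Q ∈ Algebra.adjoin F (gen '' insert (Sum.inl a) (insert (Sum.inr a) S)) ∧
      gen (Sum.inl a) ^ r * A = L + gen (Sum.inr a) * Q := by
  obtain ⟨p, rfl⟩ := exists_expansion
    (fun l hl => comm_eq_zero_of_index_ne (l := Sum.inr a) (h l hl).symm) hA
  have hp : p ≠ 0 := by rintro rfl; simp at hne
  have key := fun j => var_pow_mul_der_pow (F := F) (n := n) a j p.natTrailingDegree
  choose! Q hQ hQe using key
  -- Here the lowest term is the one kept: `x^r ∂^j` lies in `∂ Q` for `j > r`, while `j = r`
  -- contributes the constant `(-1)^r r!`.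
  set r := p.natTrailingDegree with hr
  refine ⟨r, (-1) ^ r * (r.factorial * (p.trailingCoeff : Weyl F n)),
    ∑ j ∈ p.support, Q j * (p.coeff j : Weyl F n),
    mul_mem (pow_mem (neg_mem (one_mem _)) _) (mul_mem (natCast_mem _ _) p.trailingCoeff.2),
    mul_ne_zero (pow_ne_zero _ (neg_ne_zero.2 one_ne_zero))
      (natCast_mul_ne_zero (Nat.factorial_ne_zero _) (by simpa using hp)), ?_, ?_⟩
  · refine sum_mem fun j hj => mul_mem (Algebra.adjoin_mono ?_ (hQ j ?_))
      (Algebra.adjoin_mono ?_ (p.coeff j).2)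
    · exact Set.image_mono (by
        rintro l (rfl | rfl)
        · exact Or.inl rfl
        · exact Or.inr (Or.inl rfl))
    · exact Polynomial.natTrailingDegree_le_of_mem_supp _ hj
    · exact Set.image_mono fun l hl => Or.inr (Or.inr hl)
  · rw [Polynomial.sum_def, Finset.mul_sum, Finset.mul_sum]
    have : ∀ j ∈ p.support, gen (Sum.inl a) ^ r *
        (gen (Sum.inr a) ^ j * (p.coeff j : Weyl F n)) =
        (if r = j then (-1) ^ j * ((j.factorial : Weyl F n) * (p.coeff j : Weyl F n)) else 0) +
          gen (Sum.inr a) * (Q j * (p.coeff j : Weyl F n)) := by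
      intro j hj
      rw [← mul_assoc, hQe j (Polynomial.natTrailingDegree_le_of_mem_supp _ hj), add_mul,
        mul_assoc]
      split_ifs
      · rw [mul_assoc]
      · simp
    rw [Finset.sum_congr rfl this, Finset.sum_add_distrib, Finset.sum_ite_eq,
      if_pos (Polynomial.natTrailingDegree_mem_support_of_nonzero hp), Polynomial.trailingCoeff]

end Weyl
end

/-! ### Forms over a Weyl module and the induction on `s` -/

noncomputable section

namespace Weyl

variable {F : Type u} [Field F] {n : ℕ} {N : Type v} [AddCommGroup N] [Module (Weyl F n) N]

/-! ### Forms with coefficients in a module over the Weyl algebra -/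

/-- The sign of `dx_j` in `dx_J`. -/
def formSign (j : Fin n) (J : Finset (Fin n)) : ℤ := (-1) ^ (J.filter (fun i => i < j)).card

theorem formSign_mul_self (j : Fin n) (J : Finset (Fin n)) :
    formSign j J * formSign j J = 1 := by
  rw [formSign, ← pow_add, ← two_mul, pow_mul]; simp

theorem formSign_erase_self (j : Fin n) (J : Finset (Fin n)) :
    formSign j (J.erase j) = formSign j J := by
  unfold formSign
  congr 2
  ext i
  simp only [Finset.mem_filter, Finset.mem_erase]
  constructor
  · rintro ⟨⟨_, h⟩, h'⟩; exact ⟨h, h'⟩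
  · rintro ⟨h, h'⟩; exact ⟨⟨h'.ne, h⟩, h'⟩

theorem formSign_insert_self (j : Fin n) (J : Finset (Fin n)) :
    formSign j (insert j J) = formSign j J := by
  rw [← formSign_erase_self, ← formSign_erase_self j J]
  congr 1
  ext i; simp only [Finset.mem_erase, Finset.mem_insert]; tauto

theorem formSign_erase_of_lt {i j : Fin n} (h : i < j) (J : Finset (Fin n)) :
    formSign i (J.erase j) = formSign i J := by
  unfold formSign
  congr 2
  ext x
  simp only [Finset.mem_filter, Finset.mem_erase]
  constructor
  · rintro ⟨⟨_, h⟩, h'⟩; exact ⟨h, h'⟩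
  · rintro ⟨h1, h'⟩; exact ⟨⟨(h'.trans h).ne, h1⟩, h'⟩

theorem formSign_insert_of_lt {i j : Fin n} (h : i < j) (J : Finset (Fin n)) :
    formSign i (insert j J) = formSign i J := by
  rw [← formSign_erase_of_lt h, ← formSign_erase_of_lt h J]
  congr 1
  ext i; simp only [Finset.mem_erase, Finset.mem_insert]; tauto

theorem formSign_erase_of_gt {i j : Fin n} (h : i < j) {J : Finset (Fin n)} (hi : i ∈ J) :
    formSign j (J.erase i) = -formSign j J := by
  unfold formSign
  have hmem : i ∈ J.filter (fun x => x < j) := by simp [hi, h]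
  rw [Finset.filter_erase, ← Finset.card_erase_add_one hmem, pow_succ]
  simp

variable (F) in
/-- `d_s`, on forms with coefficients in a module over the Weyl algebra. -/
def formD (s : ℕ) : Form n N →+ Form n N where
  toFun ω J := ∑ j ∈ J with j.val < s,
    formSign j J • (gen (F := F) (Sum.inr j.succ) • ω (J.erase j))
  map_zero' := by ext; simp
  map_add' ω η := by ext; simp [Finset.sum_add_distrib]

theorem formD_apply (s : ℕ) (ω : Form n N) (J : Finset (Fin n)) :
    formD F s ω J = ∑ j ∈ J with j.val < s,
      formSign j J • (gen (F := F) (Sum.inr j.succ) • ω (J.erase j)) := rfl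

/-- Exterior multiplication by `dx_j`. -/
def wedge (j : Fin n) : Form n N →+ Form n N where
  toFun ω J := if j ∈ J then formSign j J • ω (J.erase j) else 0
  map_zero' := by ext; simp
  map_add' ω η := by ext J; simp only [Pi.add_apply]; split_ifs <;> simp

/-- Contraction with the vector field dual to `dx_j`. -/
def contract (j : Fin n) : Form n N →+ Form n N where
  toFun ω J := if j ∈ J then 0 else formSign j J • ω (insert j J)
  map_zero' := by ext; simp
  map_add' ω η := by ext J; simp only [Pi.add_apply]; split_ifs <;> simp

theorem wedge_apply (j : Fin n) (ω : Form n N) (J : Finset (Fin n)) :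
    wedge j ω J = if j ∈ J then formSign j J • ω (J.erase j) else 0 := rfl

theorem contract_apply (j : Fin n) (ω : Form n N) (J : Finset (Fin n)) :
    contract j ω J = if j ∈ J then 0 else formSign j J • ω (insert j J) := rfl

theorem wedge_wedge (j : Fin n) (ω : Form n N) : wedge j (wedge j ω) = 0 := by
  ext J; simp [wedge_apply]

/-- Supplies the decomposition `ω = ω₀ + dx_j ∧ ω₁` on which the induction runs; neither `ω₀` nor
`ω₁` involves `dx_j`. -/
theorem contract_wedge_add (j : Fin n) (ω : Form n N) :
    contract j (wedge j ω) + wedge j (contract j ω) = ω := by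
  ext J
  by_cases h : j ∈ J
  · simp [wedge_apply, contract_apply, h, Finset.insert_erase, smul_smul, formSign_erase_self,
      formSign_mul_self]
  · simp [wedge_apply, contract_apply, h, smul_smul, formSign_insert_self,
      formSign_mul_self]

theorem wedge_smul (j : Fin n) (A : Weyl F n) (ω : Form n N) :
    wedge j (A • ω) = A • wedge j ω := by
  ext J
  simp only [wedge_apply, Pi.smul_apply]
  split_ifs
  · rw [smul_comm]
  · rw [smul_zero]

theorem contract_smul (j : Fin n) (A : Weyl F n) (ω : Form n N) :
    contract j (A • ω) = A • contract j ω := by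
  ext J
  simp only [contract_apply, Pi.smul_apply]
  split_ifs
  · rw [smul_zero]
  · rw [smul_comm]

/-- `d_s` involves only `dx_i` with `i < s ≤ j`, and these anticommute with `dx_j`. -/
theorem formD_wedge {s : ℕ} {j : Fin n} (hs : s ≤ j.val) (ω : Form n N) :
    formD F s (wedge j ω) = -wedge j (formD F s ω) := by
  ext J
  rw [Pi.neg_apply, wedge_apply, formD_apply]
  split_ifs with h
  · rw [formD_apply, Finset.smul_sum, ← Finset.sum_neg_distrib]
    have hfil : (J.erase j).filter (fun i => i.val < s) = J.filter (fun i => i.val < s) := by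
      ext i
      simp only [Finset.mem_filter, Finset.mem_erase]
      constructor
      · rintro ⟨⟨_, h⟩, h'⟩; exact ⟨h, h'⟩
      · rintro ⟨h1, h'⟩
        exact ⟨⟨by rintro rfl; omega, h1⟩, h'⟩
    rw [hfil]
    refine Finset.sum_congr rfl fun i hi => ?_
    rw [Finset.mem_filter] at hi
    have hij : i < j := Fin.lt_def.2 (lt_of_lt_of_le hi.2 hs)
    rw [wedge_apply, if_pos (Finset.mem_erase.2 ⟨hij.ne', h⟩), formSign_erase_of_gt hij hi.1,
      formSign_erase_of_lt hij, Finset.erase_right_comm, neg_smul, smul_neg, smul_neg,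
      smul_comm (gen (F := F) (Sum.inr i.succ)) (formSign j J),
      smul_comm (formSign j J) (formSign i J)]
  · rw [neg_zero]
    refine Finset.sum_eq_zero fun i _ => ?_
    rw [wedge_apply, if_neg (fun h' => h (Finset.mem_of_mem_erase h')), smul_zero, smul_zero]

theorem formD_contract {s : ℕ} {j : Fin n} (hs : s ≤ j.val) (ω : Form n N) :
    formD F s (contract j ω) = -contract j (formD F s ω) := by
  ext J
  rw [Pi.neg_apply, contract_apply, formD_apply]
  split_ifs with h
  · rw [neg_zero]
    refine Finset.sum_eq_zero fun i hi => ?_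
    rw [Finset.mem_filter] at hi
    have hij : i < j := Fin.lt_def.2 (lt_of_lt_of_le hi.2 hs)
    rw [contract_apply, if_pos (Finset.mem_erase.2 ⟨hij.ne', h⟩), smul_zero, smul_zero]
  · rw [formD_apply, Finset.smul_sum, ← Finset.sum_neg_distrib]
    have hfil : (insert j J).filter (fun i => i.val < s) = J.filter (fun i => i.val < s) := by
      ext i
      simp only [Finset.mem_filter, Finset.mem_insert]
      constructor
      · rintro ⟨rfl | h, h'⟩
        · omega
        · exact ⟨h, h'⟩
      · rintro ⟨h1, h'⟩
        exact ⟨Or.inr h1, h'⟩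
    rw [hfil]
    refine Finset.sum_congr rfl fun i hi => ?_
    rw [Finset.mem_filter] at hi
    have hij : i < j := Fin.lt_def.2 (lt_of_lt_of_le hi.2 hs)
    rw [contract_apply, if_neg (fun h' => h (Finset.mem_of_mem_erase h')),
      formSign_erase_of_gt hij hi.1, formSign_insert_of_lt hij,
      Finset.erase_insert_of_ne hij.ne', neg_smul, smul_neg, smul_neg,
      smul_comm (gen (F := F) (Sum.inr i.succ)) (formSign j J),
      smul_comm (formSign j J) (formSign i J)]

/-- The element `s` of `Fin n` stands for the variable `x_{s+1}`, whence `Fin.succ`; its summand is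
the only new one. -/
theorem formD_succ {s : ℕ} (hs : s < n) (ω : Form n N) :
    formD F (s + 1) ω = formD F s ω +
      wedge ⟨s, hs⟩ (gen (F := F) (Sum.inr (Fin.succ ⟨s, hs⟩)) • ω) := by
  ext J
  rw [Pi.add_apply, formD_apply, formD_apply, wedge_apply]
  split_ifs with h
  · have hfil : J.filter (fun i => i.val < s + 1) =
        insert ⟨s, hs⟩ (J.filter (fun i => i.val < s)) := by
      ext i
      simp only [Finset.mem_filter, Finset.mem_insert, Fin.ext_iff]
      constructor
      · rintro ⟨h1, h2⟩
        rcases Nat.lt_succ_iff_lt_or_eq.1 h2 with h3 | h3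
        · exact Or.inr ⟨h1, h3⟩
        · exact Or.inl h3
      · rintro (h1 | ⟨h1, h2⟩)
        · refine ⟨?_, by omega⟩
          rwa [show i = ⟨s, hs⟩ from Fin.ext h1]
        · exact ⟨h1, by omega⟩
    rw [hfil, Finset.sum_insert (by simp), add_comm]
    rfl
  · have hfil : J.filter (fun i => i.val < s + 1) = J.filter (fun i => i.val < s) := by
      ext i
      simp only [Finset.mem_filter]
      refine and_congr_right fun h1 => ?_
      have : i.val ≠ s := by rintro h2; exact h (by rwa [show (⟨s, hs⟩ : Fin n) = i from Fin.ext h2.symm])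
      omega
    rw [hfil, add_zero]

theorem formD_zero (ω : Form n N) : formD F 0 ω = 0 := by
  ext J; simp [formD_apply]

/-- Letters of different variables commute, and `d_s` differentiates only in the variables of index
`1, …, s`. -/
theorem formD_smul {s : ℕ} {T : Set (Letter n)} (hT : ∀ l ∈ T, l.index = 0 ∨ s < l.index)
    {A : Weyl F n} (hA : A ∈ Algebra.adjoin F (gen '' T)) (ω : Form n N) :
    formD F s (A • ω) = A • formD F s ω := by
  ext J
  rw [Pi.smul_apply, formD_apply, formD_apply, Finset.smul_sum]
  refine Finset.sum_congr rfl fun j hj => ?_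
  have hc : Commute (gen (F := F) (Sum.inr j.succ)) A := by
    refine commute_of_mem_adjoin (fun l hl => comm_eq_zero_of_index_ne ?_) hA
    have h1 : Letter.index (Sum.inr j.succ : Letter n) = j.val + 1 := rfl
    have h2 := (Finset.mem_filter.1 hj).2
    rcases hT l hl with h | h <;> omega
  rw [Pi.smul_apply, ← mul_smul, hc.eq, mul_smul, smul_comm A (formSign j J)]

theorem formD_formD (s : ℕ) (hs : s ≤ n) (ω : Form n N) : formD F s (formD F s ω) = 0 := by
  induction s generalizing ω with
  | zero => exact formD_zero _
  | succ s ih =>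
    set j : Fin n := ⟨s, hs⟩
    have hsj : s ≤ j.val := le_rfl
    have hD : ∀ η : Form n N, formD F s (gen (F := F) (Sum.inr j.succ) • η) =
        gen (F := F) (Sum.inr j.succ) • formD F s η := fun η =>
      formD_smul (T := {Sum.inr j.succ}) (by
        rintro l rfl
        exact Or.inr (Nat.lt_succ_self s)) (Algebra.subset_adjoin ⟨_, rfl, rfl⟩) η
    rw [formD_succ hs, formD_succ hs, map_add, ih (by omega), smul_add, map_add, formD_wedge hsj,
      hD, ← wedge_smul, wedge_wedge]
    simp [j]

/-- The main theorem, for forms with coefficients in a torsion-free module of finite rank. -/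
theorem exists_formD_eq [CharZero F] (htf : IsTorsionFree F n N) {S : Set N} (hS : S.Finite)
    (hsat : sat F n S = ⊤) (s : ℕ) (hs : s ≤ n) (V : Finset (Letter n))
    (hV : ∀ l ∈ V, s < l.index) (hcard : n - s ≤ V.card) (ω : Form n N) (hω : formD F s ω = 0) :
    ∃ L ∈ Algebra.adjoin F (gen (F := F) '' (Letter.tPart n ∪ (V : Set (Letter n)))), L ≠ 0 ∧
      ∃ μ : Form n N, L • ω = formD F s μ := by
  classical
  induction s generalizing V ω with
  | zero =>
    -- As `d_0 = 0`, the operator must annihilate `ω`; `t`, `∂_t` and the at least `n` letters of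
    -- `V` are the `n + 2` letters required.
    have hdisj : Disjoint ({Sum.inl 0, Sum.inr 0} : Finset (Letter n)) V := by
      rw [Finset.disjoint_left]
      intro l hl hlV
      have := hV l hlV
      simp only [Finset.mem_insert, Finset.mem_singleton] at hl
      rcases hl with rfl | rfl <;> exact absurd this (lt_irrefl _)
    have hc : ({Sum.inl 0, Sum.inr 0} : Finset (Letter n)).card = 2 := by
      rw [Finset.card_pair (by simp)]
    obtain ⟨L, hL, hL0, hLω⟩ := exists_annihilator htf hS hsat ω
      (({Sum.inl 0, Sum.inr 0} : Finset (Letter n)) ∪ V)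
      (by rw [Finset.card_union_of_disjoint hdisj, hc]; omega)
    refine ⟨L, ?_, hL0, 0, ?_⟩
    · convert hL using 4
      simp [Letter.tPart, Set.insert_union]
    · rw [formD_zero]; ext I; exact hLω I
  | succ s ih =>
    set j : Fin n := ⟨s, hs⟩ with hj
    have hsj : s ≤ j.val := le_rfl
    set a : Fin (n + 1) := j.succ with ha
    have haval : a.val = s + 1 := rfl
    set T : Set (Letter n) := Letter.tPart n ∪ (V : Set (Letter n)) with hT
    have hTi : ∀ l ∈ T, l.index = 0 ∨ s + 1 < l.index := by
      rintro l ((rfl | rfl) | hl)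
      · exact Or.inl rfl
      · exact Or.inl rfl
      · exact Or.inr (hV l hl)
    have hTa : ∀ l ∈ T, l.index ≠ a := by
      intro l hl
      rcases hTi l hl with h | h <;> omega
    have hTx : ∀ l ∈ insert (Sum.inl a) (insert (Sum.inr a) T), l.index = 0 ∨ s < l.index := by
      rintro l (rfl | rfl | hl)
      · exact Or.inr (Nat.lt_succ_self s)
      · exact Or.inr (Nat.lt_succ_self s)
      · rcases hTi l hl with h | h
        · exact Or.inl h
        · exact Or.inr (by omega)
    set B := Algebra.adjoin F (gen (F := F) '' insert (Sum.inl a) (insert (Sum.inr a) T)) with hB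
    have hBd : ∀ A ∈ B, ∀ η : Form n N, formD F s (A • η) = A • formD F s η :=
      fun A hA η => formD_smul hTx hA η
    set x : Weyl F n := gen (Sum.inl a)
    set D : Weyl F n := gen (Sum.inr a)
    have hxB : x ∈ B := Algebra.subset_adjoin ⟨_, Or.inl rfl, rfl⟩
    have hDB : D ∈ B := Algebra.subset_adjoin ⟨_, Or.inr (Or.inl rfl), rfl⟩
    have hTB : Algebra.adjoin F (gen (F := F) '' T) ≤ B :=
      Algebra.adjoin_mono (Set.image_mono fun l hl => Or.inr (Or.inr hl))
    have hsucc : ∀ η : Form n N, formD F (s + 1) η = formD F s η + wedge j (D • η) :=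
      fun η => formD_succ hs η
    have hnot : ∀ l : Letter n, l.index = a → l ∉ V := by
      intro l hl hlV
      have := hV l hlV
      omega
    -- `V` contains neither letter of `x_{s+1}`, so adding either of them gives a set admissible for
    -- the induction hypothesis.
    have hins : ∀ l : Letter n, l.index = a →
        (∀ l' ∈ insert l V, s < l'.index) ∧ n - s ≤ (insert l V).card := by
      intro l hl
      refine ⟨fun l' hl' => ?_, ?_⟩
      · rcases Finset.mem_insert.1 hl' with rfl | hl'
        · omega
        · have := hV l' hl'; omega
      · rw [Finset.card_insert_of_notMem (hnot l hl)]; omega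
    have hset : ∀ l : Letter n, Letter.tPart n ∪ ((insert l V : Finset (Letter n)) :
        Set (Letter n)) = insert l T := by
      intro l
      rw [hT, Finset.coe_insert, Set.union_insert]
    -- the components of `ω` without and with `dx_j`
    rw [hsucc] at hω
    have h0 : formD F s (contract j (wedge j ω)) = 0 := by
      have := congrArg (fun η => contract j (wedge j η)) hω
      simp only [map_add, wedge_wedge, map_zero, add_zero] at this
      rw [formD_contract hsj, formD_wedge hsj, map_neg, neg_neg, this]
    have h1 : D • contract j (wedge j ω) = formD F s (contract j ω) := by
      have := congrArg (contract j) hω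
      rw [map_add, map_zero, wedge_smul, contract_smul] at this
      rw [formD_contract hsj, eq_neg_iff_add_eq_zero, add_comm]
      exact this
    set ω₀ := contract j (wedge j ω)
    set ω₁ := contract j ω
    have hω01 : ω = ω₀ + wedge j ω₁ := (contract_wedge_add j ω).symm
    -- the component without `dx_j`
    obtain ⟨A, hA, hA0, μ₀, hμ₀⟩ := ih (by omega) (insert (Sum.inl a) V) (hins _ rfl).1
      (hins _ rfl).2 ω₀ h0
    rw [hset] at hA
    obtain ⟨r, L₀, P, hL₀, hL₀0, hP, hrel⟩ := exists_eliminate_var hTa hA hA0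
    -- Read off from `L₀ = D^r A - P D`, `A ω₀ = d_s μ₀` and `D ω₀ = d_s ω₁`.
    set μ' := D ^ r • μ₀ - P • ω₁ with hμ'
    have hL₀ω₀ : L₀ • ω₀ = formD F s μ' := by
      rw [hμ', map_sub, hBd _ (pow_mem hDB r), hBd _ hP, ← hμ₀, ← h1, ← mul_smul, ← mul_smul,
        ← sub_smul, hrel, add_sub_cancel_right]
    have hLD : Commute D L₀ :=
      commute_of_mem_adjoin (fun l hl =>
        comm_eq_zero_of_index_ne (l := Sum.inr a) (hTa l hl).symm) hL₀
    -- Removing `d_{s+1} μ'` from `L₀ ω` leaves `dx_j ∧ η`. One has `d_s η = L₀ D ω₀ - D L₀ ω₀`,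
    -- which vanishes because `L₀` no longer involves `x_a`.
    set η := L₀ • ω₁ - D • μ' with hη
    have hηd : formD F s η = 0 := by
      rw [hη, map_sub, hBd _ (hTB hL₀), hBd _ hDB, ← h1, ← hL₀ω₀, ← mul_smul, ← mul_smul,
        hLD.eq, sub_self]
    have hrem : L₀ • ω = formD F (s + 1) μ' + wedge j η := by
      rw [hsucc, ← hL₀ω₀, hη, map_sub, wedge_smul, wedge_smul, hω01, smul_add]
      abel
    -- the component with `dx_j`
    obtain ⟨A', hA', hA'0, μ₁, hμ₁⟩ := ih (by omega) (insert (Sum.inr a) V) (hins _ rfl).1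
      (hins _ rfl).2 η hηd
    rw [hset] at hA'
    obtain ⟨r', L₁, Q, hL₁, hL₁0, hQ, hrel'⟩ := exists_eliminate_der hTa hA' hA'0
    have hL₁η : L₁ • η = formD F s (x ^ r' • μ₁) - D • (Q • η) := by
      rw [hBd _ (pow_mem hxB r'), ← hμ₁, ← mul_smul, ← mul_smul, ← sub_smul, hrel',
        add_sub_cancel_right]
    -- Since `d_s (Q η) = 0`, the leftover `dx_j ∧ D Q η` is `d_{s+1} (Q η)`; this is why the second
    -- elimination keeps `D` on the left.
    have hw : wedge j (L₁ • η) = formD F (s + 1) (-(wedge j (x ^ r' • μ₁) + Q • η)) := by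
      rw [hL₁η, map_neg, map_add, hsucc, hsucc, formD_wedge hsj, hBd _ hQ, hηd, smul_zero,
        ← wedge_smul, wedge_wedge, map_sub]
      abel
    refine ⟨L₁ * L₀, mul_mem hL₁ hL₀, mul_ne_zero hL₁0 hL₀0,
      L₁ • μ' + -(wedge j (x ^ r' • μ₁) + Q • η), ?_⟩
    rw [mul_smul, hrem, smul_add, ← wedge_smul, hw, ← formD_smul hTi hL₁, ← map_add]

end Weyl
end

/-! ### A universal module and formal certificates -/

noncomputable section

namespace Weyl

attribute [local instance] polyModule

variable {F : Type u} [Field F] {n : ℕ}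

/-! ### The universal solution of a system of annihilating operators -/

/-- The elements of which a nonzero polynomial multiple lies in a given submodule. -/
def torsionClosure {N : Type v} [AddCommGroup N] [Module (Weyl F n) N]
    (H : Submodule (Weyl F n) N) : Submodule (Weyl F n) N where
  carrier := {f | ∃ q : MvPolynomial (Fin (n + 1)) F, q ≠ 0 ∧ ofX q • f ∈ H}
  zero_mem' := ⟨1, one_ne_zero, by simp⟩
  add_mem' := by
    rintro f g ⟨q, hq, hf⟩ ⟨r, hr, hg⟩
    refine ⟨q * r, mul_ne_zero hq hr, ?_⟩
    rw [smul_add]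
    refine add_mem ?_ ?_
    · rw [mul_comm, map_mul, mul_smul]; exact H.smul_mem _ hf
    · rw [map_mul, mul_smul]; exact H.smul_mem _ hg
  smul_mem' := by
    intro A f hf
    -- Seen as a saturation, the set is stable under the derivations by `der_mem_sat`.
    have hsat : ∀ g : N, (∃ q : MvPolynomial (Fin (n + 1)) F, q ≠ 0 ∧ ofX q • g ∈ H) ↔
        g ∈ sat F n (H : Set N) := by
      intro g
      have hspan : ∀ x, x ∈ Submodule.span (MvPolynomial (Fin (n + 1)) F) (H : Set N) ↔ x ∈ H := by
        intro x
        refine ⟨fun hx => ?_, fun hx => Submodule.subset_span hx⟩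
        induction hx using Submodule.span_induction with
        | mem x hx => exact hx
        | zero => exact H.zero_mem
        | add x y _ _ hx hy => exact H.add_mem hx hy
        | smul c x _ hx => exact H.smul_mem _ hx
      simp only [mem_sat, poly_smul_def, hspan]
    let P : Submodule F (Weyl F n) :=
      { carrier := {A | A • f ∈ sat F n (H : Set N)}
        zero_mem' := by simp
        add_mem' := by
          intro A B hA hB
          simp only [Set.mem_ofPred_eq, add_smul] at *
          exact add_mem hA hB
        smul_mem' := by
          intro c A hA
          simp only [Set.mem_ofPred_eq] at *
          rw [Algebra.smul_def, mul_smul, algebraMap_smul']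
          exact Submodule.smul_mem _ _ hA }
    refine (hsat _).2 (mem_of_stable P ?_ ?_ A)
    · simpa [P] using (hsat f).1 hf
    · intro l A hA
      change (gen l * A) • f ∈ sat F n (H : Set N)
      rw [mul_smul]
      rcases l with b | b
      · rw [var_smul]; exact Submodule.smul_mem _ _ hA
      · exact der_mem_sat (subset_sat _) b (fun s hs => subset_sat _ (H.smul_mem _ hs)) hA

theorem isTorsionFree_quotient_torsionClosure {N : Type v} [AddCommGroup N] [Module (Weyl F n) N]
    (H : Submodule (Weyl F n) N) : IsTorsionFree F n (N ⧸ torsionClosure H) := by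
  intro q f hf
  obtain ⟨f, rfl⟩ := Submodule.Quotient.mk_surjective _ f
  rw [← Submodule.Quotient.mk_smul, Submodule.Quotient.mk_eq_zero] at hf
  obtain ⟨r, hr, hf⟩ := hf
  by_cases hq : q = 0
  · exact Or.inl hq
  · refine Or.inr ((Submodule.Quotient.mk_eq_zero _).2 ⟨r * q, mul_ne_zero hr hq, ?_⟩)
    rwa [map_mul, mul_smul]

/-- The operator `∑ c_j ∂_a ^ j` with polynomial coefficients to the left. -/
def ofPolyDer (a : Fin (n + 1)) : Polynomial (MvPolynomial (Fin (n + 1)) F) →+ Weyl F n where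
  toFun p := p.sum fun j c => ofX c * gen (Sum.inr a) ^ j
  map_zero' := Polynomial.sum_zero_index _
  map_add' p q := Polynomial.sum_add_index _ _ _
    (fun i => by rw [map_zero, zero_mul])
    (by intro i x y; rw [map_add, add_mul])

theorem ofPolyDer_monomial (a : Fin (n + 1)) (j : ℕ) (c : MvPolynomial (Fin (n + 1)) F) :
    ofPolyDer a (Polynomial.monomial j c) = ofX c * gen (Sum.inr a) ^ j :=
  Polynomial.sum_monomial_index c (fun j c => ofX c * gen (Sum.inr a) ^ j)
    (by rw [map_zero, zero_mul])

theorem ofPolyDer_smul {N : Type v} [AddCommGroup N] [Module (Weyl F n) N] (a : Fin (n + 1))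
    (p : Polynomial (MvPolynomial (Fin (n + 1)) F)) (f : N) :
    ofPolyDer a p • f = p.sum fun j c => c • (gen (F := F) (Sum.inr a) ^ j • f) := by
  change (p.sum fun j c => ofX c * gen (Sum.inr a) ^ j) • f = _
  rw [Polynomial.sum_def, Finset.sum_smul, Polynomial.sum_def]
  refine Finset.sum_congr rfl fun j _ => ?_
  rw [poly_smul_def, mul_smul]

theorem ofPolyDer_mul_var (a : Fin (n + 1)) (p : Polynomial (MvPolynomial (Fin (n + 1)) F)) :
    ofPolyDer a p * gen (Sum.inl a) =
      gen (Sum.inl a) * ofPolyDer a p + ofPolyDer a (Polynomial.derivative p) := by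
  induction p using Polynomial.induction_on' with
  | add p q hp hq => simp only [map_add, add_mul, mul_add, hp, hq]; abel
  | monomial j c =>
    have h : gen (F := F) (Sum.inr a) ^ j = ofD (MvPolynomial.X a ^ j) := by
      rw [map_pow, ofD_X]
    have hc : ofX c * gen (Sum.inl a) = gen (Sum.inl a) * ofX c := by
      rw [← ofX_X, ← map_mul, ← map_mul, mul_comm]
    rw [Polynomial.derivative_monomial, ofPolyDer_monomial, ofPolyDer_monomial, h, mul_assoc,
      ofD_mul_var, mul_add, ← mul_assoc, hc, mul_assoc]
    congr 1
    rw [Derivation.leibniz_pow, MvPolynomial.pderiv_X_self, smul_eq_mul, mul_one, nsmul_eq_mul,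
      map_mul, map_mul, map_pow, ofD_X, map_natCast, map_natCast, mul_assoc]

/-- The commutator with `x_a` differentiates with respect to `∂_a`, so by induction on the degree
the derivative of a polynomial in the kernel vanishes. In characteristic zero the polynomial is then
constant, where `ofX` is injective. -/
theorem ofPolyDer_injective [CharZero F] (a : Fin (n + 1)) :
    Function.Injective (ofPolyDer (F := F) a) := by
  rw [injective_iff_map_eq_zero]
  intro p
  induction hd : p.natDegree using Nat.strong_induction_on generalizing p with
  | _ d ih =>
    intro hp
    have hder : ofPolyDer a (Polynomial.derivative p) = 0 := by
      have := ofPolyDer_mul_var a p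
      rwa [hp, zero_mul, mul_zero, zero_add, eq_comm] at this
    have hp' : Polynomial.derivative p = 0 := by
      rcases Nat.eq_zero_or_pos d with h | h
      · rw [Polynomial.eq_C_of_natDegree_eq_zero (hd.trans h), Polynomial.derivative_C]
      · exact ih _ (hd ▸ Polynomial.natDegree_derivative_lt (by omega)) _ rfl hder
    have h0 := Polynomial.eq_C_of_natDegree_eq_zero
      (Polynomial.derivative_eq_zero.1 hp')
    rw [h0, ← Polynomial.monomial_zero_left, ofPolyDer_monomial, pow_zero, mul_one,
      map_eq_zero_iff _ ofX_injective] at hp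
    rw [h0, hp, map_zero]

theorem ofPolyDer_mem_adjoin (a : Fin (n + 1)) (p : Polynomial (MvPolynomial (Fin (n + 1)) F)) :
    ofPolyDer a p ∈ Algebra.adjoin F
      (gen (F := F) '' insert (Sum.inr a) (Set.range Sum.inl)) := by
  refine sum_mem fun j _ => mul_mem (ofX_mem_adjoin ?_) (pow_mem (Algebra.subset_adjoin
    (Set.mem_image_of_mem _ (Set.mem_insert _ _))) j)
  have : {b : Fin (n + 1) | (Sum.inl b : Letter n) ∈
      insert (Sum.inr a) (Set.range Sum.inl)} = Set.univ := by ext; simp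
  rw [this, MvPolynomial.supported_univ]
  trivial

/-- An operator in the single derivation `∂_a` with polynomial coefficients can be written with the
coefficients to the left. -/
theorem exists_ofPolyDer_eq {a : Fin (n + 1)} {A : Weyl F n}
    (hA : A ∈ Algebra.adjoin F (gen (F := F) '' insert (Sum.inr a) (Set.range Sum.inl))) :
    ∃ p : Polynomial (MvPolynomial (Fin (n + 1)) F), ofPolyDer a p = A := by
  let P : Submodule F (Weyl F n) :=
    { carrier := ((ofPolyDer (F := F) a).range : Set (Weyl F n))
      zero_mem' := zero_mem _
      add_mem' := fun hA hB => add_mem hA hB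
      smul_mem' := by
        rintro c _ ⟨p, rfl⟩
        refine AddMonoidHom.mem_range.2 ?_
        induction p using Polynomial.induction_on' with
        | add p q hp hq =>
          rw [map_add, smul_add]
          exact (ofPolyDer a).range.add_mem hp hq
        | monomial j q =>
          refine ⟨Polynomial.monomial j (MvPolynomial.C c * q), ?_⟩
          rw [ofPolyDer_monomial, ofPolyDer_monomial, map_mul, ← MvPolynomial.algebraMap_eq,
            AlgHom.commutes, Algebra.smul_def, mul_assoc] }
  have hP : A ∈ P := by
    refine mem_of_mem_adjoin P ⟨Polynomial.monomial 0 1, by rw [ofPolyDer_monomial]; simp⟩ ?_ hA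
    rintro l hl _ ⟨p, rfl⟩
    change gen l * ofPolyDer a p ∈ (ofPolyDer a).range
    induction p using Polynomial.induction_on' with
    | add p q hp hq =>
      rw [map_add, mul_add]
      exact add_mem hp hq
    | monomial j q =>
      rcases hl with rfl | ⟨b, rfl⟩
      · refine ⟨Polynomial.monomial (j + 1) q +
          Polynomial.monomial j (MvPolynomial.pderiv a q), ?_⟩
        rw [map_add, ofPolyDer_monomial, ofPolyDer_monomial, ofPolyDer_monomial, ← mul_assoc,
          der_mul_ofX, add_mul, mul_assoc, ← pow_succ']
      · refine ⟨Polynomial.monomial j (MvPolynomial.X b * q), ?_⟩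
        rw [ofPolyDer_monomial, ofPolyDer_monomial, map_mul, ofX_X, mul_assoc]
  exact hP

theorem isAlgebraicFor_of_smul_eq_zero {N : Type v} [AddCommGroup N] [Module (Weyl F n) N]
    {a : Fin (n + 1)} {A : Weyl F n}
    (hA : A ∈ Algebra.adjoin F (gen (F := F) '' insert (Sum.inr a) (Set.range Sum.inl)))
    (hA0 : A ≠ 0) {f : N} (hf : A • f = 0) : IsAlgebraicFor F n a f := by
  obtain ⟨p, rfl⟩ := exists_ofPolyDer_eq hA
  exact isAlgebraicFor_of_sum_eq_zero (p := p) (by rintro rfl; simp at hA0)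
    ((ofPolyDer_smul a p f).symm.trans hf)

theorem IsAlgebraicFor.exists_smul_eq_zero [CharZero F] {N : Type v} [AddCommGroup N]
    [Module (Weyl F n) N] {a : Fin (n + 1)} {f : N} (hf : IsAlgebraicFor F n a f) :
    ∃ A ∈ Algebra.adjoin F (gen (F := F) '' insert (Sum.inr a) (Set.range Sum.inl)),
      A ≠ 0 ∧ A • f = 0 := by
  obtain ⟨p, hp, h⟩ := hf.exists_sum_eq_zero
  exact ⟨ofPolyDer a p, ofPolyDer_mem_adjoin a p,
    (map_ne_zero_iff _ (ofPolyDer_injective a)).2 hp, (ofPolyDer_smul a p f).trans h⟩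

/-- The coefficient of the form with index `I` in the coefficient of `d_s` with index `J`. -/
def formDCoeff (F : Type u) [Field F] {n : ℕ} (s : ℕ) (J I : Finset (Fin n)) : Weyl F n :=
  ∑ j ∈ J with j.val < s, if J.erase j = I then formSign j J • gen (Sum.inr j.succ) else 0

theorem formD_apply_eq_sum {N : Type v} [AddCommGroup N] [Module (Weyl F n) N] (s : ℕ)
    (ω : Form n N) (J : Finset (Fin n)) :
    formD F s ω J = ∑ I, formDCoeff F s J I • ω I := by
  simp only [formDCoeff, Finset.sum_smul]
  rw [formD_apply, Finset.sum_comm]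
  refine Finset.sum_congr rfl fun j _ => ?_
  rw [Finset.sum_eq_single (J.erase j) (fun I _ hI => by rw [if_neg hI.symm, zero_smul])
    (fun h => absurd (Finset.mem_univ _) h), if_pos rfl, smul_assoc]

theorem formD_map {N N' : Type*} [AddCommGroup N] [Module (Weyl F n) N] [AddCommGroup N']
    [Module (Weyl F n) N'] (f : N →ₗ[Weyl F n] N') (s : ℕ) (ω : Form n N) :
    formD F s (fun I => f (ω I)) = fun J => f (formD F s ω J) := by
  ext J
  simp only [formD_apply, map_sum, map_smul, map_zsmul]

/-- Given annihilating operators for the coefficients of a form, there is an operator `L` and a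
table `M` such that `L ω = d_s (M ω)` is a formal consequence of `d_s ω = 0`. -/
theorem exists_certificate [CharZero F] (A : Fin (n + 1) → Finset (Fin n) → Weyl F n)
    (hA : ∀ a I, A a I ∈ Algebra.adjoin F
      (gen (F := F) '' insert (Sum.inr a) (Set.range Sum.inl)))
    (hA0 : ∀ a I, A a I ≠ 0) (s : ℕ) (hs : s ≤ n) (V : Finset (Letter n))
    (hV : ∀ l ∈ V, s < l.index) (hcard : n - s ≤ V.card) :
    ∃ L ∈ Algebra.adjoin F (gen (F := F) '' (Letter.tPart n ∪ (V : Set (Letter n)))), L ≠ 0 ∧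
      ∃ M : Finset (Fin n) → Finset (Fin n) → Weyl F n, ∀ J,
        ∃ q : MvPolynomial (Fin (n + 1)) F, q ≠ 0 ∧
        ∃ (B : Fin (n + 1) → Finset (Fin n) → Weyl F n) (R : Finset (Fin n) → Weyl F n), ∀ I,
          ofX q * ((if J = I then L else 0) - ∑ J', formDCoeff F s J J' * M J' I) =
            ∑ a, B a I * A a I + ∑ J', R J' * formDCoeff F s J' I := by
  classical
  -- The tautological form on a free module: its coefficients are the basis vectors, and `H` imposes
  -- exactly the known relations `A a I • e I = 0` and `d_s e = 0`. Dividing out the torsion makes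
  -- `exists_formD_eq` applicable; the torsion reappears as the polynomial `q`.
  let e : Form n (Finset (Fin n) → Weyl F n) := fun I => Pi.single I 1
  let g : (Fin (n + 1) × Finset (Fin n)) ⊕ Finset (Fin n) →
      (Finset (Fin n) → Weyl F n) :=
    Sum.elim (fun p => A p.1 p.2 • e p.2) (formD F s e)
  let H : Submodule (Weyl F n)
      (Finset (Fin n) → Weyl F n) := Submodule.span (Weyl F n) (Set.range g)
  let T := torsionClosure H
  have hHT : H ≤ T := fun x hx => ⟨1, one_ne_zero, by simpa using hx⟩
  have hgT : ∀ i, T.mkQ (g i) = 0 := fun i =>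
    (Submodule.Quotient.mk_eq_zero T).2 (hHT (Submodule.subset_span ⟨i, rfl⟩))
  let ē : Form n ((Finset (Fin n) → Weyl F n) ⧸ T) := fun I => T.mkQ (e I)
  have hdē : formD F s ē = 0 := by
    rw [formD_map]
    ext J
    exact hgT (Sum.inr J)
  have hspan : Submodule.span (Weyl F n) (Set.range ē) = ⊤ := by
    have h1 : Submodule.span (Weyl F n) (Set.range e) = ⊤ := by
      have := (Pi.basisFun (Weyl F n) (Finset (Fin n))).span_eq
      rw [← this]
      congr 2
      ext I : 1
      simp [e]
    have h2 : Set.range ē = T.mkQ '' Set.range e := by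
      rw [← Set.range_comp]; rfl
    rw [h2, Submodule.span_image, h1, Submodule.map_top, Submodule.range_mkQ]
  have halg : ∀ a I, IsAlgebraicFor F n a (ē I) := by
    intro a I
    refine isAlgebraicFor_of_smul_eq_zero (hA a I) (hA0 a I) ?_
    rw [← map_smul]
    exact hgT (Sum.inl (a, I))
  obtain ⟨S, hS, hsat⟩ := exists_finite_sat_eq_top ē hspan halg
  obtain ⟨L, hL, hL0, μ, hμ⟩ := exists_formD_eq (isTorsionFree_quotient_torsionClosure H) hS hsat
    s hs V hV hcard ē hdē
  -- Lifting the primitive to the free module reads off the table `M`.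
  choose M hM using fun J => T.mkQ_surjective (μ J)
  obtain rfl : μ = fun J => T.mkQ (M J) := funext fun J => (hM J).symm
  rw [formD_map] at hμ
  refine ⟨L, hL, hL0, M, fun J => ?_⟩
  have hJ := congrFun hμ J
  rw [Pi.smul_apply, ← map_smul, ← sub_eq_zero, ← map_sub] at hJ
  obtain ⟨q, hq, hqm⟩ := (Submodule.Quotient.mk_eq_zero T).1 hJ
  -- Membership in `H` provides the cofactors: `B` for the annihilating operators and `R` for the
  -- closedness relations.
  obtain ⟨c, hc⟩ := (Submodule.mem_span_range_iff_exists_fun _).1 hqm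
  refine ⟨q, hq, fun a I => c (Sum.inl (a, I)), fun J' => c (Sum.inr J'), fun I => ?_⟩
  have hI := congrFun hc I
  rw [formD_apply_eq_sum, Fintype.sum_sum_type, Fintype.sum_prod_type] at hI
  simp only [g, Sum.elim_inl, Sum.elim_inr, formD_apply_eq_sum, Finset.sum_apply, Pi.add_apply,
    Pi.smul_apply, Pi.sub_apply, smul_eq_mul, e, Pi.single_apply, mul_ite, mul_one, mul_zero,
    Finset.sum_ite_eq, Finset.mem_univ, if_true] at hI
  simp only [eq_comm (a := J)]
  exact hI.symm

end Weyl
end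

/-! ### Computability on lists and semidecidable predicates -/

noncomputable section

namespace Computable

variable {α : Type*} {β : Type*} {σ : Type*} [Primcodable α] [Primcodable β] [Primcodable σ]

/-- The fold is a recursion on the length of the prefix already read. Each step looks up the next
entry; the default branch for an index out of range is never reached. -/
theorem list_foldl {f : α → List β} {g : α → σ} {h : α → σ × β → σ} (hf : Computable f)
    (hg : Computable g) (hh : Computable₂ h) :
    Computable fun a => (f a).foldl (fun s b => h a (s, b)) (g a) := by
  let step : α → ℕ × σ → σ := fun a q =>
    Option.casesOn (motive := fun _ => σ) ((f a)[q.1]?) q.2 (fun b => h a (q.2, b))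
  have hstep : Computable₂ step :=
    Computable.option_casesOn
      (list_getElem?.comp (hf.comp Computable.fst) (Computable.fst.comp Computable.snd))
      (Computable.snd.comp Computable.snd)
      (hh.comp (Computable.fst.comp Computable.fst)
        (Computable.pair (Computable.snd.comp (Computable.snd.comp Computable.fst))
          Computable.snd)).to₂
  refine (Computable.nat_rec (list_length.comp hf) hg hstep).of_eq fun a => ?_
  have key : ∀ m, m ≤ (f a).length →
      (Nat.rec (motive := fun _ => σ) (g a) (fun i s => step a (i, s)) m : σ) =
        ((f a).take m).foldl (fun s b => h a (s, b)) (g a) := by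
    intro m
    induction m with
    | zero => intro _; simp
    | succ m ih =>
      intro hm
      change step a (m, Nat.rec (motive := fun _ => σ) (g a) (fun i s => step a (i, s)) m) = _
      rw [ih (by omega), List.take_add_one, List.foldl_append]
      have : (f a)[m]? = some ((f a)[m]'(by omega)) := List.getElem?_eq_getElem (by omega)
      simp only [step, this]
      rfl
  refine (key _ le_rfl).trans ?_
  rw [List.take_length]

theorem list_foldr {f : α → List β} {g : α → σ} {h : α → β × σ → σ} (hf : Computable f)
    (hg : Computable g) (hh : Computable₂ h) :
    Computable fun a => (f a).foldr (fun b s => h a (b, s)) (g a) := by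
  refine (list_foldl (h := fun a (q : σ × β) => h a (q.2, q.1)) (list_reverse.comp hf) hg
    (hh.comp Computable.fst (Computable.pair (Computable.snd.comp Computable.snd)
      (Computable.fst.comp Computable.snd))).to₂).of_eq fun a => ?_
  rw [List.foldl_reverse]

theorem list_map {f : α → List β} {g : α → β → σ} (hf : Computable f) (hg : Computable₂ g) :
    Computable fun a => (f a).map (g a) := by
  refine (list_foldr (h := fun a (q : β × List σ) => g a q.1 :: q.2) hf (const [])
    (list_cons.comp (hg.comp Computable.fst (Computable.fst.comp Computable.snd))
      (Computable.snd.comp Computable.snd)).to₂).of_eq fun a => ?_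
  induction f a with
  | nil => rfl
  | cons b l ih => simp

theorem list_flatMap {f : α → List β} {g : α → β → List σ} (hf : Computable f)
    (hg : Computable₂ g) : Computable fun a => (f a).flatMap (g a) := by
  refine (list_foldr (h := fun a (q : β × List σ) => g a q.1 ++ q.2) hf (const [])
    (list_append.comp (hg.comp Computable.fst (Computable.fst.comp Computable.snd))
      (Computable.snd.comp Computable.snd)).to₂).of_eq fun a => ?_
  induction f a with
  | nil => rfl
  | cons b l ih => simpa [List.flatMap_cons] using ih

theorem list_all {f : α → List β} {g : α → β → Bool} (hf : Computable f) (hg : Computable₂ g) :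
    Computable fun a => (f a).all (g a) := by
  refine (list_foldr (h := fun a (q : β × Bool) => g a q.1 && q.2) hf (const true)
    ((Primrec.and.to_comp).comp (hg.comp Computable.fst (Computable.fst.comp Computable.snd))
      (Computable.snd.comp Computable.snd)).to₂).of_eq fun a => ?_
  induction f a with
  | nil => rfl
  | cons b l ih => simpa using congrArg (g a b && ·) ih

/-- The list of indices is fixed, so no uniformity of `g` in the index is required. -/
theorem flatMap_list {ι : Type*} (l : List ι) {g : ι → α → List σ}
    (hg : ∀ i, Computable (g i)) : Computable fun a => l.flatMap fun i => g i a := by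
  induction l with
  | nil => exact const []
  | cons i l ih => simpa only [List.flatMap_cons] using list_append.comp (hg i) ih

theorem decide_eq [DecidableEq β] {f g : α → β} (hf : Computable f) (hg : Computable g) :
    Computable fun a => decide (f a = g a) :=
  (Primrec.eq (α := β)).decide.to_comp.comp hf hg

theorem apply_fin {m : ℕ} {f : α → Fin m → σ} (hf : Computable f) (i : Fin m) :
    Computable fun a => f a i :=
  fin_app.comp hf (const i)

theorem apply_table {n : ℕ} {σ : Type u} [Primcodable σ] {f : α → Finset (Fin n) → σ}
    (hf : Computable f) (I : Finset (Fin n)) : Computable fun a => f a I := by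
  have h : Computable (Equiv.arrowCongr (Fintype.equivFin (Finset (Fin n))) (Equiv.refl σ)) :=
    Primrec.of_equiv.to_comp
  refine (apply_fin (h.comp hf) (Fintype.equivFin _ I)).of_eq fun a => ?_
  simp [Equiv.arrowCongr]

end Computable

/-- A predicate that is verified by a computable search for a natural number. -/
def IsSemidecidable {α : Type*} [Primcodable α] (P : α → Prop) : Prop :=
  ∃ c : α → ℕ → Bool, Computable₂ c ∧ ∀ a, P a ↔ ∃ m, c a m = true

namespace IsSemidecidable

variable {α : Type*} {β : Type*} [Primcodable α] [Primcodable β]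

theorem of_computable {c : α → Bool} (hc : Computable c) {P : α → Prop}
    (h : ∀ a, P a ↔ c a = true) : IsSemidecidable P :=
  ⟨fun a _ => c a, (hc.comp Computable.fst).to₂, fun a => by simp [h]⟩

theorem congr {P Q : α → Prop} (hP : IsSemidecidable P) (h : ∀ a, Q a ↔ P a) :
    IsSemidecidable Q := by
  obtain rfl : Q = P := funext fun a => propext (h a)
  exact hP

theorem comp {P : β → Prop} (hP : IsSemidecidable P) {f : α → β} (hf : Computable f) :
    IsSemidecidable fun a => P (f a) := by
  obtain ⟨c, hc, h⟩ := hP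
  exact ⟨fun a m => c (f a) m, (hc.comp (hf.comp Computable.fst) Computable.snd).to₂,
    fun a => h (f a)⟩

theorem and {P Q : α → Prop} (hP : IsSemidecidable P) (hQ : IsSemidecidable Q) :
    IsSemidecidable fun a => P a ∧ Q a := by
  obtain ⟨c, hc, h⟩ := hP
  obtain ⟨d, hd, h'⟩ := hQ
  refine ⟨fun a m => c a m.unpair.1 && d a m.unpair.2, ?_, fun a => ?_⟩
  · have hu : Computable fun q : α × ℕ => q.2.unpair := Computable.unpair.comp Computable.snd
    exact (Primrec.and.to_comp.comp (hc.comp Computable.fst (Computable.fst.comp hu))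
      (hd.comp Computable.fst (Computable.snd.comp hu))).to₂
  · refine (and_congr (h a) (h' a)).trans ?_
    constructor
    · rintro ⟨⟨m, hm⟩, m', hm'⟩
      exact ⟨Nat.pair m m', by simp [hm, hm']⟩
    · rintro ⟨m, hm⟩
      rw [Bool.and_eq_true] at hm
      exact ⟨⟨_, hm.1⟩, _, hm.2⟩

/-- One of the two constant answers is correct and both are computable; which one it is need not be
known. -/
theorem const (p : Prop) : IsSemidecidable fun _ : α => p := by
  classical
  exact of_computable (Computable.const (decide p)) fun _ => by simp

theorem forall_fintype {ι : Type*} [Finite ι] {P : ι → α → Prop}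
    (hP : ∀ i, IsSemidecidable (P i)) : IsSemidecidable fun a => ∀ i, P i a := by
  classical
  cases nonempty_fintype ι
  have key : ∀ t : Finset ι, IsSemidecidable fun a => ∀ i ∈ t, P i a := by
    intro t
    induction t using Finset.induction_on with
    | empty => exact (const True).congr fun a => by simp
    | insert i t _ ih => exact ((hP i).and ih).congr fun a => by simp
  exact (key Finset.univ).congr fun a => by simp

theorem imp_const {p : Prop} {P : α → Prop} (hP : p → IsSemidecidable P) :
    IsSemidecidable fun a => p → P a := by
  by_cases hp : p
  · exact (hP hp).congr fun a => by simp [hp]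
  · exact (const True).congr fun a => by simp [hp]

/-- The search index codes a pair, a candidate `b` and a witness for `P (a, b)`, so one unbounded
search covers both existential quantifiers. -/
theorem exists_decode {P : α × β → Prop} (hP : IsSemidecidable P) :
    ∃ c : α → ℕ → Option β, Computable₂ c ∧ (∀ a m b, b ∈ c a m → P (a, b)) ∧
      ∀ a b, P (a, b) → ∃ m, b ∈ c a m := by
  obtain ⟨c, hc, h⟩ := hP
  refine ⟨fun a m => (Encodable.decode (α := β) m.unpair.1).bind fun b =>
    bif c (a, b) m.unpair.2 then some b else none, ?_, fun a m b hb => ?_, fun a b hb => ?_⟩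
  · have hu : Computable fun q : α × ℕ => q.2.unpair := Computable.unpair.comp Computable.snd
    have hg : Computable₂ fun (q : α × ℕ) (b : β) =>
        (bif c (q.1, b) q.2.unpair.2 then some b else none : Option β) :=
      (Computable.cond (hc.comp (Computable.pair (Computable.fst.comp Computable.fst)
        Computable.snd) (Computable.snd.comp (hu.comp Computable.fst)))
        (Computable.option_some.comp Computable.snd) (Computable.const none)).to₂
    exact (Computable.option_bind (Computable.decode.comp (Computable.fst.comp hu)) hg).to₂
  · obtain ⟨b', _, hb'⟩ := Option.mem_bind_iff.1 hb
    cases hcb : c (a, b') m.unpair.2 with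
    | false => simp [hcb] at hb'
    | true =>
      simp only [hcb, cond_true, Option.mem_def, Option.some.injEq] at hb'
      subst hb'
      exact (h _).2 ⟨_, hcb⟩
  · obtain ⟨m, hm⟩ := (h _).1 hb
    exact ⟨Nat.pair (Encodable.encode b) m, by simp [hm]⟩

theorem exists_of {P : α × β → Prop} (hP : IsSemidecidable P) :
    IsSemidecidable fun a => ∃ b, P (a, b) := by
  obtain ⟨c, hc, h1, h2⟩ := hP.exists_decode
  refine ⟨fun a m => (c a m).isSome, (Primrec.option_isSome.to_comp.comp hc).to₂, fun a => ?_⟩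
  constructor
  · rintro ⟨b, hb⟩
    obtain ⟨m, hm⟩ := h2 a b hb
    exact ⟨m, Option.isSome_iff_exists.2 ⟨b, hm⟩⟩
  · rintro ⟨m, hm⟩
    obtain ⟨b, hb⟩ := Option.isSome_iff_exists.1 hm
    exact ⟨b, h1 a m b hb⟩

/-- Unbounded search for a witness of a semidecidable predicate. -/
theorem exists_partrec {P : α × β → Prop} (hP : IsSemidecidable P) :
    ∃ G : α →. β, Partrec G ∧ ∀ a, (∃ b, P (a, b)) → ∃ b ∈ G a, P (a, b) := by
  obtain ⟨c, hc, h1, h2⟩ := hP.exists_decode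
  refine ⟨fun a => Nat.rfindOpt (c a), Partrec.rfindOpt hc, fun a ⟨b, hb⟩ => ?_⟩
  obtain ⟨m, hm⟩ := h2 a b hb
  have hd : (Nat.rfindOpt (c a)).Dom := Nat.rfindOpt_dom.2 ⟨m, b, hm⟩
  obtain ⟨m', hm'⟩ := Nat.rfindOpt_spec (Part.get_mem hd)
  exact ⟨_, Part.get_mem hd, h1 a m' _ hm'⟩

end IsSemidecidable

end

/-! ### Codes of operators and the word problem of the Weyl algebra -/

noncomputable section

namespace Weyl

variable {F : Type u} [Field F] {n : ℕ}

/-! ### Codes of operators -/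

/-- The value `∑ c w` of a code, for given values of the letters. -/
def codeEval {B : Type*} [Ring B] [Algebra F B] (g : Letter n → B)
    (c : List (F × List (Letter n))) : B :=
  (c.map fun q => q.1 • (q.2.map g).prod).sum

/-- A code for the product. -/
def codeMul (c d : List (F × List (Letter n))) : List (F × List (Letter n)) :=
  c.flatMap fun p => d.map fun q => (p.1 * q.1, p.2 ++ q.2)

/-- A code for the negative. -/
def codeNeg (c : List (F × List (Letter n))) : List (F × List (Letter n)) :=
  c.map fun q => (-q.1, q.2)

/-- The coefficient of a word in the free algebra. -/
def codeCoeff (c : List (F × List (Letter n))) (w : List (Letter n)) : F :=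
  c.foldr (fun q r => (bif decide (q.2 = w) then q.1 else 0) + r) 0

section Eval

variable {B : Type*} [Ring B] [Algebra F B] (g : Letter n → B)

@[simp] theorem codeEval_nil : codeEval (F := F) g [] = 0 := rfl

theorem codeEval_cons (q : F × List (Letter n)) (c : List (F × List (Letter n))) :
    codeEval g (q :: c) = q.1 • (q.2.map g).prod + codeEval g c := by
  simp [codeEval]

theorem codeEval_append (c d : List (F × List (Letter n))) :
    codeEval g (c ++ d) = codeEval g c + codeEval g d := by
  simp [codeEval]

theorem codeEval_flatMap {ι : Type*} (l : List ι) (c : ι → List (F × List (Letter n))) :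
    codeEval g (l.flatMap c) = (l.map fun i => codeEval g (c i)).sum := by
  induction l with
  | nil => rfl
  | cons i l ih => rw [List.flatMap_cons, codeEval_append, ih, List.map_cons, List.sum_cons]

theorem codeEval_neg (c : List (F × List (Letter n))) :
    codeEval g (codeNeg c) = -codeEval g c := by
  induction c with
  | nil => simp [codeNeg]
  | cons q c ih =>
    rw [codeNeg] at ih ⊢
    rw [List.map_cons, codeEval_cons, ih, codeEval_cons, neg_smul, neg_add]

theorem codeEval_mul (c d : List (F × List (Letter n))) :
    codeEval g (codeMul c d) = codeEval g c * codeEval g d := by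
  induction c with
  | nil => simp [codeMul]
  | cons p c ih =>
    rw [codeMul] at ih ⊢
    rw [List.flatMap_cons, codeEval_append, ih, codeEval_cons, add_mul]
    congr 1
    clear ih
    induction d with
    | nil => simp
    | cons q d ih =>
      rw [List.map_cons, codeEval_cons, ih, codeEval_cons, mul_add, List.map_append,
        List.prod_append, smul_mul_smul_comm]

theorem map_codeEval {B' : Type*} [Ring B'] [Algebra F B'] (f : B →ₐ[F] B')
    (c : List (F × List (Letter n))) : f (codeEval g c) = codeEval (fun l => f (g l)) c := by
  simp [codeEval, map_list_sum, List.map_map, Function.comp_def, map_list_prod]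

theorem codeEval_mem_adjoin {S : Set (Letter n)} {c : List (F × List (Letter n))}
    (hc : ∀ q ∈ c, ∀ l ∈ q.2, l ∈ S) : codeEval g c ∈ Algebra.adjoin F (g '' S) := by
  refine list_sum_mem fun x hx => ?_
  obtain ⟨q, hq, rfl⟩ := List.mem_map.1 hx
  refine Subalgebra.smul_mem _ (list_prod_mem fun y hy => ?_) _
  obtain ⟨l, hl, rfl⟩ := List.mem_map.1 hy
  exact Algebra.subset_adjoin ⟨l, hc q hq l hl, rfl⟩

theorem exists_codeEval_eq {S : Set (Letter n)} {A : B} (hA : A ∈ Algebra.adjoin F (g '' S)) :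
    ∃ c : List (F × List (Letter n)), (∀ q ∈ c, ∀ l ∈ q.2, l ∈ S) ∧ codeEval g c = A := by
  induction hA using Algebra.adjoin_induction with
  | mem x hx =>
    obtain ⟨l, hl, rfl⟩ := hx
    refine ⟨[(1, [l])], fun q hq l' hl' => ?_, by simp [codeEval]⟩
    obtain rfl := List.mem_singleton.1 hq
    obtain rfl := List.mem_singleton.1 hl'
    exact hl
  | algebraMap r => exact ⟨[(r, [])], by simp, by simp [codeEval, Algebra.smul_def]⟩
  | add x y _ _ hx hy =>
    obtain ⟨c, hc, rfl⟩ := hx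
    obtain ⟨d, hd, rfl⟩ := hy
    refine ⟨c ++ d, fun q hq => ?_, codeEval_append g c d⟩
    exact (List.mem_append.1 hq).elim (hc q) (hd q)
  | mul x y _ _ hx hy =>
    obtain ⟨c, hc, rfl⟩ := hx
    obtain ⟨d, hd, rfl⟩ := hy
    refine ⟨codeMul c d, fun q hq l hl => ?_, codeEval_mul g c d⟩
    simp only [codeMul, List.mem_flatMap, List.mem_map] at hq
    obtain ⟨a, ha, b, hb, rfl⟩ := hq
    exact (List.mem_append.1 hl).elim (hc a ha l) (hd b hb l)

end Eval

theorem exists_codeEval_gen_eq (A : Weyl F n) :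
    ∃ c : List (F × List (Letter n)), codeEval gen c = A := by
  obtain ⟨c, -, hc⟩ := exists_codeEval_eq (F := F) (gen (F := F) (n := n)) (S := Set.univ) (A := A)
    (by rw [Set.image_univ, adjoin_range_gen]; trivial)
  exact ⟨c, hc⟩

theorem exists_codeEval_ι_eq (A : FreeAlgebra F (Letter n)) :
    ∃ c : List (F × List (Letter n)), codeEval (FreeAlgebra.ι F) c = A := by
  obtain ⟨c, -, hc⟩ := exists_codeEval_eq (F := F) (FreeAlgebra.ι F (X := Letter n))
    (S := Set.univ) (A := A)
    (by rw [Set.image_univ, FreeAlgebra.adjoin_range_ι]; trivial)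
  exact ⟨c, hc⟩

theorem ofFree_codeEval (c : List (F × List (Letter n))) :
    ofFree (codeEval (FreeAlgebra.ι F) c) = codeEval gen c :=
  map_codeEval _ _ _

theorem coeff_codeEval (c : List (F × List (Letter n))) (w : List (Letter n)) :
    (FreeAlgebra.equivMonoidAlgebraFreeMonoid (codeEval (FreeAlgebra.ι F) c)).coeff
      (FreeMonoid.ofList w) = codeCoeff c w := by
  classical
  have hw : ∀ w : List (Letter n), FreeAlgebra.equivMonoidAlgebraFreeMonoid (R := F)
      ((w.map (FreeAlgebra.ι F)).prod) = MonoidAlgebra.single (FreeMonoid.ofList w) 1 := by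
    intro w
    induction w with
    | nil => simp [MonoidAlgebra.one_def]
    | cons l w ih =>
      rw [List.map_cons, List.prod_cons, map_mul, ih]
      simp [FreeAlgebra.equivMonoidAlgebraFreeMonoid, MonoidAlgebra.single_mul_single]
  induction c with
  | nil => simp [codeCoeff]
  | cons q c ih =>
    rw [codeEval_cons, map_add, map_smul, hw, MonoidAlgebra.coeff_add, Finsupp.add_apply, ih,
      codeCoeff, codeCoeff, List.foldr_cons]
    congr 1
    rw [MonoidAlgebra.smul_single, MonoidAlgebra.coeff_single, Finsupp.single_apply, Bool.cond_decide]
    simp only [smul_eq_mul, mul_one, EmbeddingLike.apply_eq_iff_eq]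

/-- Words form a basis of the free algebra, and words that do not occur in the code have coefficient
zero; vanishing is therefore a finite check. -/
theorem codeEval_ι_eq_zero_iff (c : List (F × List (Letter n))) :
    codeEval (FreeAlgebra.ι F) c = 0 ↔ ∀ q ∈ c, codeCoeff c q.2 = 0 := by
  constructor
  · intro h q _
    rw [← coeff_codeEval, h]
    simp
  · intro h
    refine (map_eq_zero_iff _ (FreeAlgebra.equivMonoidAlgebraFreeMonoid (R := F)).injective).1 ?_
    rw [← MonoidAlgebra.coeff_eq_zero]
    ext w
    obtain ⟨w, rfl⟩ := FreeMonoid.ofList.surjective w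
    rw [coeff_codeEval]
    by_cases hw : ∃ q ∈ c, q.2 = w
    · obtain ⟨q, hq, rfl⟩ := hw
      exact h q hq
    · push Not at hw
      clear h
      induction c with
      | nil => rfl
      | cons q c ih =>
        rw [codeCoeff, List.foldr_cons, ← codeCoeff, ih fun q hq => hw q (by simp [hq])]
        simp [hw q (by simp)]

/-- A code for a defining relation of the Weyl algebra. -/
def relCode (F : Type u) [Field F] {n : ℕ} (p : Letter n × Letter n) :
    List (F × List (Letter n)) :=
  [(1, [p.1, p.2]), (-1, [p.2, p.1]), (-((p.1.comm p.2 : ℤ) : F), [])]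

/-- An element vanishes in the Weyl algebra when it cancels against a sum of multiples of the
relations, and `d` lists these multiples. Vanishing becomes an existential statement over a finite
check in the free algebra. -/
theorem codeEval_gen_eq_zero_iff (c : List (F × List (Letter n))) :
    codeEval (gen (F := F)) c = 0 ↔ ∃ d : List (List (F × List (Letter n)) × (Letter n × Letter n) ×
      List (F × List (Letter n))), ∀ q ∈ c ++ d.flatMap fun e =>
        codeMul e.1 (codeMul (relCode F e.2.1) e.2.2), codeCoeff (c ++ d.flatMap fun e =>
          codeMul e.1 (codeMul (relCode F e.2.1) e.2.2)) q.2 = 0 := by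
  simp only [← codeEval_ι_eq_zero_iff, codeEval_append]
  have hrel : ∀ p : Letter n × Letter n,
      codeEval (FreeAlgebra.ι F) (relCode F p) = weylRel F p.1 p.2 := by
    intro p
    simp [relCode, codeEval, weylRel, Algebra.smul_def, sub_eq_add_neg, add_assoc]
  constructor
  · intro h
    rw [← ofFree_codeEval, ofFree_eq_zero_iff, ← neg_mem_iff] at h
    suffices H : ∀ x ∈ weylIdeal F n, ∃ d : List (List (F × List (Letter n)) ×
        (Letter n × Letter n) × List (F × List (Letter n))),
        codeEval (FreeAlgebra.ι F) (d.flatMap fun e =>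
          codeMul e.1 (codeMul (relCode F e.2.1) e.2.2)) = x by
      obtain ⟨d, hd⟩ := H _ h
      exact ⟨d, by rw [hd, add_neg_cancel]⟩
    intro x hx
    induction hx using Submodule.span_induction with
    | mem x hx =>
      obtain ⟨l, l', v, rfl⟩ := hx
      obtain ⟨v, rfl⟩ := exists_codeEval_ι_eq v
      refine ⟨[([(1, [])], (l, l'), v)], ?_⟩
      rw [codeEval_flatMap]
      simp [codeEval_mul, hrel, codeEval_cons]
    | zero => exact ⟨[], rfl⟩
    | add x y _ _ hx hy =>
      obtain ⟨c, rfl⟩ := hx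
      obtain ⟨d, rfl⟩ := hy
      exact ⟨c ++ d, by rw [List.flatMap_append, codeEval_append]⟩
    | smul a x _ hx =>
      obtain ⟨d, rfl⟩ := hx
      obtain ⟨a, rfl⟩ := exists_codeEval_ι_eq a
      refine ⟨d.map fun e => (codeMul a e.1, e.2), ?_⟩
      rw [smul_eq_mul, codeEval_flatMap, codeEval_flatMap, ← List.sum_map_mul_left, List.map_map]
      congr 1
      refine List.map_congr_left fun e _ => ?_
      simp [codeEval_mul, mul_assoc]
  · rintro ⟨d, hd⟩
    have h := congrArg ofFree hd
    rw [map_add, ofFree_codeEval, ofFree_codeEval, map_zero, codeEval_flatMap] at h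
    have h0 : (d.map fun e => codeEval (gen (F := F))
        (codeMul e.1 (codeMul (relCode F e.2.1) e.2.2))).sum = 0 := by
      refine List.sum_eq_zero fun x hx => ?_
      obtain ⟨e, -, rfl⟩ := List.mem_map.1 hx
      have : codeEval (gen (F := F)) (relCode F e.2.1) = 0 := by
        rw [← ofFree_codeEval, hrel, ofFree_eq_zero_iff]
        exact Submodule.subset_span ⟨_, _, 1, (mul_one _).symm⟩
      rw [codeEval_mul, codeEval_mul, this, zero_mul, mul_zero]
    rwa [h0, add_zero] at h

/-- Simplicity makes nonvanishing existential as well: the witness `d` expresses `1` as a sum of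
products `u c v`. -/
theorem codeEval_gen_ne_zero_iff [CharZero F] (c : List (F × List (Letter n))) :
    codeEval (gen (F := F)) c ≠ 0 ↔ ∃ d : List (List (F × List (Letter n)) × List (F × List (Letter n))),
      codeEval (gen (F := F)) ((d.flatMap fun e => codeMul e.1 (codeMul c e.2)) ++ [(-1, [])])
        = 0 := by
  have hone : codeEval (gen (F := F) (n := n)) [((-1 : F), [])] = -1 := by simp [codeEval]
  simp only [codeEval_append, hone, add_neg_eq_zero]
  constructor
  · intro h
    have H : ∀ x ∈ Submodule.span F {B | ∃ u v, B = u * codeEval (gen (F := F)) c * v},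
        ∃ d : List (List (F × List (Letter n)) × List (F × List (Letter n))),
          codeEval (gen (F := F)) (d.flatMap fun e => codeMul e.1 (codeMul c e.2)) = x := by
      intro x hx
      induction hx using Submodule.span_induction with
      | mem x hx =>
        obtain ⟨u, v, rfl⟩ := hx
        obtain ⟨u, rfl⟩ := exists_codeEval_gen_eq u
        obtain ⟨v, rfl⟩ := exists_codeEval_gen_eq v
        exact ⟨[(u, v)], by simp [codeEval_mul, mul_assoc]⟩
      | zero => exact ⟨[], rfl⟩
      | add x y _ _ hx hy =>
        obtain ⟨c, rfl⟩ := hx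
        obtain ⟨d, rfl⟩ := hy
        exact ⟨c ++ d, by rw [List.flatMap_append, codeEval_append]⟩
      | smul r x _ hx =>
        obtain ⟨d, rfl⟩ := hx
        refine ⟨d.map fun e => (codeMul [(r, [])] e.1, e.2), ?_⟩
        rw [Algebra.smul_def, codeEval_flatMap, codeEval_flatMap, ← List.sum_map_mul_left,
          List.map_map]
        congr 1
        refine List.map_congr_left fun e _ => ?_
        simp [codeEval_mul, codeEval_cons, Algebra.smul_def, mul_assoc]
    exact H _ (one_mem_span_mul_mul h)
  · rintro ⟨d, hd⟩ h
    rw [codeEval_flatMap] at hd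
    refine one_ne_zero (hd.symm.trans (List.sum_eq_zero fun x hx => ?_))
    obtain ⟨e, -, rfl⟩ := List.mem_map.1 hx
    rw [codeEval_mul, codeEval_mul, h, zero_mul, mul_zero]

end Weyl
end

/-! ### The search for a certificate -/

noncomputable section

namespace Weyl

variable {F : Type u} [Field F] {n : ℕ}

/-! ### Computability of the operations on codes -/

/-- A code for a finite sum. -/
def codeSum {ι : Type*} [Fintype ι] (c : ι → List (F × List (Letter n))) :
    List (F × List (Letter n)) :=
  (Finset.univ : Finset ι).toList.flatMap c

theorem codeEval_sum {B : Type*} [Ring B] [Algebra F B] (g : Letter n → B) {ι : Type*}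
    [Fintype ι] (c : ι → List (F × List (Letter n))) :
    codeEval g (codeSum c) = ∑ i, codeEval g (c i) := by
  rw [codeSum, codeEval_flatMap, Finset.sum_map_toList]

theorem exists_ofX_of_mem_adjoin {A : Weyl F n}
    (hA : A ∈ Algebra.adjoin F (gen (F := F) '' Set.range Sum.inl)) :
    ∃ q : MvPolynomial (Fin (n + 1)) F, ofX q = A := by
  have h : Algebra.adjoin F (gen (F := F) (n := n) '' Set.range Sum.inl) ≤
      (ofX (F := F) (n := n)).range := by
    refine Algebra.adjoin_le ?_
    rintro _ ⟨_, ⟨a, rfl⟩, rfl⟩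
    exact ⟨MvPolynomial.X a, ofX_X a⟩
  exact h hA

theorem ofX_mem_adjoin_range (q : MvPolynomial (Fin (n + 1)) F) :
    ofX q ∈ Algebra.adjoin F (gen (F := F) '' Set.range Sum.inl) :=
  ofX_mem_adjoin (by simp [MvPolynomial.supported_univ])

/-- A code for the difference of the two sides of the identity in `exists_certificate`. -/
def certificateCode (D : Finset (Fin n) → Finset (Fin n) → List (F × List (Letter n)))
    (A : Fin (n + 1) → Finset (Fin n) → List (F × List (Letter n)))
    (L : List (F × List (Letter n)))
    (M : Finset (Fin n) → Finset (Fin n) → List (F × List (Letter n)))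
    (q : List (F × List (Letter n)))
    (B : Fin (n + 1) → Finset (Fin n) → List (F × List (Letter n)))
    (R : Finset (Fin n) → List (F × List (Letter n))) (J I : Finset (Fin n)) :
    List (F × List (Letter n)) :=
  codeMul q ((if J = I then L else []) ++ codeNeg (codeSum fun J' => codeMul (D J J') (M J' I))) ++
    codeNeg (codeSum (fun a => codeMul (B a I) (A a I)) ++
      codeSum fun J' => codeMul (R J') (D J' I))

theorem codeEval_certificateCode_eq_zero_iff
    (D : Finset (Fin n) → Finset (Fin n) → List (F × List (Letter n)))
    (A : Fin (n + 1) → Finset (Fin n) → List (F × List (Letter n)))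
    (L : List (F × List (Letter n)))
    (M : Finset (Fin n) → Finset (Fin n) → List (F × List (Letter n)))
    (q : List (F × List (Letter n)))
    (B : Fin (n + 1) → Finset (Fin n) → List (F × List (Letter n)))
    (R : Finset (Fin n) → List (F × List (Letter n))) (J I : Finset (Fin n)) :
    codeEval (gen (F := F)) (certificateCode D A L M q B R J I) = 0 ↔
      codeEval (gen (F := F)) q * ((if J = I then codeEval gen L else 0) -
        ∑ J', codeEval (gen (F := F)) (D J J') * codeEval gen (M J' I)) =
      ∑ a, codeEval (gen (F := F)) (B a I) * codeEval gen (A a I) +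
        ∑ J', codeEval (gen (F := F)) (R J') * codeEval gen (D J' I) := by
  have hite : codeEval (gen (F := F)) (if J = I then L else []) =
      if J = I then codeEval gen L else 0 := by
    split_ifs <;> rfl
  simp only [certificateCode, codeEval_append, codeEval_neg, codeEval_mul, codeEval_sum, hite,
    ← sub_eq_add_neg, sub_eq_zero]

variable [Primcodable F]

theorem computable_codeMul (hF : IsComputableField F) {α : Type*} [Primcodable α]
    {f g : α → List (F × List (Letter n))} (hf : Computable f) (hg : Computable g) :
    Computable fun a => codeMul (f a) (g a) := by
  have hpair : Computable₂ fun (x : α × (F × List (Letter n))) (q : F × List (Letter n)) =>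
      (x.2.1 * q.1, x.2.2 ++ q.2) := by
    have h1 : Computable fun x : (α × (F × List (Letter n))) × (F × List (Letter n)) =>
        x.1.2 := Computable.snd.comp Computable.fst
    have h2 : Computable fun x : (α × (F × List (Letter n))) × (F × List (Letter n)) =>
        x.1.2.1 * x.2.1 :=
      hF.mul.comp (Computable.fst.comp h1) (Computable.fst.comp Computable.snd)
    have h3 : Computable fun x : (α × (F × List (Letter n))) × (F × List (Letter n)) =>
        x.1.2.2 ++ x.2.2 :=
      Computable.list_append.comp (Computable.snd.comp h1) (Computable.snd.comp Computable.snd)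
    exact (Computable.pair h2 h3).to₂
  exact Computable.list_flatMap hf (Computable.list_map (hg.comp Computable.fst) hpair).to₂

theorem computable_codeNeg (hF : IsComputableField F) {α : Type*} [Primcodable α]
    {f : α → List (F × List (Letter n))} (hf : Computable f) :
    Computable fun a => codeNeg (f a) :=
  Computable.list_map hf (Computable.pair (hF.neg.comp (Computable.fst.comp Computable.snd))
    (Computable.snd.comp Computable.snd)).to₂

theorem computable_codeCoeff (hF : IsComputableField F) {α : Type*} [Primcodable α]
    {f : α → List (F × List (Letter n))} {g : α → List (Letter n)} (hf : Computable f)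
    (hg : Computable g) : Computable fun a => codeCoeff (f a) (g a) := by
  have hdec : Computable fun x : α × ((F × List (Letter n)) × F) =>
      decide (x.2.1.2 = g x.1) :=
    Computable.decide_eq (Computable.snd.comp (Computable.fst.comp Computable.snd))
      (hg.comp Computable.fst)
  have hcond : Computable fun x : α × ((F × List (Letter n)) × F) =>
      bif decide (x.2.1.2 = g x.1) then x.2.1.1 else 0 :=
    Computable.cond hdec (Computable.fst.comp (Computable.fst.comp Computable.snd))
      (Computable.const 0)
  have hstep : Computable fun x : α × ((F × List (Letter n)) × F) =>
      (bif decide (x.2.1.2 = g x.1) then x.2.1.1 else 0) + x.2.2 :=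
    hF.add.comp hcond (Computable.snd.comp Computable.snd)
  exact Computable.list_foldr hf (Computable.const 0) hstep.to₂

theorem isSemidecidable_forall_codeCoeff_eq_zero (hF : IsComputableField F) :
    IsSemidecidable fun c : List (F × List (Letter n)) => ∀ q ∈ c, codeCoeff c q.2 = 0 := by
  classical
  have hc : Computable fun x : List (F × List (Letter n)) × (F × List (Letter n)) =>
      codeCoeff x.1 x.2.2 :=
    computable_codeCoeff hF Computable.fst (Computable.snd.comp Computable.snd)
  have hd : Computable fun x : List (F × List (Letter n)) × (F × List (Letter n)) =>
      decide (codeCoeff x.1 x.2.2 = 0) := Computable.decide_eq hc (Computable.const 0)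
  have hall : Computable fun c : List (F × List (Letter n)) =>
      c.all fun q => decide (codeCoeff c q.2 = 0) := Computable.list_all Computable.id hd.to₂
  exact IsSemidecidable.of_computable hall fun c => by simp [List.all_eq_true]

theorem isSemidecidable_codeEval_eq_zero (hF : IsComputableField F) :
    IsSemidecidable fun c : List (F × List (Letter n)) => codeEval (gen (F := F)) c = 0 := by
  -- A function on the finite set of pairs of letters is computable as a table.
  have hrel : Computable (relCode F (n := n)) := (Primrec.dom_finite _).to_comp
  have hterm : Computable fun e : List (F × List (Letter n)) × (Letter n × Letter n) ×
      List (F × List (Letter n)) => codeMul e.1 (codeMul (relCode F e.2.1) e.2.2) :=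
    computable_codeMul hF Computable.fst (computable_codeMul hF
      (hrel.comp (Computable.fst.comp Computable.snd)) (Computable.snd.comp Computable.snd))
  have hsum : Computable fun x : List (F × List (Letter n)) ×
      List (List (F × List (Letter n)) × (Letter n × Letter n) × List (F × List (Letter n))) =>
      x.1 ++ x.2.flatMap fun e => codeMul e.1 (codeMul (relCode F e.2.1) e.2.2) :=
    Computable.list_append.comp Computable.fst
      (Computable.list_flatMap Computable.snd (hterm.comp Computable.snd).to₂)
  exact ((isSemidecidable_forall_codeCoeff_eq_zero hF).comp hsum).exists_of.congr
    codeEval_gen_eq_zero_iff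

theorem isSemidecidable_codeEval_ne_zero [CharZero F] (hF : IsComputableField F) :
    IsSemidecidable fun c : List (F × List (Letter n)) => codeEval (gen (F := F)) c ≠ 0 := by
  have hsum : Computable fun x : List (F × List (Letter n)) ×
      List (List (F × List (Letter n)) × List (F × List (Letter n))) =>
        (x.2.flatMap fun e => codeMul e.1 (codeMul x.1 e.2)) ++ [((-1 : F), [])] :=
    Computable.list_append.comp (Computable.list_flatMap Computable.snd
      (computable_codeMul hF (Computable.fst.comp Computable.snd) (computable_codeMul hF
        (Computable.fst.comp Computable.fst) (Computable.snd.comp Computable.snd))).to₂)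
      (Computable.const _)
  exact ((isSemidecidable_codeEval_eq_zero hF).comp hsum).exists_of.congr
    codeEval_gen_ne_zero_iff

theorem isSemidecidable_forall_mem {F : Type u} [Primcodable F] {n : ℕ} (S : Set (Letter n)) :
    IsSemidecidable fun c : List (F × List (Letter n)) => ∀ q ∈ c, ∀ l ∈ q.2, l ∈ S := by
  classical
  refine IsSemidecidable.of_computable (c := fun c : List (F × List (Letter n)) =>
    c.all fun q => q.2.all fun l => decide (l ∈ S)) ?_ fun c => by simp [List.all_eq_true]
  have hS : Computable fun l : Letter n => decide (l ∈ S) := (Primrec.dom_finite _).to_comp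
  exact Computable.list_all Computable.id (Computable.list_all
    (Computable.snd.comp Computable.snd) (hS.comp Computable.snd).to₂).to₂

/-! ### The search for a certificate -/

theorem computable_codeSum {F : Type u} [Primcodable F] {n : ℕ} {α ι : Type*} [Primcodable α] [Fintype ι]
    {c : α → ι → List (F × List (Letter n))} (hc : ∀ i, Computable fun a => c a i) :
    Computable fun a => codeSum (c a) :=
  Computable.flatMap_list _ hc

theorem computable_certificateCode (hF : IsComputableField F)
    (D : Finset (Fin n) → Finset (Fin n) → List (F × List (Letter n))) {α : Type*} [Primcodable α]
    {A : α → Fin (n + 1) → Finset (Fin n) → List (F × List (Letter n))}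
    {L : α → List (F × List (Letter n))}
    {M : α → Finset (Fin n) → Finset (Fin n) → List (F × List (Letter n))}
    {q : α → List (F × List (Letter n))}
    {B : α → Fin (n + 1) → Finset (Fin n) → List (F × List (Letter n))}
    {R : α → Finset (Fin n) → List (F × List (Letter n))}
    (hA : Computable A) (hL : Computable L) (hM : Computable M) (hq : Computable q)
    (hB : Computable B) (hR : Computable R) (J I : Finset (Fin n)) :
    Computable fun a => certificateCode D (A a) (L a) (M a) (q a) (B a) (R a) J I := by
  have hite : Computable fun a => if J = I then L a else [] := by
    split_ifs
    · exact hL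
    · exact Computable.const _
  refine Computable.list_append.comp (computable_codeMul hF hq (Computable.list_append.comp hite
    (computable_codeNeg hF (computable_codeSum fun J' => computable_codeMul hF
      (Computable.const _) ((hM.apply_table J').apply_table I)))))
    (computable_codeNeg hF (Computable.list_append.comp
      (computable_codeSum fun a => computable_codeMul hF ((hB.apply_fin a).apply_table I)
        ((hA.apply_fin a).apply_table I))
      (computable_codeSum fun J' => computable_codeMul hF (hR.apply_table J')
        (Computable.const _))))

/-- A partial recursive function that finds the operators of `exists_certificate`, in degree `p`. -/
theorem exists_partrec_certificate [CharZero F] (hF : IsComputableField F) (s p : ℕ) (hs : s ≤ n)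
    (V : Finset (Letter n)) (hV : ∀ l ∈ V, s < l.index) (hcard : n - s ≤ V.card) :
    ∃ G : (Fin (n + 1) → Finset (Fin n) → List (F × List (Letter n))) →.
        List (F × List (Letter n)) ×
          (Finset (Fin n) → Finset (Fin n) → List (F × List (Letter n))),
      Partrec G ∧ ∀ A : Fin (n + 1) → Finset (Fin n) → List (F × List (Letter n)),
        (∀ a I, (∀ q ∈ A a I, ∀ l ∈ q.2, l ∈ (insert (Sum.inr a) (Set.range Sum.inl) :
          Set (Letter n))) ∧ codeEval (gen (F := F)) (A a I) ≠ 0) →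
        ∃ out ∈ G A,
          (∀ q ∈ out.1, ∀ l ∈ q.2, l ∈ Letter.tPart n ∪ (V : Set (Letter n))) ∧
          codeEval (gen (F := F)) out.1 ≠ 0 ∧
          (∀ J I : Finset (Fin n), J.card + 1 ≠ p → out.2 J I = []) ∧
          ∀ J : Finset (Fin n), J.card = p → ∃ q : MvPolynomial (Fin (n + 1)) F, q ≠ 0 ∧
            ∃ (B : Fin (n + 1) → Finset (Fin n) → Weyl F n) (R : Finset (Fin n) → Weyl F n),
              ∀ I, ofX q * ((if J = I then codeEval gen out.1 else 0) -
                ∑ J', formDCoeff F s J J' * codeEval gen (out.2 J' I)) =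
                ∑ a, B a I * codeEval gen (A a I) + ∑ J', R J' * formDCoeff F s J' I := by
  classical
  -- A fixed finite table, which the algorithm contains as a constant; its choice need not be
  -- effective.
  choose D hD using fun J I : Finset (Fin n) => exists_codeEval_gen_eq (formDCoeff F s J I)
  -- Every clause can be verified by search. Empty entries outside `J.card + 1 = p` force the degree
  -- of `μ`, also for `p = 0`, where the whole table is empty; accordingly the identity is demanded
  -- only for `J.card = p`.
  let P : (Fin (n + 1) → Finset (Fin n) → List (F × List (Letter n))) ×
      (List (F × List (Letter n)) ×
        (Finset (Fin n) → Finset (Fin n) → List (F × List (Letter n)))) → Prop := fun x =>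
    (∀ q ∈ x.2.1, ∀ l ∈ q.2, l ∈ Letter.tPart n ∪ (V : Set (Letter n))) ∧
    codeEval (gen (F := F)) x.2.1 ≠ 0 ∧
    (∀ J I : Finset (Fin n), J.card + 1 ≠ p → x.2.2 J I = []) ∧
    ∀ J : Finset (Fin n), J.card = p → ∃ y : List (F × List (Letter n)) ×
      (Fin (n + 1) → Finset (Fin n) → List (F × List (Letter n))) ×
      (Finset (Fin n) → List (F × List (Letter n))),
      (∀ q ∈ y.1, ∀ l ∈ q.2, l ∈ (Set.range Sum.inl : Set (Letter n))) ∧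
      codeEval (gen (F := F)) y.1 ≠ 0 ∧
      ∀ I, codeEval (gen (F := F)) (certificateCode D x.1 x.2.1 x.2.2 y.1 y.2.1 y.2.2 J I) = 0
  have hP : IsSemidecidable P := by
    have hL := Computable.fst.comp (Computable.snd (α := Fin (n + 1) → Finset (Fin n) →
      List (F × List (Letter n))) (β := List (F × List (Letter n)) ×
        (Finset (Fin n) → Finset (Fin n) → List (F × List (Letter n)))))
    have hM := Computable.snd.comp (Computable.snd (α := Fin (n + 1) → Finset (Fin n) →
      List (F × List (Letter n))) (β := List (F × List (Letter n)) ×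
        (Finset (Fin n) → Finset (Fin n) → List (F × List (Letter n)))))
    refine ((isSemidecidable_forall_mem _).comp hL).and
      (((isSemidecidable_codeEval_ne_zero hF).comp hL).and
        ((IsSemidecidable.forall_fintype fun J => IsSemidecidable.forall_fintype fun I =>
          IsSemidecidable.imp_const fun _ => ?_).and
          (IsSemidecidable.forall_fintype fun J => IsSemidecidable.imp_const fun _ => ?_)))
    · exact IsSemidecidable.of_computable (Computable.decide_eq
        ((hM.apply_table J).apply_table I) (Computable.const [])) fun x => by simp
    · refine IsSemidecidable.exists_of (P := fun z : ((Fin (n + 1) → Finset (Fin n) → List (F × List (Letter n))) ×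
        (List (F × List (Letter n)) ×
          (Finset (Fin n) → Finset (Fin n) → List (F × List (Letter n))))) ×
        (List (F × List (Letter n)) ×
          (Fin (n + 1) → Finset (Fin n) → List (F × List (Letter n))) ×
          (Finset (Fin n) → List (F × List (Letter n)))) => (∀ q ∈ z.2.1, ∀ l ∈ q.2,
        l ∈ (Set.range Sum.inl : Set (Letter n))) ∧ codeEval (gen (F := F)) z.2.1 ≠ 0 ∧
        ∀ I, codeEval (gen (F := F)) (certificateCode D z.1.1 z.1.2.1 z.1.2.2 z.2.1 z.2.2.1
          z.2.2.2 J I) = 0) ?_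
      refine ((isSemidecidable_forall_mem _).comp (Computable.fst.comp Computable.snd)).and
        (((isSemidecidable_codeEval_ne_zero hF).comp (Computable.fst.comp Computable.snd)).and
          (IsSemidecidable.forall_fintype fun I =>
            (isSemidecidable_codeEval_eq_zero hF).comp ?_))
      exact computable_certificateCode hF D (Computable.fst.comp Computable.fst)
        (hL.comp Computable.fst) (hM.comp Computable.fst) (Computable.fst.comp Computable.snd)
        (Computable.fst.comp (Computable.snd.comp Computable.snd))
        (Computable.snd.comp (Computable.snd.comp Computable.snd)) J I
  obtain ⟨G, hG, hGP⟩ := hP.exists_partrec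
  refine ⟨G, hG, fun A hA => ?_⟩
  have hex : ∃ out, P (A, out) := by
    obtain ⟨L, hL, hL0, M, hM⟩ := exists_certificate (fun a I => codeEval gen (A a I))
      (fun a I => codeEval_mem_adjoin gen (hA a I).1) (fun a I => (hA a I).2) s hs V hV hcard
    obtain ⟨cL, hcL, rfl⟩ := exists_codeEval_eq gen hL
    choose cM hcM using fun J I => exists_codeEval_gen_eq (M J I)
    refine ⟨(cL, fun J I => if J.card + 1 = p then cM J I else []), hcL, hL0,
      fun J I hJ => if_neg hJ, fun J hJ => ?_⟩
    obtain ⟨q, hq, B, R, h⟩ := hM J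
    obtain ⟨cq, hcq, hcq'⟩ := exists_codeEval_eq gen (ofX_mem_adjoin_range q)
    choose cB hcB using fun a I => exists_codeEval_gen_eq (B a I)
    choose cR hcR using fun J => exists_codeEval_gen_eq (R J)
    refine ⟨(cq, cB, cR), hcq, ?_, fun I => ?_⟩
    · change codeEval gen cq ≠ 0
      rw [hcq']
      exact (map_ne_zero_iff _ ofX_injective).2 hq
    · rw [codeEval_certificateCode_eq_zero_iff]
      simp only [hcq', hcB, hcR, hD]
      rw [← h I]
      congr 2
      refine Finset.sum_congr rfl fun J' _ => ?_
      split_ifs with hJ'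
      · rw [hcM]
      -- An entry lost in the truncation is multiplied by zero: `d_s` reaches `J` only from subsets
      -- with one element less.
      · have : formDCoeff F s J J' = 0 := by
          refine Finset.sum_eq_zero fun j hj => if_neg ?_
          rintro rfl
          refine hJ' ?_
          rw [Finset.card_erase_add_one (Finset.mem_filter.1 hj).1, hJ]
        rw [this, zero_mul, zero_mul]
  obtain ⟨out, hout, h1, h2, h3, h4⟩ := hGP A hex
  refine ⟨out, hout, h1, h2, h3, fun J hJ => ?_⟩
  obtain ⟨⟨cq, cB, cR⟩, hcq, hcq0, h⟩ := h4 J hJ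
  obtain ⟨q, hq⟩ := exists_ofX_of_mem_adjoin (codeEval_mem_adjoin gen hcq)
  refine ⟨q, ?_, fun a I => codeEval gen (cB a I), fun J => codeEval gen (cR J), fun I => ?_⟩
  · rintro rfl
    exact hcq0 (by rw [← hq, map_zero])
  · have := (codeEval_certificateCode_eq_zero_iff _ _ _ _ _ _ _ _ _).1 (h I)
    simpa only [hD, hq] using this

end Weyl
end

/-! ### The action on `U`, denominators and D-finite elements -/

noncomputable section

namespace DiffExt

open Weyl

variable {k : Type u} [Field k] {n : ℕ} {U : Type v} [Field U] [Algebra k U]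
  [Algebra (RatFun k n) U] (E : DiffExt k n U)

/-! ### The action of the Weyl algebra on a differential field -/

theorem letterOp_comm (l l' : Letter n) :
    E.letterOp l * E.letterOp l' - E.letterOp l' * E.letterOp l =
      ((l.comm l' : ℤ) : Module.End k U) := by
  ext f
  rcases l with a | a <;> rcases l' with b | b
  · simp [letterOp, mulOp, Letter.comm, mul_left_comm]
  · by_cases h : a = b
    · subst h
      simp [letterOp, mulOp, Letter.comm, E.der_var, mul_comm]
    · simp [letterOp, mulOp, Letter.comm, E.der_var, h, Ne.symm h, mul_comm]
  · by_cases h : a = b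
    · subst h
      simp [letterOp, mulOp, Letter.comm, E.der_var, mul_comm]
    · simp [letterOp, mulOp, Letter.comm, E.der_var, h, mul_comm]
  · simp [letterOp, Letter.comm, E.der_comm a b]

section Rep

variable (F : Type u) [Field F] [Algebra F (Module.End k U)]

/-- The action of the Weyl algebra on `U`. -/
def rep : Weyl F n →ₐ[F] Module.End k U :=
  lift E.letterOp E.letterOp_comm

@[simp] theorem rep_gen (l : Letter n) : E.rep F (gen l) = E.letterOp l :=
  lift_gen _ _ _

theorem rep_codeEval (c : List (F × List (Letter n))) :
    E.rep F (codeEval gen c) = codeEval E.letterOp c := by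
  rw [map_codeEval]
  simp only [rep_gen]

/-- `U` as a module over the Weyl algebra. -/
@[reducible] def weylModule : Module (Weyl F n) U :=
  Module.compHom U (E.rep F).toRingHom

theorem rep_injective [CharZero F] : Function.Injective (E.rep F) :=
  algHom_injective _

/-- The variables act by multiplication. A scalar of `F` is known only as a central operator, but it
commutes with multiplication by `f`, which settles the constants. -/
theorem rep_ofX_apply (q : MvPolynomial (Fin (n + 1)) F) (f : U) :
    E.rep F (ofX q) f = E.rep F (ofX q) 1 * f := by
  induction q using MvPolynomial.induction_on generalizing f with
  | C c =>
    rw [← MvPolynomial.algebraMap_eq, AlgHom.commutes, AlgHom.commutes]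
    have h := LinearMap.congr_fun (Algebra.commutes c (LinearMap.mulRight k f)) 1
    simpa using h
  | add p q hp hq => rw [map_add, map_add, LinearMap.add_apply, LinearMap.add_apply, hp, hq, add_mul]
  | mul_X p a hp =>
    rw [map_mul, map_mul, Module.End.mul_apply, Module.End.mul_apply, hp, hp (E.rep F _ 1), ofX_X,
      rep_gen]
    simp [letterOp, mulOp, mul_assoc]

theorem rep_ofX_apply_eq_zero [CharZero F] {q : MvPolynomial (Fin (n + 1)) F} (hq : q ≠ 0) {f : U}
    (hf : E.rep F (ofX q) f = 0) : f = 0 := by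
  rw [rep_ofX_apply, mul_eq_zero] at hf
  refine hf.resolve_left fun h => hq ?_
  have h0 : E.rep F (ofX q) = 0 := by
    ext g
    rw [rep_ofX_apply, h, zero_mul, LinearMap.zero_apply]
  exact ofX_injective (E.rep_injective F (by rw [h0, map_zero, map_zero]))

theorem d_eq_formD (s : ℕ) (ω : Form n U) :
    E.d s ω = (letI := E.weylModule F; formD F s ω) := by
  let := E.weylModule F
  ext J
  rw [formD_apply]
  refine Finset.sum_congr rfl fun j _ => ?_
  have h : gen (F := F) (Sum.inr j.succ) • ω (J.erase j) = E.der j.succ (ω (J.erase j)) := by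
    change E.rep F (gen _) (ω (J.erase j)) = _
    rw [rep_gen]
    rfl
  rw [h, formSign, zsmul_eq_mul]
  push_cast
  rfl

end Rep

theorem opAlg_eq_map (S : Set (Letter n)) :
    E.opAlg S = (Algebra.adjoin k (gen (F := k) '' S)).map (E.rep k) := by
  rw [AlgHom.map_adjoin, ← Set.image_comp]
  simp only [Function.comp_def, rep_gen]
  rfl

theorem rep_mem_opAlg {S : Set (Letter n)} {A : Weyl k n}
    (hA : A ∈ Algebra.adjoin k (gen (F := k) '' S)) : E.rep k A ∈ E.opAlg S := by
  rw [opAlg_eq_map]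
  exact ⟨A, hA, rfl⟩

theorem d_rep_act (s : ℕ) {T : Set (Letter n)} (hT : ∀ l ∈ T, l.index = 0 ∨ s < l.index)
    {A : Weyl k n} (hA : A ∈ Algebra.adjoin k (gen (F := k) '' T)) (ω : Form n U) :
    E.d s (E.act (E.rep k A) ω) = E.act (E.rep k A) (E.d s ω) := by
  let := E.weylModule k
  rw [E.d_eq_formD k, E.d_eq_formD k]
  exact formD_smul hT hA ω

theorem d_d (s : ℕ) (hs : s ≤ n) (ω : Form n U) : E.d s (E.d s ω) = 0 := by
  let := E.weylModule k
  rw [E.d_eq_formD k, E.d_eq_formD k]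
  exact formD_formD s hs ω

/-! ### Clearing denominators -/

section Denominators

/-- An intermediate field whose elements are fractions of polynomials in the variables from `B`. -/
def IsFractionsOf (K : IntermediateField k (RatFun k n)) (B : Set (Fin (n + 1))) : Prop :=
  ∀ c, c ∈ K ↔ ∃ r ∈ MvPolynomial.supported k B, ∃ s ∈ MvPolynomial.supported k B, s ≠ 0 ∧
    algebraMap _ (RatFun k n) s * c = algebraMap _ (RatFun k n) r

theorem isFractionsOf_top : IsFractionsOf (⊤ : IntermediateField k (RatFun k n)) Set.univ := by
  intro c
  simp only [IntermediateField.mem_top, true_iff, MvPolynomial.supported_univ]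
  obtain ⟨r, s, hs, rfl⟩ := IsFractionRing.div_surjective (MvPolynomial (Fin (n + 1)) k) c
  refine ⟨r, trivial, s, trivial, nonZeroDivisors.ne_zero hs, ?_⟩
  rw [mul_div_cancel₀]
  exact (map_ne_zero_iff _ (IsFractionRing.injective _ _)).2 (nonZeroDivisors.ne_zero hs)

theorem isFractionsOf_fieldT : IsFractionsOf (RatFun.fieldT k n) {0} := by
  have hX : ∀ p : Polynomial k, Polynomial.aeval (RatFun.var k n 0) p =
      algebraMap _ (RatFun k n) (Polynomial.aeval (MvPolynomial.X (R := k) (0 : Fin (n + 1))) p) :=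
    fun p => (Polynomial.aeval_algebraMap_apply _ _ _)
  have hsupp : ∀ p : Polynomial k, Polynomial.aeval (MvPolynomial.X (R := k) (0 : Fin (n + 1))) p ∈
      MvPolynomial.supported k ({0} : Set (Fin (n + 1))) := by
    intro p
    have h : (MvPolynomial.X (R := k) (0 : Fin (n + 1))) ∈
        MvPolynomial.supported k ({0} : Set (Fin (n + 1))) :=
      Algebra.subset_adjoin ⟨0, rfl, rfl⟩
    exact Polynomial.aeval_mem_adjoin_singleton k _ |> fun h' =>
      (Algebra.adjoin_le (Set.singleton_subset_iff.2 h)) h'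
  intro c
  constructor
  · intro hc
    obtain ⟨r, s, rfl⟩ := (IntermediateField.mem_adjoin_simple_iff k c).1 hc
    by_cases hs : Polynomial.aeval (RatFun.var k n 0) s = 0
    · exact ⟨0, zero_mem _, 1, one_mem _, one_ne_zero, by simp [hs]⟩
    · refine ⟨_, hsupp r, _, hsupp s, ?_, ?_⟩
      · intro h
        rw [hX, h, map_zero] at hs
        exact hs rfl
      · rw [← hX, ← hX, mul_div_cancel₀ _ hs]
  · rintro ⟨r, hr, s, hs, hs0, h⟩
    have hmem : ∀ q ∈ MvPolynomial.supported k ({0} : Set (Fin (n + 1))),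
        algebraMap _ (RatFun k n) q ∈ RatFun.fieldT k n := by
      intro q hq
      induction hq using Algebra.adjoin_induction with
      | mem x hx =>
        obtain ⟨_, rfl, rfl⟩ := hx
        exact IntermediateField.mem_adjoin_simple_self k _
      | algebraMap r =>
        rw [← IsScalarTower.algebraMap_apply]
        exact (RatFun.fieldT k n).algebraMap_mem r
      | add x y _ _ hx hy => rw [map_add]; exact add_mem hx hy
      | mul x y _ _ hx hy => rw [map_mul]; exact mul_mem hx hy
    have hs1 : algebraMap _ (RatFun k n) s ≠ 0 :=
      (map_ne_zero_iff _ (IsFractionRing.injective _ _)).2 hs0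
    rw [eq_div_of_mul_eq hs1 ((mul_comm _ _).trans h)]
    exact div_mem (hmem r hr) (hmem s hs)

theorem rep_mem_ratOpAlg {K : IntermediateField k (RatFun k n)} {B : Set (Fin (n + 1))}
    (hK : IsFractionsOf K B) {a : Fin (n + 1)} {A : Weyl k n}
    (hA : A ∈ Algebra.adjoin k (gen (F := k) '' insert (Sum.inr a) (Sum.inl '' B))) :
    E.rep k A ∈ E.ratOpAlg K a := by
  have h : E.rep k A ∈ (Algebra.adjoin k
      (gen (F := k) '' insert (Sum.inr a) (Sum.inl '' B))).map (E.rep k) := ⟨A, hA, rfl⟩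
  rw [AlgHom.map_adjoin] at h
  refine Algebra.adjoin_mono ?_ h
  rintro _ ⟨_, ⟨l, hl, rfl⟩, rfl⟩
  rcases hl with rfl | ⟨b, hb, rfl⟩
  · rw [rep_gen]; exact Set.mem_insert _ _
  · rw [rep_gen]
    refine Set.mem_insert_of_mem _ ⟨RatFun.var k n b, (hK _).2 ⟨MvPolynomial.X b, ?_, 1, one_mem _,
      one_ne_zero, ?_⟩, rfl⟩
    · exact Algebra.subset_adjoin ⟨b, hb, rfl⟩
    · rw [map_one, one_mul]; rfl

variable [IsScalarTower k (RatFun k n) U]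

theorem rep_ofX (q : MvPolynomial (Fin (n + 1)) k) :
    E.rep k (ofX q) = E.mulOp (algebraMap _ (RatFun k n) q) := by
  have h : (E.rep k).comp ofX = ((Algebra.lmul k U).comp ((IsScalarTower.toAlgHom k (RatFun k n)
      U).comp (IsScalarTower.toAlgHom k (MvPolynomial (Fin (n + 1)) k) (RatFun k n)))) := by
    refine MvPolynomial.algHom_ext fun a => ?_
    simp only [AlgHom.comp_apply, ofX_X, rep_gen]
    rfl
  exact AlgHom.congr_fun h q

/-- Denominators can be collected on the left. If `s M` comes from the Weyl algebra, so does `s² ∂ M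
= (s ∂ - ∂(s)) s M`, and for a fraction `c` it suffices to multiply further by the denominator of
`c`. The induction shows that `M ↦ L M` preserves this property, which is the form suited to
products. -/
theorem exists_rep_eq_mul {K : IntermediateField k (RatFun k n)} {B : Set (Fin (n + 1))}
    (hK : IsFractionsOf K B) {a : Fin (n + 1)} {L : Module.End k U} (hL : L ∈ E.ratOpAlg K a) :
    ∃ s ∈ MvPolynomial.supported k B, s ≠ 0 ∧
      ∃ A ∈ Algebra.adjoin k (gen (F := k) '' insert (Sum.inr a) (Sum.inl '' B)),
        E.rep k (ofX s) * L = E.rep k A := by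
  set W := Algebra.adjoin k (gen (F := k) '' insert (Sum.inr a) (Sum.inl '' B)) with hW
  let P : Module.End k U → Prop := fun L => ∃ s ∈ MvPolynomial.supported k B, s ≠ 0 ∧
    ∃ A ∈ W, E.rep k (ofX s) * L = E.rep k A
  have hX : ∀ q ∈ MvPolynomial.supported k B, ofX q ∈ W := by
    intro q hq
    refine ofX_mem_adjoin ?_
    convert hq using 2
    ext b
    simp
  have hcomm : ∀ q r : MvPolynomial (Fin (n + 1)) k, ofX q * ofX r = ofX r * ofX q := fun q r => by
    rw [← map_mul, ← map_mul, mul_comm]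
  have hder : gen (Sum.inr a) ∈ W := Algebra.subset_adjoin ⟨_, Set.mem_insert _ _, rfl⟩
  have hadd : ∀ L₁ L₂, P L₁ → P L₂ → P (L₁ + L₂) := by
    rintro L₁ L₂ ⟨s, hs, hs0, A, hA, h⟩ ⟨s', hs', hs0', A', hA', h'⟩
    refine ⟨s * s', mul_mem hs hs', mul_ne_zero hs0 hs0', ofX s' * A + ofX s * A',
      add_mem (mul_mem (hX _ hs') hA) (mul_mem (hX _ hs) hA'), ?_⟩
    have h₁ : E.rep k (ofX (s * s')) = E.rep k (ofX s') * E.rep k (ofX s) := by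
      rw [← map_mul, ← map_mul, mul_comm]
    have h₂ : E.rep k (ofX (s * s')) = E.rep k (ofX s) * E.rep k (ofX s') := by
      rw [← map_mul, ← map_mul]
    rw [mul_add, map_add, map_mul (E.rep k), map_mul (E.rep k), ← h, ← h', ← mul_assoc,
      ← mul_assoc, ← h₁, ← h₂]
  have key : ∀ M, P M → P (L * M) := by
    induction hL using Algebra.adjoin_induction with
    | mem x hx =>
      rintro M ⟨s, hs, hs0, A, hA, h⟩
      rcases hx with rfl | ⟨c, hc, rfl⟩
      · have hD : (E.der a : U →ₗ[k] U) = E.rep k (gen (Sum.inr a)) := by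
          rw [rep_gen]
          rfl
        -- The derivative is a commutator of two elements of `W`, so it introduces no variables
        -- outside `B`.
        have hs' : ofX (MvPolynomial.pderiv a s) ∈ W := by
          have := der_mul_ofX (F := k) a s
          rw [← sub_eq_iff_eq_add'] at this
          rw [← this]
          exact sub_mem (mul_mem hder (hX s hs)) (mul_mem (hX s hs) hder)
        refine ⟨s * s, mul_mem hs hs, mul_ne_zero hs0 hs0,
          ofX s * gen (Sum.inr a) * A - ofX (MvPolynomial.pderiv a s) * A,
          sub_mem (mul_mem (mul_mem (hX s hs) hder) hA) (mul_mem hs' hA), ?_⟩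
        rw [map_sub, map_mul (E.rep k), map_mul (E.rep k) _ A, ← h, hD, ← mul_assoc, ← mul_assoc,
          ← mul_assoc, ← map_mul, ← map_mul, ← map_mul, ← sub_mul, ← map_sub, map_mul ofX,
          mul_assoc (ofX s) (gen _), der_mul_ofX, mul_add, hcomm (MvPolynomial.pderiv a s) s, ← mul_assoc,
          add_sub_cancel_right]
      · obtain ⟨r, hr, s', hs', hs0', hc⟩ := (hK c).1 hc
        refine ⟨s' * s, mul_mem hs' hs, mul_ne_zero hs0' hs0, ofX r * A,
          mul_mem (hX r hr) hA, ?_⟩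
        have hmul : ∀ x y : RatFun k n, E.mulOp (x * y) = E.mulOp x * E.mulOp y := by
          intro x y
          ext f
          simp [mulOp]
        rw [map_mul (E.rep k), ← h, ← mul_assoc, ← mul_assoc, rep_ofX, rep_ofX, rep_ofX, ← hmul,
          ← hmul, map_mul, ← hc]
        congr 2
        ring
    | algebraMap r =>
      rintro M ⟨s, hs, hs0, A, hA, h⟩
      refine ⟨s, hs, hs0, algebraMap k _ r * A, mul_mem (W.algebraMap_mem r) hA, ?_⟩
      rw [map_mul, AlgHom.commutes, ← h, ← mul_assoc, ← mul_assoc, Algebra.commutes]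
    | add x y _ _ hx hy =>
      intro M hM
      rw [add_mul]
      exact hadd _ _ (hx M hM) (hy M hM)
    | mul x y _ _ hx hy =>
      intro M hM
      rw [mul_assoc]
      exact hx _ (hy M hM)
  have h1 := key 1 ⟨1, one_mem _, one_ne_zero, 1, one_mem _, by rw [map_one, map_one, mul_one]⟩
  rwa [mul_one] at h1

end Denominators

/-! ### D-finite elements -/

variable [CharZero k] [IsScalarTower k (RatFun k n) U]

/-- Clearing denominators makes D-finiteness a property of the Weyl module `U`, so that the closure
properties of `IsAlgebraicFor` apply. -/
theorem isDFinite_iff_exists_weyl {f : U} : E.IsDFinite f ↔ ∀ a,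
    ∃ A ∈ Algebra.adjoin k (gen (F := k) '' insert (Sum.inr a) (Set.range Sum.inl)),
      A ≠ 0 ∧ E.rep k A f = 0 := by
  refine forall_congr' fun a => ?_
  constructor
  · rintro ⟨L, hL, hL0, hf⟩
    obtain ⟨s, -, hs0, A, hA, h⟩ := E.exists_rep_eq_mul isFractionsOf_top hL
    rw [Set.image_univ] at hA
    refine ⟨A, hA, ?_, ?_⟩
    · rintro rfl
      refine hL0 (LinearMap.ext fun g => E.rep_ofX_apply_eq_zero k hs0 ?_)
      rw [← Module.End.mul_apply, h, map_zero, LinearMap.zero_apply]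
    · rw [← h, Module.End.mul_apply, hf, map_zero]
  · rintro ⟨A, hA, hA0, hf⟩
    exact ⟨E.rep k A, E.rep_mem_ratOpAlg isFractionsOf_top (by rwa [Set.image_univ]),
      (map_ne_zero_iff _ (E.rep_injective k)).2 hA0, hf⟩

theorem isDFinite_iff {f : U} : E.IsDFinite f ↔
    letI := E.weylModule k; ∀ a, IsAlgebraicFor k n a f := by
  let := E.weylModule k
  rw [isDFinite_iff_exists_weyl]
  refine forall_congr' fun a => ⟨?_, fun h => h.exists_smul_eq_zero⟩
  rintro ⟨A, hA, hA0, hf⟩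
  exact isAlgebraicFor_of_smul_eq_zero hA hA0 hf

theorem isDFinite_zero : E.IsDFinite (0 : U) :=
  let := E.weylModule k
  E.isDFinite_iff.2 fun _ => .zero

theorem IsDFinite.add {f g : U} (hf : E.IsDFinite f) (hg : E.IsDFinite g) :
    E.IsDFinite (f + g) := by
  let := E.weylModule k
  rw [isDFinite_iff] at *
  exact fun a => (hf a).add (hg a)

theorem IsDFinite.rep_apply {f : U} (hf : E.IsDFinite f) (A : Weyl k n) :
    E.IsDFinite (E.rep k A f) := by
  let := E.weylModule k
  rw [isDFinite_iff] at *
  exact fun a => (hf a).smul A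

/-! ### Closed forms -/

/-- A form that is `d_s`-closed is `d_s`-exact after applying an operator. -/
theorem exists_d_eq (s : ℕ) (hs : s ≤ n) (V : Finset (Letter n)) (hV : ∀ l ∈ V, s < l.index)
    (hcard : n - s ≤ V.card) {ω : Form n U} (hω : E.IsDForm ω) (hd : E.d s ω = 0) :
    ∃ L ∈ Algebra.adjoin k (gen (F := k) '' (Letter.tPart n ∪ (V : Set (Letter n)))), L ≠ 0 ∧
      ∃ μ : Form n U, E.IsDForm μ ∧ E.act (E.rep k L) ω = E.d s μ := by
  let := E.weylModule k
  -- This submodule is torsion-free since `U` is a field, and of finite rank since its generators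
  -- are D-finite. Any primitive found in it automatically has D-finite coefficients.
  let N := Submodule.span (Weyl k n) (Set.range ω)
  let e : Form n N := fun I => ⟨ω I, Submodule.subset_span ⟨I, rfl⟩⟩
  have hspan : Submodule.span (Weyl k n) (Set.range e) = ⊤ := by
    refine Submodule.map_injective_of_injective N.injective_subtype ?_
    rw [Submodule.map_span, ← Set.range_comp, Submodule.map_top, Submodule.range_subtype]
    rfl
  have halg : ∀ a I, IsAlgebraicFor k n a (e I) := by
    intro a I
    obtain ⟨A, hA, hA0, h⟩ := E.isDFinite_iff_exists_weyl.1 (hω I) a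
    exact isAlgebraicFor_of_smul_eq_zero hA hA0 (Subtype.ext h)
  have htf : IsTorsionFree k n N := by
    intro q f hf
    by_cases hq : q = 0
    · exact Or.inl hq
    · exact Or.inr (Subtype.ext (E.rep_ofX_apply_eq_zero k hq (congrArg Subtype.val hf)))
  obtain ⟨S, hS, hsat⟩ := exists_finite_sat_eq_top e hspan halg
  have hde : formD k s e = 0 := by
    have h := formD_map N.subtype s e
    have h' : formD k s ω = 0 := by rwa [E.d_eq_formD k] at hd
    ext J
    exact (congrFun h J).symm.trans (congrFun h' J)
  obtain ⟨L, hL, hL0, μ, hμ⟩ := exists_formD_eq htf hS hsat s hs V hV hcard e hde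
  refine ⟨L, hL, hL0, fun I => μ I, fun I => ?_, ?_⟩
  · suffices H : ∀ f ∈ N, E.IsDFinite f from H _ (μ I).2
    intro f hf
    induction hf using Submodule.span_induction with
    | mem x hx => obtain ⟨I, rfl⟩ := hx; exact hω I
    | zero => exact E.isDFinite_zero
    | add x y _ _ hx hy => exact hx.add E hy
    | smul A x _ hx => exact hx.rep_apply E A
  · rw [E.d_eq_formD k]
    refine Eq.trans ?_ (formD_map N.subtype s μ).symm
    rw [← hμ]
    rfl

/-- `d_s` raises the degree by one, so the components of a primitive outside degree `p - 1` may be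
replaced by zero. -/
theorem exists_isPForm_d_eq (s p : ℕ) (hs : s ≤ n) (V : Finset (Letter n))
    (hV : ∀ l ∈ V, s < l.index) (hcard : n - s ≤ V.card) {ω : Form n U} (hω : E.IsPForm p ω)
    (hd : E.d s ω = 0) :
    ∃ L ∈ E.opAlg (Letter.tPart n ∪ (V : Set (Letter n))), L ≠ 0 ∧
      ∃ μ : Form n U, E.IsPForm ((p : ℤ) - 1) μ ∧ E.act L ω = E.d s μ := by
  obtain ⟨L, hL, hL0, μ, hμ, h⟩ := E.exists_d_eq s hs V hV hcard hω.1 hd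
  refine ⟨E.rep k L, E.rep_mem_opAlg hL, (map_ne_zero_iff _ (E.rep_injective k)).2 hL0,
    fun I => if (I.card : ℤ) = p - 1 then μ I else 0, ⟨fun I => ?_, fun I hI => ?_⟩, ?_⟩
  · dsimp only
    split_ifs
    · exact hμ I
    · exact E.isDFinite_zero
  · by_contra hne
    exact hI (if_neg hne)
  · ext J
    have hcardJ : ∀ j ∈ J, ((J.erase j).card : ℤ) = J.card - 1 := by
      intro j hj
      rw [← Finset.card_erase_add_one hj]
      push_cast
      ring
    by_cases hJ : J.card = p
    · refine (congrFun h J).trans (Finset.sum_congr rfl fun j hj => ?_)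
      dsimp only
      rw [if_pos (by rw [hcardJ j (Finset.mem_filter.1 hj).1, hJ])]
    · have hωJ : ω J = 0 := by
        by_contra hne
        exact hJ (by exact_mod_cast hω.2 J hne)
      refine (congrArg (E.rep k L) hωJ).trans ((map_zero _).trans (Finset.sum_eq_zero ?_).symm)
      intro j hj
      dsimp only
      rw [if_neg, map_zero, mul_zero]
      rw [hcardJ j (Finset.mem_filter.1 hj).1]
      intro h'
      exact hJ (by omega)

end DiffExt

end

/-! ### Telescopers, and certificates evaluated on forms -/

noncomputable section

namespace DiffExt

open Weyl

variable {k : Type u} [Field k] {n : ℕ} {U : Type v} [Field U] [Algebra k U]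
  [Algebra (RatFun k n) U] (E : DiffExt k n U)

/-! ### Telescopers -/

theorem insert_inr_image_inl_eq_tPart :
    (insert (Sum.inr 0) (Sum.inl '' {0}) : Set (Letter n)) = Letter.tPart n := by
  rw [Set.image_singleton, Letter.tPart, Set.pair_comm]

theorem index_of_mem_tPart (s : ℕ) : ∀ l ∈ Letter.tPart n, l.index = 0 ∨ s < l.index := by
  rintro _ (rfl | rfl) <;> exact Or.inl rfl

theorem rep_mem_ratOpAlg_fieldT {A : Weyl k n}
    (hA : A ∈ Algebra.adjoin k (gen (F := k) '' Letter.tPart n)) :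
    E.rep k A ∈ E.ratOpAlg (RatFun.fieldT k n) 0 :=
  E.rep_mem_ratOpAlg isFractionsOf_fieldT (by rwa [insert_inr_image_inl_eq_tPart])

theorem act_zero (L : Module.End k U) : E.act L 0 = 0 :=
  funext fun _ => map_zero L

section Telescoper

variable [CharZero k] [IsScalarTower k (RatFun k n) U]

theorem IsDForm.act_rep {ω : Form n U} (hω : E.IsDForm ω) (A : Weyl k n) :
    E.IsDForm (E.act (E.rep k A) ω) :=
  fun I => (hω I).rep_apply E A

/-- Clearing denominators in an operator from `k(t)⟨∂_t⟩`. -/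
theorem exists_rep_eq_rep_mul {L : Module.End k U}
    (hL : L ∈ E.ratOpAlg (RatFun.fieldT k n) 0) (hL0 : L ≠ 0) :
    ∃ S ∈ Algebra.adjoin k (gen (F := k) '' Letter.tPart n),
      ∃ A ∈ Algebra.adjoin k (gen (F := k) '' Letter.tPart n), A ≠ 0 ∧
        E.rep k A = E.rep k S * L := by
  obtain ⟨q, hq, hq0, A, hA, h⟩ := E.exists_rep_eq_mul isFractionsOf_fieldT hL
  rw [insert_inr_image_inl_eq_tPart] at hA
  refine ⟨ofX q, ofX_mem_adjoin ?_, A, hA, ?_, h.symm⟩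
  · convert hq using 2
    ext b
    simp [Letter.tPart]
  · rintro rfl
    refine hL0 (LinearMap.ext fun g => E.rep_ofX_apply_eq_zero k hq0 ?_)
    rw [← Module.End.mul_apply, h, map_zero, LinearMap.zero_apply]

/-- The case `s = n` with `V` empty, applied to `A ω`: the resulting operator involves only `t` and
`∂_t`, and its product with `A` is nonzero because the Weyl algebra has no zero divisors. -/
theorem exists_isTelescoper {ω : Form n U} (hω : E.IsDForm ω) {A : Weyl k n}
    (hA : A ∈ Algebra.adjoin k (gen (F := k) '' Letter.tPart n)) (hA0 : A ≠ 0)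
    (hd : E.d n (E.act (E.rep k A) ω) = 0) : ∃ L, E.IsTelescoper L ω := by
  obtain ⟨L, hL, hL0, μ, hμ, h⟩ := E.exists_d_eq n le_rfl ∅ (by simp) (by simp)
    (hω.act_rep E A) hd
  rw [Finset.coe_empty, Set.union_empty] at hL
  refine ⟨E.rep k (L * A), E.rep_mem_ratOpAlg_fieldT (mul_mem hL hA),
    (map_ne_zero_iff _ (E.rep_injective k)).2 (mul_ne_zero hL0 hA0), μ, hμ, ?_⟩
  rw [map_mul]
  exact h

/-- The parametrized Poincaré lemma. -/
theorem IsTClosed.isTExact {ω : Form n U} (hω : E.IsDForm ω) (h : E.IsTClosed ω) :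
    E.IsTExact ω := by
  obtain ⟨L, hL, hL0, hd⟩ := h
  -- Denominators in `t` are cleared because `d_rep_act` concerns polynomial operators only.
  obtain ⟨S, hS, A, hA, hA0, hSA⟩ := E.exists_rep_eq_rep_mul hL hL0
  refine E.exists_isTelescoper hω hA hA0 ?_
  rw [hSA]
  change E.d n (E.act (E.rep k S) (E.act L ω)) = 0
  rw [E.d_rep_act n (index_of_mem_tPart n) hS, hd, act_zero]

/-- With denominators cleared, operators in `t` and `∂_t` commute with `d`. Thus `L ω = dη` gives `L
dω = d dη = 0`, and conversely `L dω = 0` says that `L ω` is closed. -/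
theorem exists_isTelescoper_iff {ω : Form n U} (hω : E.IsDForm ω) :
    (∃ L, E.IsTelescoper L ω) ↔
      ∃ L ∈ E.ratOpAlg (RatFun.fieldT k n) 0, L ≠ 0 ∧ E.act L (E.d n ω) = 0 := by
  constructor
  · rintro ⟨L, hL, hL0, η, -, h⟩
    obtain ⟨S, hS, A, hA, hA0, hSA⟩ := E.exists_rep_eq_rep_mul hL hL0
    refine ⟨E.rep k A, E.rep_mem_ratOpAlg_fieldT hA,
      (map_ne_zero_iff _ (E.rep_injective k)).2 hA0, ?_⟩
    rw [← E.d_rep_act n (index_of_mem_tPart n) hA, hSA]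
    change E.d n (E.act (E.rep k S) (E.act L ω)) = 0
    rw [E.d_rep_act n (index_of_mem_tPart n) hS, h, E.d_d n le_rfl, act_zero]
  · rintro ⟨L, hL, hL0, h⟩
    obtain ⟨S, hS, A, hA, hA0, hSA⟩ := E.exists_rep_eq_rep_mul hL hL0
    refine E.exists_isTelescoper hω hA hA0 ?_
    rw [E.d_rep_act n (index_of_mem_tPart n) hA, hSA]
    change E.act (E.rep k S) (E.act L (E.d n ω)) = 0
    rw [h, act_zero]

end Telescoper

/-! ### Operators given by codes -/

section Codes

variable {k₀ : Subfield k}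

theorem evalCode_eq_rep (c : OpCode k₀ n) : E.evalCode c = E.rep k₀ (codeEval gen c) := by
  rw [rep_codeEval]
  rfl

/-- D-finiteness refers to operators over `k`, so a code over `k₀` is reread as a code over `k`. -/
theorem exists_evalCode_eq_rep (c : OpCode k₀ n) : ∃ A : Weyl k n, E.evalCode c = E.rep k A := by
  refine ⟨codeEval gen (c.map fun q => ((q.1 : k), q.2)), ?_⟩
  rw [rep_codeEval, codeEval, List.map_map]
  rfl

theorem isDFinite_applyTable [CharZero k] [IsScalarTower k (RatFun k n) U]
    (M : Finset (Fin n) → Finset (Fin n) → OpCode k₀ n) {ω : Form n U} (hω : E.IsDForm ω) :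
    E.IsDForm (E.applyTable M ω) := by
  intro J
  refine Finset.sum_induction _ E.IsDFinite (fun _ _ hf hg => hf.add E hg) E.isDFinite_zero
    fun I _ => ?_
  obtain ⟨A, hA⟩ := E.exists_evalCode_eq_rep (M J I)
  rw [hA]
  exact (hω I).rep_apply E A

theorem applyTable_eq_zero {M : Finset (Fin n) → Finset (Fin n) → OpCode k₀ n}
    {J : Finset (Fin n)} (hJ : ∀ I, M J I = []) (ω : Form n U) : E.applyTable M ω J = 0 := by
  refine Finset.sum_eq_zero fun I _ => ?_
  rw [hJ I]
  rfl

/-- The formal identity of `exists_certificate` implies an identity between forms. -/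
theorem evalCode_apply_eq_d_applyTable [CharZero k] {s : ℕ} {L : OpCode k₀ n}
    {A : Fin (n + 1) → Finset (Fin n) → OpCode k₀ n}
    {M : Finset (Fin n) → Finset (Fin n) → OpCode k₀ n} {J : Finset (Fin n)}
    {q : MvPolynomial (Fin (n + 1)) k₀} (hq : q ≠ 0)
    {B : Fin (n + 1) → Finset (Fin n) → Weyl k₀ n} {R : Finset (Fin n) → Weyl k₀ n}
    (h : ∀ I, ofX q * ((if J = I then codeEval gen L else 0) -
      ∑ J', formDCoeff k₀ s J J' * codeEval gen (M J' I)) =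
      ∑ a, B a I * codeEval gen (A a I) + ∑ J', R J' * formDCoeff k₀ s J' I)
    {ω : Form n U} (hA : ∀ a I, E.evalCode (A a I) (ω I) = 0) (hd : E.d s ω = 0) :
    E.evalCode L (ω J) = E.d s (E.applyTable M ω) J := by
  let := E.weylModule k₀
  have hcode : ∀ (c : OpCode k₀ n) (f : U), E.evalCode c f = codeEval (gen (F := k₀)) c • f := by
    intro c f
    rw [evalCode_eq_rep]
    rfl
  have hd' : ∀ η : Form n U, ∀ J, E.d s η J = ∑ I, formDCoeff k₀ s J I • η I := by
    intro η J
    rw [E.d_eq_formD k₀, formD_apply_eq_sum]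
  -- The identity for column `I` is applied to `ω I`, and the results are added. The terms with `A`
  -- vanish, those with `R` assemble to `R J'` applied to coefficients of `d_s ω = 0`, and the
  -- factor `q` cancels because `U` is a field.
  have hsum := Finset.sum_congr (rfl : (Finset.univ : Finset (Finset (Fin n))) = _)
    fun I _ => congrArg (· • ω I) (h I)
  simp only [mul_smul, sub_smul, add_smul, Finset.sum_smul, ite_smul, zero_smul, ← hcode, hA,
    smul_zero, Finset.sum_const_zero, zero_add] at hsum
  have hM : ∑ I, ∑ J', formDCoeff k₀ s J J' • E.evalCode (M J' I) (ω I) =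
      E.d s (E.applyTable M ω) J := by
    rw [hd', Finset.sum_comm]
    refine Finset.sum_congr rfl fun J' _ => ?_
    rw [applyTable, Finset.smul_sum]
  have hR : ∑ I, ∑ J', R J' • formDCoeff k₀ s J' I • ω I = 0 := by
    rw [Finset.sum_comm]
    refine Finset.sum_eq_zero fun J' _ => ?_
    rw [← Finset.smul_sum, ← hd', hd, Pi.zero_apply, smul_zero]
  rw [← Finset.smul_sum, Finset.sum_sub_distrib, Finset.sum_ite_eq, if_pos (Finset.mem_univ _),
    hM, hR] at hsum
  exact sub_eq_zero.1 (E.rep_ofX_apply_eq_zero k₀ hq hsum)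

end Codes

theorem exists_partrec_isPForm_d_eq [CharZero k] [IsScalarTower k (RatFun k n) U] (s p : ℕ)
    (hs : s ≤ n) (V : Finset (Letter n)) (hV : ∀ l ∈ V, s < l.index) (hcard : n - s ≤ V.card)
    (k₀ : Subfield k) [Primcodable k₀] (hk₀ : IsComputableField k₀) :
    ∃ F : (Fin (n + 1) → Finset (Fin n) → OpCode k₀ n) →.
        OpCode k₀ n × (Finset (Fin n) → Finset (Fin n) → OpCode k₀ n),
      Partrec F ∧
      ∀ A : Fin (n + 1) → Finset (Fin n) → OpCode k₀ n, E.IsAnnihilatorData A →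
        ∃ out ∈ F A,
          out.1.UsesOnly (Letter.tPart n ∪ (V : Set (Letter n))) ∧
          E.evalCode out.1 ≠ 0 ∧
          ∀ ω : Form n U, E.IsPForm p ω → (∀ a I, E.evalCode (A a I) (ω I) = 0) →
            E.d s ω = 0 →
            E.IsPForm ((p : ℤ) - 1) (E.applyTable out.2 ω) ∧
              E.act (E.evalCode out.1) ω = E.d s (E.applyTable out.2 ω) := by
  obtain ⟨G, hG, h⟩ := exists_partrec_certificate hk₀ s p hs V hV hcard
  have hne : ∀ c : OpCode k₀ n, E.evalCode c ≠ 0 ↔ codeEval (gen (F := k₀)) c ≠ 0 := fun c => by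
    rw [evalCode_eq_rep, map_ne_zero_iff _ (E.rep_injective k₀)]
  refine ⟨G, hG, fun A hA => ?_⟩
  obtain ⟨out, hout, h1, h2, h3, h4⟩ := h A fun a I => ⟨(hA a I).1, (hne _).1 (hA a I).2⟩
  refine ⟨out, hout, h1, (hne _).2 h2, fun ω hω hAω hd =>
    ⟨⟨E.isDFinite_applyTable _ hω.1, fun J hJ => ?_⟩, funext fun J => ?_⟩⟩
  · by_contra hne
    refine hJ (E.applyTable_eq_zero (fun I => h3 J I fun h => hne ?_) ω)
    rw [← h]
    push_cast
    ring
  · by_cases hJ : J.card = p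
    · obtain ⟨q, hq, B, R, hI⟩ := h4 J hJ
      exact E.evalCode_apply_eq_d_applyTable hq hI hAω hd
    · have hωJ : ω J = 0 := by
        by_contra hne
        exact hJ (by exact_mod_cast hω.2 J hne)
      refine (congrArg (E.evalCode out.1) hωJ).trans ((map_zero _).trans (Finset.sum_eq_zero ?_).symm)
      intro j hj
      rw [E.applyTable_eq_zero (fun I => h3 _ I ?_), map_zero, mul_zero]
      rwa [Finset.card_erase_add_one (Finset.mem_filter.1 hj).1]

end DiffExt

end

theorem theorem3p6 {k : Type u} [Field k] [IsAlgClosed k] [CharZero k] (n : ℕ)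
    {U : Type v} [Field U] [Algebra k U] [Algebra (RatFun k n) U]
    [IsScalarTower k (RatFun k n) U] (E : DiffExt k n U) :
    -- the theorem for `d_s`
    (∀ (s : ℕ) (p : ℕ) (V : Finset (Letter n)), s ≤ n → (∀ l ∈ V, s < l.index) →
      V.card = n - s →
      -- existence of `L` and `μ`, for all forms
      (∀ ω : Form n U, E.IsPForm p ω → E.d s ω = 0 →
        ∃ L ∈ E.opAlg (Letter.tPart n ∪ (V : Set (Letter n))), L ≠ 0 ∧
          ∃ μ : Form n U, E.IsPForm ((p : ℤ) - 1) μ ∧ E.act L ω = E.d s μ) ∧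
      -- over a computable field of constants, an algorithm finds `L` and operators giving `μ`
      -- from annihilating operators of the coefficients of `ω`
      (∀ (k₀ : Subfield k) [Primcodable k₀], IsComputableField k₀ →
        ∃ F : (Fin (n + 1) → Finset (Fin n) → OpCode k₀ n) →.
            OpCode k₀ n × (Finset (Fin n) → Finset (Fin n) → OpCode k₀ n),
          Partrec F ∧
          ∀ A : Fin (n + 1) → Finset (Fin n) → OpCode k₀ n, E.IsAnnihilatorData A →
            ∃ out ∈ F A,
              out.1.UsesOnly (Letter.tPart n ∪ (V : Set (Letter n))) ∧
              E.evalCode out.1 ≠ 0 ∧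
              ∀ ω : Form n U, E.IsPForm p ω → (∀ a I, E.evalCode (A a I) (ω I) = 0) →
                E.d s ω = 0 →
                E.IsPForm ((p : ℤ) - 1) (E.applyTable out.2 ω) ∧
                  E.act (E.evalCode out.1) ω = E.d s (E.applyTable out.2 ω))) ∧
    -- the parametrized Poincaré lemma
    (∀ ω : Form n U, E.IsDForm ω → E.IsTClosed ω → E.IsTExact ω) ∧
    -- the criterion for the existence of telescopers
    (∀ ω : Form n U, E.IsDForm ω →
      ((∃ L, E.IsTelescoper L ω) ↔
        ∃ L ∈ E.ratOpAlg (RatFun.fieldT k n) 0, L ≠ 0 ∧ E.act L (E.d n ω) = 0)) := by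
  refine ⟨fun s p V hs hV hcard => ⟨fun ω hω hd => ?_, fun k₀ _ hk₀ => ?_⟩,
    fun ω hω h => h.isTExact E hω, fun ω hω => E.exists_isTelescoper_iff hω⟩
  · exact E.exists_isPForm_d_eq s p hs V hV hcard.ge hω hd
  · exact E.exists_partrec_isPForm_d_eq s p hs V hV hcard.ge k₀ hk₀
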